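/- Let $d\in\mathbb N$ and let $\Omega$ be either $C_0([0,\infty[,\mathbb R^d)$ with the topology of uniform convergence on compact sets, or $D_0([0,\infty[,\mathbb R^d)$ (càdlàg paths) with the Skorokhod topology; the index $0$ means that paths start at $0$. For $0\le t<\infty$ let $\Omega_t$ be, respectively, $C_0([0,t],\mathbb R^d)$ with the uniform topology, or $D_0([0,t[,\mathbb R^d)$ with the topology carried over from $D_0([0,\infty[,\mathbb R^d)$ by the time change $u\mapsto u/(t-u)$ (a single point if $t=0$), and let $\Omega_\infty=\Omega$. Through the restriction map $\Omega\to\Omega_t$, functions and open sets of $\Omega_t$ are viewed as functions and subsets of $\Omega$; let ${\cal B}_t$ be the $\sigma$-algebra on $\Omega$ generated by the open sets of $\Omega_t$. Let $1\le p<\infty$, let ${\cal P}$ be a weakly relatively compact set of Borel probability measures on $\Omega$, and let $c(f)=\sup_{R\in{\cal P}}E_R(|f|^p)^{1/p}$ for $f\in C_b(\Omega)$. Let $L^1(c)$ be the completion and separation of $C_b(\Omega)$ with respect to $c$, ordered by the closure of the cone of nonnegative functions of $C_b(\Omega)$, and let $L^1_t(c)$ be the closure of $C_b(\Omega_t)$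 in $L^1(c)$. Let $P$ be a probability measure on $\Omega$ with $|E_P(f)|\le c(f)$ for all $f\in C_b(\Omega)$ which belongs to the canonical $c$-class: for $X,Y\in L^1(c)$, $X=Y$ $P$-a.s. if and only if $X=Y$ in $L^1(c)$. Let $(\rho_{st})_{0\le s\le t\le\infty}$ be a dynamic risk measure on $L^1(c)$: maps $\rho_{st}:L^1_t(c)\to L^1_s(c)$ such that $\rho_{st}(X)\ge\rho_{st}(Y)$ if $X\le Y$; $\rho_{st}(X+Y)=\rho_{st}(X)-Y$ for $X\in L^1_t(c)$, $Y\in L^1_s(c)$; and $\rho_{st}(\lambda X+(1-\lambda)Y)\le\lambda\rho_{st}(X)+(1-\lambda)\rho_{st}(Y)$ for $0\le\lambda\le1$. Fix $s\le t$. Let ${\cal Q}_{s,t}(P)$ be the set of probability measures $Q$ on $(\Omega,{\cal B}_t)$ which define a continuous linear form on $L^1_t(c)$ and whose restriction to ${\cal B}_s$ equals that of $P$. For such $Q$ let $$\alpha^m_{st}(Q)=Q\text{-}\operatorname{ess\,sup}\{E_Q(-X\mid{\cal B}_s)\;:\;X\in L^1_t(c),\ \rho_{st}(X)\le 0\},$$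 a ${\cal B}_s$-measurable function with values in $\,]-\infty,+\infty]$. Assume that $\tilde\rho_{st}=E_P\circ\rho_{st}:L^1_t(c)\to\mathbb R$ satisfies $\tilde\rho_{st}(0)=0$ and that $\tilde\rho_{st}\le\varphi$ on $L^1_t(c)$ for some sublinear risk measure $\varphi:L^1_t(c)\to\mathbb R$, that is, a monotone map ($\varphi(X)\ge\varphi(Y)$ if $X\le Y$) with $\varphi(X+a)=\varphi(X)-a$ for $a\in\mathbb R$, which is subadditive and positively homogeneous. Then for every $X\in L^1_t(c)$ there is $Q_X\in{\cal Q}_{s,t}(P)$ such that $$\rho_{st}(X)=E_{Q_X}(-X\mid{\cal B}_s)-\alpha^m_{st}(Q_X)=P\text{-}\operatorname*{ess\,sup}_{Q\in{\cal Q}_{s,t}(P)}\bigl(E_Q(-X\mid{\cal B}_s)-\alpha^m_{st}(Q)\bigr)\qquad P\text{-a.s.}$$ -/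

import Mathlib

open MeasureTheory Filter Topology UniformSpace
open scoped NNReal ENNReal BoundedContinuousFunction

noncomputable section

/-! ### Continuous paths -/

/-- `C_0([0,T], ℝ^d)` for `T < ∞` and `C_0([0,∞[, ℝ^d)` for `T = ∞`: continuous paths starting at
`0`, with the topology of uniform convergence on compact sets. -/
def ContPath (d : ℕ) (T : ℝ≥0∞) : Type :=
  {x : C({u : ℝ≥0 // (u : ℝ≥0∞) ≤ T}, EuclideanSpace ℝ (Fin d)) // x ⟨0, by simp⟩ = 0}

instance (d : ℕ) (T : ℝ≥0∞) : TopologicalSpace (ContPath d T) :=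
  inferInstanceAs (TopologicalSpace
    {x : C({u : ℝ≥0 // (u : ℝ≥0∞) ≤ T}, EuclideanSpace ℝ (Fin d)) // x ⟨0, by simp⟩ = 0})

/-- The restriction of a continuous path on `[0,∞[` to `[0,T]`. -/
def ContPath.restrict {d : ℕ} (T : ℝ≥0∞) (x : ContPath d ⊤) : ContPath d T :=
  ⟨x.1.comp ⟨fun u => ⟨u.1, le_top⟩, by fun_prop⟩, x.2⟩

/-! ### The Skorokhod distance -/

/-- `g_m`: equal to `1` on `[0,m-1]`, to `m - u` on `[m-1,m]` and to `0` on `[m,∞[`. -/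
def skorokhodCutoff (m : ℕ) (u : ℝ≥0) : ℝ := max 0 (min 1 ((m : ℝ) - u))

/-- The distance `d_m(g_m x, g_m y)`: infimum over the increasing homeomorphisms `e` of `[0,m]` of
`max (‖e - id‖_∞, ‖g_m x - (g_m y) ∘ e‖_∞)`. -/
def skorokhodDistOn {E : Type*} [NormedAddCommGroup E] [NormedSpace ℝ E] (m : ℕ)
    (x y : ℝ≥0 → E) : ℝ≥0∞ :=
  ⨅ e : Set.Icc (0 : ℝ≥0) m ≃o Set.Icc (0 : ℝ≥0) m,
    max (⨆ u : Set.Icc (0 : ℝ≥0) m, edist (e u : ℝ≥0) (u : ℝ≥0))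
      (⨆ u : Set.Icc (0 : ℝ≥0) m,
        edist (skorokhodCutoff m u • x u) (skorokhodCutoff m (e u) • y (e u)))

/-- The distance `d_∞(x,y) = ∑_{m ≥ 1} 2^{-m} (1 ∧ d_m(g_m x, g_m y))` on functions on `[0,∞[`. -/
def skorokhodDist {E : Type*} [NormedAddCommGroup E] [NormedSpace ℝ E] (x y : ℝ≥0 → E) : ℝ≥0∞ :=
  ∑' m : ℕ, ((2 : ℝ≥0∞) ^ (m + 1))⁻¹ * min 1 (skorokhodDistOn (m + 1) x y)

section
variable {E : Type*} [NormedAddCommGroup E] [NormedSpace ℝ E]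

theorem skorokhodDistOn_self (m : ℕ) (x : ℝ≥0 → E) : skorokhodDistOn m x x = 0 := by
  refine le_antisymm (iInf_le_of_le (OrderIso.refl _) ?_) zero_le
  simp

theorem skorokhodDistOn_comm_le (m : ℕ) (x y : ℝ≥0 → E) :
    skorokhodDistOn m x y ≤ skorokhodDistOn m y x := by
  refine le_iInf fun e => iInf_le_of_le e.symm ?_
  refine max_le_max (iSup_le fun u => ?_) (iSup_le fun u => ?_)
  · refine le_iSup_of_le (e.symm u) ?_
    rw [OrderIso.apply_symm_apply, edist_comm]
  · refine le_iSup_of_le (e.symm u) ?_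
    rw [OrderIso.apply_symm_apply, edist_comm]

theorem skorokhodDistOn_triangle (m : ℕ) (x y z : ℝ≥0 → E) :
    skorokhodDistOn m x z ≤ skorokhodDistOn m x y + skorokhodDistOn m y z := by
  unfold skorokhodDistOn
  rw [ENNReal.iInf_add]
  refine le_iInf fun e => ?_
  rw [ENNReal.add_iInf]
  refine le_iInf fun e' => iInf_le_of_le (e.trans e') (max_le ?_ ?_)
  · refine iSup_le fun u => ?_
    refine (edist_triangle _ ((e u : Set.Icc (0 : ℝ≥0) m) : ℝ≥0) _).trans ?_
    rw [add_comm]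
    refine add_le_add ((le_iSup_of_le (f := fun v => edist (e v : ℝ≥0) (v : ℝ≥0)) u le_rfl).trans
      (le_max_left _ _)) ?_
    exact (le_iSup_of_le (f := fun v => edist (e' v : ℝ≥0) (v : ℝ≥0)) (e u) le_rfl).trans
      (le_max_left _ _)
  · refine iSup_le fun u => ?_
    refine (edist_triangle _ (skorokhodCutoff m (e u) • y (e u)) _).trans ?_
    refine add_le_add ((le_iSup_of_le (f := fun v : Set.Icc (0 : ℝ≥0) m =>
      edist (skorokhodCutoff m v • x v) (skorokhodCutoff m (e v) • y (e v))) u le_rfl).trans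
      (le_max_right _ _)) ?_
    exact (le_iSup_of_le (f := fun v : Set.Icc (0 : ℝ≥0) m =>
      edist (skorokhodCutoff m v • y v) (skorokhodCutoff m (e' v) • z (e' v))) (e u) le_rfl).trans
      (le_max_right _ _)

theorem skorokhodDist_self (x : ℝ≥0 → E) : skorokhodDist x x = 0 := by
  simp [skorokhodDist, skorokhodDistOn_self]

theorem skorokhodDist_comm (x y : ℝ≥0 → E) : skorokhodDist x y = skorokhodDist y x := by
  unfold skorokhodDist
  congr 1
  ext m
  rw [le_antisymm (skorokhodDistOn_comm_le (m + 1) x y) (skorokhodDistOn_comm_le (m + 1) y x)]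

theorem skorokhodDist_triangle (x y z : ℝ≥0 → E) :
    skorokhodDist x z ≤ skorokhodDist x y + skorokhodDist y z := by
  unfold skorokhodDist
  rw [← ENNReal.tsum_add]
  refine ENNReal.tsum_le_tsum fun m => ?_
  rw [← mul_add]
  gcongr
  refine (min_le_min_left 1 (skorokhodDistOn_triangle (m + 1) x y z)).trans ?_
  rcases le_total 1 (skorokhodDistOn (m + 1) x y) with h | h
  · rw [min_eq_left h]; exact (min_le_left _ _).trans le_self_add
  · rcases le_total 1 (skorokhodDistOn (m + 1) y z) with h' | h'
    · rw [min_eq_left h']; exact (min_le_left _ _).trans le_add_self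
    · rw [min_eq_right h, min_eq_right h']; exact min_le_right _ _

end

/-! ### Càdlàg paths -/

/-- `D_0([0,T[, ℝ^d)` (`T = ∞` allowed): right continuous paths on `[0,T[` with left limits, starting
at `0`. For `T = 0` the interval is empty and there is exactly one path. -/
def CadlagPath (d : ℕ) (T : ℝ≥0∞) : Type :=
  {x : {u : ℝ≥0 // (u : ℝ≥0∞) < T} → EuclideanSpace ℝ (Fin d) //
    (∀ u, Tendsto x (𝓝[>] u) (𝓝 (x u)) ∧ ∃ l, Tendsto x (𝓝[<] u) (𝓝 l)) ∧
      ∀ u : {u : ℝ≥0 // (u : ℝ≥0∞) < T}, (u : ℝ≥0) = 0 → x u = 0}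

/-- The inverse of `u ↦ u / (T - u)` from `[0,T[` onto `[0,∞[` if `T < ∞`; the identity if
`T = ∞`. -/
def timeChange (T : ℝ≥0∞) (v : ℝ≥0) : ℝ≥0 := if T = ⊤ then v else T.toNNReal * (v / (1 + v))

/-- The path `x ∘ α_T⁻¹` on `[0,∞[`, where `α_T u = u / (T - u)` (`α_∞ = id`). The default value is
used only for `T = 0`. -/
def CadlagPath.rescale {d : ℕ} {T : ℝ≥0∞} (x : CadlagPath d T) (v : ℝ≥0) :
    EuclideanSpace ℝ (Fin d) :=
  if h : (timeChange T v : ℝ≥0∞) < T then x.1 ⟨timeChange T v, h⟩ else 0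

/-- For `T = ∞` this is the Skorokhod topology on `D_0([0,∞[)`; for `T < ∞` it is the uniform
Skorokhod topology on compact sets of `[0,T[`. -/
instance (d : ℕ) (T : ℝ≥0∞) : PseudoEMetricSpace (CadlagPath d T) where
  edist x y := skorokhodDist x.rescale y.rescale
  edist_self _ := skorokhodDist_self _
  edist_comm _ _ := skorokhodDist_comm _ _
  edist_triangle _ _ _ := skorokhodDist_triangle _ _ _

/-- The restriction of a càdlàg path on `[0,∞[` to `[0,T[`. -/
def CadlagPath.restrict {d : ℕ} (T : ℝ≥0∞) (x : CadlagPath d ⊤) : CadlagPath d T :=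
  ⟨fun u => x.1 ⟨u.1, ENNReal.coe_lt_top⟩, by
    have hc : Continuous fun u : {u : ℝ≥0 // (u : ℝ≥0∞) < T} =>
        (⟨u.1, ENNReal.coe_lt_top⟩ : {u : ℝ≥0 // (u : ℝ≥0∞) < ⊤}) := by fun_prop
    refine ⟨fun u => ⟨?_, ?_⟩, fun u hu => x.2.2 _ hu⟩
    · exact (x.2.1 ⟨u.1, ENNReal.coe_lt_top⟩).1.comp
        (hc.continuousWithinAt.tendsto_nhdsWithin fun v hv => hv)
    · obtain ⟨l, hl⟩ := (x.2.1 ⟨u.1, ENNReal.coe_lt_top⟩).2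
      exact ⟨l, hl.comp (hc.continuousWithinAt.tendsto_nhdsWithin fun v hv => hv)⟩⟩

/-! ### The two path spaces -/

/-- The two kinds of paths that are considered. -/
inductive PathKind : Type
  | continuous
  | cadlag

/-- `Ω_T`, in the continuous or in the càdlàg case; `Ω = Ω_∞`. -/
def PathSpace (k : PathKind) (d : ℕ) (T : ℝ≥0∞) : Type :=
  match k with
  | .continuous => ContPath d T
  | .cadlag => CadlagPath d T

instance (k : PathKind) (d : ℕ) (T : ℝ≥0∞) : TopologicalSpace (PathSpace k d T) :=
  match k with
  | .continuous => inferInstanceAs (TopologicalSpace (ContPath d T))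
  | .cadlag => inferInstanceAs (TopologicalSpace (CadlagPath d T))

instance (k : PathKind) (d : ℕ) (T : ℝ≥0∞) : MeasurableSpace (PathSpace k d T) := borel _

instance (k : PathKind) (d : ℕ) (T : ℝ≥0∞) : BorelSpace (PathSpace k d T) := ⟨rfl⟩

/-- The restriction map `Ω → Ω_T`. -/
def restrictPath (k : PathKind) (d : ℕ) (T : ℝ≥0∞) : PathSpace k d ⊤ → PathSpace k d T :=
  match k with
  | .continuous => ContPath.restrict T
  | .cadlag => CadlagPath.restrict T

/-! ### The space `L¹(c)` -/

section Capacity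

variable {Ω : Type*} [TopologicalSpace Ω] [MeasurableSpace Ω]

theorem iSup_eLpNorm_ne_top (𝒦 : Set (ProbabilityMeasure Ω)) (p : ℝ≥0∞) (f : Ω →ᵇ ℝ) :
    (⨆ R ∈ 𝒦, eLpNorm f p (R : Measure Ω)) ≠ ⊤ := by
  refine ne_top_of_le_ne_top (b := ENNReal.ofReal ‖f‖) ENNReal.ofReal_ne_top
    (iSup₂_le fun R _ => ?_)
  refine (eLpNorm_le_of_ae_bound (C := ‖f‖) (ae_of_all _ fun ω => f.norm_coe_le_norm ω)).trans ?_
  simp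

variable [OpensMeasurableSpace Ω]

/-- The capacity `c(f) = sup_{R ∈ 𝒦} E_R(|f|^p)^{1/p}` on `C_b(Ω)`, as a seminorm. -/
def capacity (𝒦 : Set (ProbabilityMeasure Ω)) (p : ℝ≥0∞) [Fact (1 ≤ p)] :
    Seminorm ℝ (Ω →ᵇ ℝ) :=
  Seminorm.of (fun f => (⨆ R ∈ 𝒦, eLpNorm f p (R : Measure Ω)).toReal)
    (fun f g => by
      rw [← ENNReal.toReal_add (iSup_eLpNorm_ne_top 𝒦 p f) (iSup_eLpNorm_ne_top 𝒦 p g)]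
      refine ENNReal.toReal_mono (ENNReal.add_ne_top.2
        ⟨iSup_eLpNorm_ne_top 𝒦 p f, iSup_eLpNorm_ne_top 𝒦 p g⟩) (iSup₂_le fun R hR => ?_)
      refine (eLpNorm_add_le f.continuous.measurable.aestronglyMeasurable
        g.continuous.measurable.aestronglyMeasurable Fact.out).trans (add_le_add ?_ ?_)
      · exact le_iSup₂ (f := fun (R : ProbabilityMeasure Ω) (_ : R ∈ 𝒦) =>
          eLpNorm f p (R : Measure Ω)) R hR
      · exact le_iSup₂ (f := fun (R : ProbabilityMeasure Ω) (_ : R ∈ 𝒦) =>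
          eLpNorm g p (R : Measure Ω)) R hR)
    (fun a f => by
      have h : ∀ R : ProbabilityMeasure Ω, eLpNorm (a • f) p (R : Measure Ω)
          = ‖a‖ₑ * eLpNorm f p (R : Measure Ω) := fun R => eLpNorm_const_smul a f p _
      have h' : ‖a‖ = (‖a‖ₑ).toReal := by simp
      rw [h', ← ENNReal.toReal_mul, ENNReal.mul_iSup]
      simp only [ENNReal.mul_iSup]
      congr 1
      refine iSup_congr fun R => iSup_congr fun _ => ?_
      exact h R)

/-- `C_b(Ω)` equipped with the seminorm `c`. -/
def CbCap (_𝒦 : Set (ProbabilityMeasure Ω)) (p : ℝ≥0∞) [Fact (1 ≤ p)] : Type _ := Ω →ᵇ ℝ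

variable (𝒦 : Set (ProbabilityMeasure Ω)) (p : ℝ≥0∞) [Fact (1 ≤ p)]

instance : SeminormedAddCommGroup (CbCap 𝒦 p) :=
  (capacity 𝒦 p).toAddGroupSeminorm.toSeminormedAddCommGroup

instance : Module ℝ (CbCap 𝒦 p) := inferInstanceAs (Module ℝ (Ω →ᵇ ℝ))

instance : NormedSpace ℝ (CbCap 𝒦 p) where
  norm_smul_le a f := le_of_eq (map_smul_eq_mul (capacity 𝒦 p) a f)

/-- `L¹(c)`: the completion and separation of `C_b(Ω)` with respect to `c`. -/
abbrev L1c : Type _ := Completion (CbCap 𝒦 p)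

/-- The canonical linear map `C_b(Ω) → L¹(c)`. -/
def toL1c : (Ω →ᵇ ℝ) →ₗ[ℝ] L1c 𝒦 p where
  toFun f := ((show CbCap 𝒦 p from f : CbCap 𝒦 p) : Completion (CbCap 𝒦 p))
  map_add' f g := Completion.coe_add (show CbCap 𝒦 p from f) (show CbCap 𝒦 p from g)
  map_smul' a f := Completion.coe_smul a (show CbCap 𝒦 p from f)

variable {𝒦 p} in
/-- The order of `L¹(c)`: its positive cone is the closure of the nonnegative functions of
`C_b(Ω)`. -/
def L1c.LEq (X Y : L1c 𝒦 p) : Prop := Y - X ∈ closure (toL1c 𝒦 p '' {f | ∀ ω, 0 ≤ f ω})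

/-- `C_b(Ω')`, seen in `C_b(Ω)` through `π : Ω → Ω'`. -/
def cylinderFun {Ω' : Type*} [TopologicalSpace Ω'] (π : Ω → Ω') : Submodule ℝ (Ω →ᵇ ℝ) where
  carrier := {f | ∃ g : Ω' →ᵇ ℝ, ∀ ω, f ω = g (π ω)}
  add_mem' := by
    rintro f f' ⟨g, hg⟩ ⟨g', hg'⟩
    exact ⟨g + g', fun ω => by simp [hg, hg']⟩
  zero_mem' := ⟨0, fun ω => by simp⟩
  smul_mem' := by
    rintro a f ⟨g, hg⟩
    exact ⟨a • g, fun ω => by simp [hg]⟩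

/-- `L¹_t(c)`: the closure of `C_b(Ω_t)` in `L¹(c)`, where `π : Ω → Ω_t`. -/
def L1cSub {Ω' : Type*} [TopologicalSpace Ω'] (π : Ω → Ω') : Submodule ℝ (L1c 𝒦 p) :=
  ((cylinderFun π).map (toL1c 𝒦 p)).topologicalClosure

end Capacity

/-! ### Elements of `L¹(c)` as random variables -/

section Versions

/- The measures `Q` below may be defined on a σ-algebra `m` other than the Borel σ-algebra. -/
variable {Ω : Type*} [TopologicalSpace Ω] {m : MeasurableSpace Ω} [MeasurableSpace Ω]
  [OpensMeasurableSpace Ω] {𝒦 : Set (ProbabilityMeasure Ω)} {p : ℝ≥0∞} [Fact (1 ≤ p)]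

/-- The integral with respect to `Q` is bounded by a multiple of `c` on the subspace `C` of
`C_b(Ω)`, i.e. it defines a continuous linear form on the closure of `C` in `L¹(c)`. -/
def InDual (𝒦 : Set (ProbabilityMeasure Ω)) (p : ℝ≥0∞) [Fact (1 ≤ p)]
    (C : Submodule ℝ (Ω →ᵇ ℝ)) (Q : @Measure Ω m) : Prop :=
  ∃ K : ℝ, ∀ f ∈ C, |∫ ω, f ω ∂Q| ≤ K * capacity 𝒦 p f

/-- `Y` is an integrable function that represents `X`, an element of the closure of `C` in `L¹(c)`,
under `Q`: some elements of `C` converge both to `X` in `L¹(c)` and to `Y` in `L¹(Q)`. If `Q`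
is in the dual of the closure of `C`, such a `Y` exists and is unique up to `Q`-null sets. -/
def IsVersion (C : Submodule ℝ (Ω →ᵇ ℝ)) (Q : @Measure Ω m)
    (X : L1c 𝒦 p) (Y : Ω → ℝ) : Prop :=
  Integrable Y Q ∧ ∀ ε : ℝ≥0∞, 0 < ε → ∃ f ∈ C,
    edist X (toL1c 𝒦 p f) < ε ∧ ∫⁻ ω, edist (f ω) (Y ω) ∂Q < ε

/-- The random variable represented by `X` under `Q`. -/
def versionUnder (C : Submodule ℝ (Ω →ᵇ ℝ)) (Q : @Measure Ω m)
    (X : L1c 𝒦 p) : Ω → ℝ :=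
  Classical.epsilon fun Y => IsVersion C Q X Y

/-- `P` belongs to the nonnegative part `K_+` of the unit ball of the dual of `L¹(c)` and to the
canonical `c`-class: elements of `L¹(c)` are equal if and only if they are equal `P`-a.s. -/
def InCanonicalClass {Ω : Type*} [TopologicalSpace Ω] [MeasurableSpace Ω] [OpensMeasurableSpace Ω]
    (𝒦 : Set (ProbabilityMeasure Ω)) (p : ℝ≥0∞) [Fact (1 ≤ p)]
    (P : Measure Ω) : Prop :=
  (∀ f : Ω →ᵇ ℝ, |∫ ω, f ω ∂P| ≤ capacity 𝒦 p f) ∧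
    ∀ X Y : L1c 𝒦 p, versionUnder ⊤ P X =ᵐ[P] versionUnder ⊤ P Y ↔ X = Y

end Versions

/-! ### Essential suprema -/

/-- `g` is the `μ`-essential supremum, among `m`-measurable functions, of the family `S`. -/
def IsEssSupFamily {Ω : Type*} (m : MeasurableSpace Ω) {m0 : MeasurableSpace Ω}
    (μ : @Measure Ω m0) (S : Set (Ω → EReal)) (g : Ω → EReal) : Prop :=
  Measurable[m] g ∧ (∀ f ∈ S, f ≤ᵐ[μ] g) ∧
    ∀ h : Ω → EReal, Measurable[m] h → (∀ f ∈ S, f ≤ᵐ[μ] h) → g ≤ᵐ[μ] h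

/-- The `μ`-essential supremum of a family of `m`-measurable functions (defined up to null sets). -/
def essSupFamily {Ω : Type*} (m : MeasurableSpace Ω) {m0 : MeasurableSpace Ω}
    (μ : @Measure Ω m0) (S : Set (Ω → EReal)) : Ω → EReal :=
  Classical.epsilon fun g => IsEssSupFamily m μ S g

/-! ### Dynamic risk measures -/

section RiskMeasure

variable {Ω : Type*} [TopologicalSpace Ω] [MeasurableSpace Ω] [OpensMeasurableSpace Ω]
  {𝒦 : Set (ProbabilityMeasure Ω)} {p : ℝ≥0∞} [Fact (1 ≤ p)]

/-- A dynamic risk measure on `L¹(c)`: a family `ρ_{st} : L¹_t(c) → L¹_s(c)`, `0 ≤ s ≤ t ≤ ∞`, of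
monotone, translation invariant and convex maps; `π t : Ω → Ω_t` is the restriction. The values of
`ρ s t` for `t < s` play no role. -/
structure IsDynamicRiskMeasure {Ω' : ℝ≥0∞ → Type*} [∀ t, TopologicalSpace (Ω' t)]
    (π : ∀ t, Ω → Ω' t) (ρ : ∀ s t : ℝ≥0∞, L1cSub 𝒦 p (π t) → L1cSub 𝒦 p (π s)) : Prop where
  monotone : ∀ s t, s ≤ t → ∀ X Y : L1cSub 𝒦 p (π t),
    L1c.LEq (X : L1c 𝒦 p) Y → L1c.LEq (ρ s t Y : L1c 𝒦 p) (ρ s t X)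
  translation : ∀ s t, s ≤ t → ∀ (X Z : L1cSub 𝒦 p (π t)) (Y : L1cSub 𝒦 p (π s)),
    (Z : L1c 𝒦 p) = X + Y → ρ s t Z = ρ s t X - Y
  convex : ∀ s t, s ≤ t → ∀ (X Y : L1cSub 𝒦 p (π t)) (a : ℝ), 0 ≤ a → a ≤ 1 →
    L1c.LEq (ρ s t (a • X + (1 - a) • Y) : L1c 𝒦 p) (a • ρ s t X + (1 - a) • ρ s t Y)

/-- A real-valued sublinear risk measure on a subspace `V` of `L¹(c)`: monotone, invariant under
translation by constants, subadditive and positively homogeneous. -/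
structure IsSublinearRiskMeasure (V : Submodule ℝ (L1c 𝒦 p)) (φ : V → ℝ) : Prop where
  monotone : ∀ X Y : V, L1c.LEq (X : L1c 𝒦 p) Y → φ Y ≤ φ X
  translation : ∀ (X Z : V) (a : ℝ),
    (Z : L1c 𝒦 p) = X + toL1c 𝒦 p (BoundedContinuousFunction.const Ω a) → φ Z = φ X - a
  subadditive : ∀ X Y : V, φ (X + Y) ≤ φ X + φ Y
  homogeneous : ∀ (a : ℝ) (X : V), 0 ≤ a → φ (a • X) = a * φ X

variable {Ωs Ωt : Type*} [TopologicalSpace Ωs] [TopologicalSpace Ωt]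

/-- The σ-algebra `𝓑_t` on `Ω` generated by the open sets of `Ω_t`, where `π : Ω → Ω_t`. -/
@[reducible] def sigmaOf {Ω' : Type*} [TopologicalSpace Ω'] (π : Ω → Ω') : MeasurableSpace Ω :=
  (borel Ω').comap π

/-- `E_P ∘ ρ_{st}`. -/
def expectedRisk (P : Measure Ω) {πs : Ω → Ωs} {πt : Ω → Ωt}
    (ρst : L1cSub 𝒦 p πt → L1cSub 𝒦 p πs) (X : L1cSub 𝒦 p πt) : ℝ :=
  ∫ ω, versionUnder ⊤ P (ρst X : L1c 𝒦 p) ω ∂P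

/-- The acceptance set `𝒜_{st} = {X ∈ L¹_t(c) | ρ_{st}(X) ≤ 0}`. -/
def acceptanceSet {πs : Ω → Ωs} {πt : Ω → Ωt} (ρst : L1cSub 𝒦 p πt → L1cSub 𝒦 p πs) :
    Set (L1cSub 𝒦 p πt) :=
  {X | L1c.LEq (ρst X : L1c 𝒦 p) 0}

/-- The conditional expectation `E_Q(-X | 𝓑_s)`, for `X ∈ L¹_t(c)` and a measure `Q` on
`(Ω, 𝓑_t)`. -/
def condNegExp (πs : Ω → Ωs) {πt : Ω → Ωt} (Q : @Measure Ω (sigmaOf πt))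
    (X : L1cSub 𝒦 p πt) : Ω → ℝ :=
  Q[fun ω => -versionUnder (cylinderFun πt) Q (X : L1c 𝒦 p) ω | sigmaOf πs]

/-- The minimal penalty `α^m_{st}(Q) = Q-esssup_{X ∈ 𝒜_{st}} E_Q(-X | 𝓑_s)`, which may take the
value `+∞`. -/
def minimalPenalty {πs : Ω → Ωs} {πt : Ω → Ωt} (ρst : L1cSub 𝒦 p πt → L1cSub 𝒦 p πs)
    (Q : @Measure Ω (sigmaOf πt)) : Ω → EReal :=
  essSupFamily (sigmaOf πs) Q
    {g | ∃ X ∈ acceptanceSet ρst, g = fun ω => (condNegExp πs Q X ω : EReal)}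

/-- `𝒬_{s,t}(P)`: the probability measures on `(Ω, 𝓑_t)` in the dual of `L¹_t(c)` whose restriction
to `𝓑_s` is equal to `P`. -/
def dualMeasures (𝒦 : Set (ProbabilityMeasure Ω)) (p : ℝ≥0∞) [Fact (1 ≤ p)] (P : Measure Ω)
    (πs : Ω → Ωs) (πt : Ω → Ωt) : Set (@Measure Ω (sigmaOf πt)) :=
  {Q | IsProbabilityMeasure Q ∧ InDual 𝒦 p (cylinderFun πt) Q ∧
    ∀ A, MeasurableSet[sigmaOf πs] A → Q A = P A}

/-- `E_Q(-X | 𝓑_s) - α^m_{st}(Q)`. -/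
def penalizedExp {πs : Ω → Ωs} {πt : Ω → Ωt} (ρst : L1cSub 𝒦 p πt → L1cSub 𝒦 p πs)
    (X : L1cSub 𝒦 p πt) (Q : @Measure Ω (sigmaOf πt)) (ω : Ω) : EReal :=
  (condNegExp πs Q X ω : EReal) - minimalPenalty ρst Q ω

end RiskMeasure

end

/-! Fix `X`. The function `h = E_P ∘ ρ_st` is finite, convex and decreasing on `L¹_t(c)`, so it has
an algebraic subgradient at `X` (`exists_subgradient`). Monotonicity makes its negative `Λ` a
positive form. On a complete space with a closed positive cone and an absolute value, positive forms
are continuous. This is `L1cSub.exists_continuous_extension`, which rests on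
`exists_le_add_of_monotone_convex`. Thus `h(X) - Λ(D) ≤ h(X + D)` for all `D`, and translation by
`±f` with `f ∈ C_b(Ω_s)` forces `Λ f = E_P f`.

Weak relative compactness and Dini's theorem make `c`, hence `Λ`, continuous along sequences of
`C_b` decreasing to `0` (`tendsto_capacity_zero`). The Daniell construction
`IsDaniell.exists_measure` then gives a measure `Q` on `𝓑_t` with `Λ = E_Q`. It agrees with `P` on
`𝓑_s`, so it lies in `𝒬_{s,t}(P)`.

The subgradient inequality must next be made conditional on `𝓑_s`. Constant-coefficient convexity,
monotonicity and translation invariance together give `ρ(X + fD) ≤ f ρ(X + D) + (1 - f) ρ(X)` for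
bounded `D` and `f ∈ C_b(Ω_s)` with `0 ≤ f ≤ 1` (`ae_le_of_bounded`). Truncating a general `D` from
above and from below yields `E_P(f (ρ(X) - ρ(X + D))) ≤ E_Q(f D)` for every `D`
(`integral_mul_sub_le`). Such `f` detect the sign of a `𝓑_s`-measurable function, hence `E_Q(-Y |
𝓑_s) - ρ(Y) ≤ E_Q(-X | 𝓑_s) - ρ(X)` for every `Y`. Over acceptable `Y` this bounds `α^m_{st}(Q)` by
the right-hand side.

Conversely `X + ρ(X)` is acceptable, so every measure of `𝒬_{s,t}(P)` has penalty at least `E(-X |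
𝓑_s) - ρ(X)`. Hence no such measure exceeds `ρ(X)` in the representation, and `Q` attains it.

Two facts connect these arguments with the spaces involved. In the canonical class the order of
`L¹(c)` is the `P`-a.s. order (`InCanonicalClass.lEq_iff`). The restriction `Ω_t → Ω_s` is
continuous, so `C_b(Ω_s) ⊆ C_b(Ω_t)` and `𝓑_s ⊆ 𝓑_t`; for càdlàg paths this needs an argument about
Skorokhod distances. -/

noncomputable section

/-! ### Continuity of the restriction of càdlàg paths -/

section Skorokhod

/-- An increasing homeomorphism of `[0,m]` that is `η`-close to the identity can be modified near
the end point of `[0,L]` to an increasing homeomorphism of `[0,L]`. -/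
theorem exists_orderIso_Icc_clip {L m : ℝ≥0} (hL : 0 < L) (hLm : L ≤ m) {η : ℝ}
    (e : Set.Icc (0 : ℝ≥0) m ≃o Set.Icc (0 : ℝ≥0) m)
    (he : ∀ u, |((e u : ℝ≥0) : ℝ) - (u : ℝ≥0)| ≤ η) :
    ∃ e' : Set.Icc (0 : ℝ≥0) L ≃o Set.Icc (0 : ℝ≥0) L,
      (∀ u, |((e' u : ℝ≥0) : ℝ) - (u : ℝ≥0)| ≤ η) ∧
      ∀ u : Set.Icc (0 : ℝ≥0) L, ((u : ℝ≥0) : ℝ) + 2 * η ≤ L →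
        (e' u : ℝ≥0) = e ⟨u, u.2.1, u.2.2.trans hLm⟩ := by
  have hL' : (0 : ℝ) < L := hL
  set i : Set.Icc (0 : ℝ≥0) L → Set.Icc (0 : ℝ≥0) m := fun u => ⟨u, u.2.1, u.2.2.trans hLm⟩ with hi
  have hic : Continuous i := by fun_prop
  have him : StrictMono i := fun a b h => h
  -- The map `e` is clipped between the lines `2u - L` and `(L + u)/2`. Both are strictly increasing
  -- and meet at `(L, L)`, so the end point is fixed. When `L - u ≥ 2η` they lie at distance at
  -- least `η` from `u` on either side, and the clipping is inactive.
  set F : Set.Icc (0 : ℝ≥0) L → ℝ := fun u =>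
    max (min ((e (i u) : ℝ≥0) : ℝ) ((L + (u : ℝ≥0)) / 2)) (2 * (u : ℝ≥0) - L) with hF
  have hFc : Continuous F := by
    have : Continuous fun u => ((e (i u) : ℝ≥0) : ℝ) :=
      NNReal.continuous_coe.comp (continuous_subtype_val.comp (e.continuous.comp hic))
    fun_prop
  have hFm : StrictMono F := by
    intro a b h
    have h1 : ((a : ℝ≥0) : ℝ) < (b : ℝ≥0) := h
    have h2 : ((e (i a) : ℝ≥0) : ℝ) < (e (i b) : ℝ≥0) := e.strictMono (him h)
    simp only [hF]
    refine max_lt_max (min_lt_min h2 ?_) ?_ <;> linarith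
  have hub : ∀ u : Set.Icc (0 : ℝ≥0) L, ((u : ℝ≥0) : ℝ) ≤ L := fun u => u.2.2
  have hF0 : ∀ u, 0 ≤ F u := fun u => le_max_of_le_left (le_min (by positivity) (by positivity))
  have hFL : ∀ u, F u ≤ L := fun u => by
    have := hub u
    exact max_le ((min_le_right _ _).trans (by linarith)) (by linarith)
  set G : Set.Icc (0 : ℝ≥0) L → Set.Icc (0 : ℝ≥0) L := fun u => ⟨⟨F u, hF0 u⟩, zero_le, hFL u⟩
    with hG
  have hGc : Continuous G := by
    refine Continuous.subtype_mk ?_ _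
    exact Continuous.subtype_mk hFc _
  have hGm : StrictMono G := fun a b h => hFm h
  have hbot : G ⟨0, le_rfl, zero_le⟩ = ⟨0, le_rfl, zero_le⟩ := by
    have h0 : e (i ⟨0, le_rfl, zero_le⟩) = ⟨0, le_rfl, zero_le⟩ := by
      have h1 : i ⟨0, le_rfl, zero_le⟩ ≤ e.symm ⟨0, le_rfl, zero_le⟩ := zero_le (a := (_ : ℝ≥0))
      have h2 := e.monotone h1
      rw [e.apply_symm_apply] at h2
      exact le_antisymm h2 (zero_le (a := (_ : ℝ≥0)))
    have hF0' : F ⟨0, le_rfl, zero_le⟩ = 0 := by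
      simp only [hF, h0, NNReal.coe_zero, mul_zero, add_zero, zero_sub]
      rw [min_eq_left (by positivity), max_eq_left (by linarith)]
    exact Subtype.ext (NNReal.eq hF0')
  have htop : G ⟨L, zero_le, le_rfl⟩ = ⟨L, zero_le, le_rfl⟩ := by
    apply Subtype.ext
    apply NNReal.eq
    refine le_antisymm (hFL _) ?_
    exact le_max_of_le_right (by simp; linarith)
  have hsurj : Function.Surjective G := by
    have : PreconnectedSpace (Set.Icc (0 : ℝ≥0) L) :=
      Subtype.preconnectedSpace isPreconnected_Icc
    intro y
    refine intermediate_value_univ (⟨0, le_rfl, zero_le⟩ : Set.Icc (0 : ℝ≥0) L)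
      ⟨L, zero_le, le_rfl⟩ hGc ?_
    rw [hbot, htop]
    exact ⟨y.2.1, y.2.2⟩
  refine ⟨hGm.orderIsoOfSurjective _ hsurj, fun u => ?_, fun u hu => ?_⟩
  · have h1 := abs_le.1 (he (i u))
    have h2 : (((i u : ℝ≥0)) : ℝ) = (u : ℝ≥0) := rfl
    have h3 := hub u
    have h4 : 0 ≤ η := (abs_nonneg _).trans (he (i u))
    rw [h2] at h1
    change |F u - _| ≤ η
    rw [abs_le]
    constructor
    · have : (u : ℝ≥0) - η ≤ F u := le_max_of_le_left (le_min (by linarith) (by linarith))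
      linarith
    · have : F u ≤ (u : ℝ≥0) + η := max_le ((min_le_left _ _).trans (by linarith)) (by linarith)
      linarith
  · have h1 := abs_le.1 (he (i u))
    have h2 : (((i u : ℝ≥0)) : ℝ) = (u : ℝ≥0) := rfl
    rw [h2] at h1
    have h4 : 0 ≤ η := (abs_nonneg _).trans (he (i u))
    apply NNReal.eq
    change F u = _
    simp only [hF]
    rw [min_eq_left (by linarith), max_eq_left (by linarith)]

/-- A strictly increasing continuous map induces an order isomorphism of initial intervals. -/
theorem exists_orderIso_Icc_of_strictMono {σ : ℝ≥0 → ℝ≥0} (hσ : StrictMono σ) (hc : Continuous σ)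
    (h0 : σ 0 = 0) {M L : ℝ≥0} (hL : L = σ M) :
    ∃ τ : Set.Icc (0 : ℝ≥0) M ≃o Set.Icc (0 : ℝ≥0) L,
      ∀ v : Set.Icc (0 : ℝ≥0) M, (τ v : ℝ≥0) = σ v := by
  subst hL
  set G : Set.Icc (0 : ℝ≥0) M → Set.Icc (0 : ℝ≥0) (σ M) :=
    fun v => ⟨σ v, zero_le, hσ.monotone v.2.2⟩ with hG
  have hGm : StrictMono G := fun a b h => hσ h
  have hsurj : Function.Surjective G := by
    intro y
    have := intermediate_value_Icc (zero_le : 0 ≤ M) hc.continuousOn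
    rw [h0] at this
    obtain ⟨v, hv, hvy⟩ := this y.2
    exact ⟨⟨v, hv⟩, Subtype.ext hvy⟩
  exact ⟨hGm.orderIsoOfSurjective _ hsurj, fun v => rfl⟩

theorem skorokhodCutoff_nonneg (m : ℕ) (u : ℝ≥0) : 0 ≤ skorokhodCutoff m u := le_max_left _ _

theorem skorokhodCutoff_le_one (m : ℕ) (u : ℝ≥0) : skorokhodCutoff m u ≤ 1 :=
  max_le zero_le_one (min_le_left _ _)

theorem skorokhodCutoff_le {m : ℕ} {u : ℝ≥0} (hu : u ≤ m) : skorokhodCutoff m u ≤ m - u := by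
  have : (u : ℝ) ≤ m := by exact_mod_cast hu
  exact max_le (by linarith) (min_le_right _ _)

theorem skorokhodCutoff_eq_one {m : ℕ} {u : ℝ≥0} (hu : u + 1 ≤ m) : skorokhodCutoff m u = 1 := by
  have : (u : ℝ) + 1 ≤ m := by exact_mod_cast hu
  rw [skorokhodCutoff, min_eq_left (by linarith), max_eq_right zero_le_one]

theorem abs_skorokhodCutoff_sub_le (m : ℕ) (u v : ℝ≥0) :
    |skorokhodCutoff m u - skorokhodCutoff m v| ≤ |(v : ℝ) - u| := by
  unfold skorokhodCutoff
  have h1 : ∀ a b : ℝ, |max 0 a - max 0 b| ≤ |a - b| := fun a b => by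
    simpa using abs_max_sub_max_le_max 0 a 0 b
  have h2 : ∀ a b : ℝ, |min 1 a - min 1 b| ≤ |a - b| := fun a b => by
    simpa using abs_min_sub_min_le_max 1 a 1 b
  exact (h1 _ _).trans ((h2 _ _).trans (by rw [sub_sub_sub_cancel_left]))

variable {E : Type*} [NormedAddCommGroup E] [NormedSpace ℝ E]

theorem exists_orderIso_of_skorokhodDistOn_lt {m : ℕ} {x y : ℝ≥0 → E} {η : ℝ}
    (h : skorokhodDistOn m x y < ENNReal.ofReal η) :
    ∃ e : Set.Icc (0 : ℝ≥0) m ≃o Set.Icc (0 : ℝ≥0) m,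
      (∀ u, |((e u : ℝ≥0) : ℝ) - (u : ℝ≥0)| ≤ η) ∧
      ∀ u : Set.Icc (0 : ℝ≥0) m,
        ‖skorokhodCutoff m u • x u - skorokhodCutoff m (e u) • y (e u)‖ ≤ η := by
  obtain ⟨e, he⟩ := iInf_lt_iff.1 h
  refine ⟨e, fun u => ?_, fun u => ?_⟩
  · have : edist (e u : ℝ≥0) (u : ℝ≥0) < ENNReal.ofReal η :=
      ((le_iSup_of_le (f := fun v => edist (e v : ℝ≥0) (v : ℝ≥0)) u le_rfl).trans
        (le_max_left _ _)).trans_lt he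
    rw [edist_lt_ofReal, NNReal.dist_eq] at this
    exact this.le
  · have : edist (skorokhodCutoff m u • x u) (skorokhodCutoff m (e u) • y (e u))
        < ENNReal.ofReal η :=
      ((le_iSup_of_le (f := fun v : Set.Icc (0 : ℝ≥0) m =>
        edist (skorokhodCutoff m v • x v) (skorokhodCutoff m (e v) • y (e v))) u le_rfl).trans
        (le_max_right _ _)).trans_lt he
    rw [edist_lt_ofReal, dist_eq_norm] at this
    exact this.le

theorem skorokhodDistOn_le_of_orderIso {m : ℕ} {x y : ℝ≥0 → E} {η : ℝ}
    (e : Set.Icc (0 : ℝ≥0) m ≃o Set.Icc (0 : ℝ≥0) m)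
    (he : ∀ u, |((e u : ℝ≥0) : ℝ) - (u : ℝ≥0)| ≤ η)
    (hxy : ∀ u : Set.Icc (0 : ℝ≥0) m,
      ‖skorokhodCutoff m u • x u - skorokhodCutoff m (e u) • y (e u)‖ ≤ η) :
    skorokhodDistOn m x y ≤ ENNReal.ofReal η := by
  refine iInf_le_of_le e (max_le (iSup_le fun u => ?_) (iSup_le fun u => ?_))
  · rw [edist_dist, NNReal.dist_eq]
    exact ENNReal.ofReal_le_ofReal (he u)
  · rw [edist_dist, dist_eq_norm]
    exact ENNReal.ofReal_le_ofReal (hxy u)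

/-- Composition with `σ` is continuous at a locally bounded path. A time change `e` matching `x` and
`z` on a large interval is clipped to `[0, σ M]` and conjugated by `σ`. Clipping spoils the match
only near the end point, where the cutoff is small and both paths are bounded. -/
theorem exists_skorokhodDistOn_comp_le {σ : ℝ≥0 → ℝ≥0} (hσ : StrictMono σ) (hc : Continuous σ)
    (h0 : σ 0 = 0) {S : ℝ≥0} (hS : ∀ v, σ v ≤ S) {x : ℝ≥0 → E} {B : ℝ}
    (hB : ∀ u ≤ S + 1, ‖x u‖ ≤ B) (M : ℕ) {ε : ℝ} (hε : 0 < ε) :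
    ∃ m : ℕ, ∃ η : ℝ, 0 < η ∧ ∀ z : ℝ≥0 → E, skorokhodDistOn m x z < ENNReal.ofReal η →
      skorokhodDistOn M (x ∘ σ) (z ∘ σ) ≤ ENNReal.ofReal ε := by
  rcases Nat.eq_zero_or_pos M with hM | hM
  · subst hM
    refine ⟨0, 1, one_pos, fun z _ => ?_⟩
    refine skorokhodDistOn_le_of_orderIso (OrderIso.refl _) (fun u => by simpa using hε.le)
      fun u => ?_
    change ‖skorokhodCutoff 0 u • (x ∘ σ) u - skorokhodCutoff 0 u • (z ∘ σ) u‖ ≤ ε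
    have : skorokhodCutoff 0 (u : ℝ≥0) = 0 := by simp [skorokhodCutoff]
    simp [this, hε.le]
  have hB0 : 0 ≤ B := (norm_nonneg _).trans (hB 0 zero_le)
  obtain ⟨L, hLdef⟩ : ∃ L, L = σ M := ⟨_, rfl⟩
  obtain ⟨τ, hτ⟩ := exists_orderIso_Icc_of_strictMono hσ hc h0 hLdef
  have hL : 0 < L := by rw [hLdef, ← h0]; exact hσ (by exact_mod_cast hM)
  have hLS : L ≤ S := hLdef ▸ hS _
  -- For `u ≤ S + 1` and `η ≤ 1` one has `e u ≤ S + 2`, so with this `m` the cutoff equals `1` at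
  -- both `u` and `e u`.
  obtain ⟨m, hm⟩ := exists_nat_ge (S + 3)
  -- The two cases below produce errors of at most `ε' (B + 2)` and `ε' (3 B + 2)`.
  set ε' := ε / (4 * B + 4) with hε'
  have hε'0 : 0 < ε' := by positivity
  have hε'B : ε' * (4 * B + 4) = ε := by rw [hε']; field_simp
  have huc : UniformContinuous τ.symm :=
    CompactSpace.uniformContinuous_of_continuous τ.symm.continuous
  obtain ⟨ζ, hζ, hτζ⟩ := Metric.uniformContinuous_iff.1 huc ε' hε'0
  -- The last bound gives `2η < ζ`, so that `τ.symm` moves points at distance `2η`, the width of the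
  -- zone affected by clipping, by at most `ε'`.
  set η := min (min 1 ε') (ζ / 3) with hη
  have hη0 : 0 < η := by positivity
  have hη1 : η ≤ 1 := (min_le_left _ _).trans (min_le_left _ _)
  have hηε : η ≤ ε' := (min_le_left _ _).trans (min_le_right _ _)
  have hηζ : 2 * η < ζ := by
    have : η ≤ ζ / 3 := min_le_right _ _
    linarith
  refine ⟨m, η, hη0, fun z hz => ?_⟩
  obtain ⟨e, he, hxz⟩ := exists_orderIso_of_skorokhodDistOn_lt hz
  have hm' : (S : ℝ) + 3 ≤ m := by exact_mod_cast hm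
  have hLm : L ≤ m := by
    have : (L : ℝ) ≤ S := hLS
    have : (L : ℝ) ≤ m := by linarith
    exact_mod_cast this
  have hclose : ∀ u : Set.Icc (0 : ℝ≥0) m, (u : ℝ≥0) ≤ S + 1 → ‖x u - z (e u)‖ ≤ η := by
    intro u hu
    have h1 := abs_le.1 (he u)
    have hu' : ((u : ℝ≥0) : ℝ) ≤ S + 1 := by exact_mod_cast hu
    have h2 : skorokhodCutoff m u = 1 := by
      apply skorokhodCutoff_eq_one
      have : ((u : ℝ≥0) : ℝ) + 1 ≤ m := by linarith
      exact_mod_cast this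
    have h3 : skorokhodCutoff m (e u) = 1 := by
      apply skorokhodCutoff_eq_one
      have : ((e u : ℝ≥0) : ℝ) + 1 ≤ m := by linarith
      exact_mod_cast this
    have := hxz u
    rwa [h2, h3, one_smul, one_smul] at this
  have hzB : ∀ w : ℝ≥0, w ≤ S → ‖z w‖ ≤ B + 1 := by
    intro w hw
    have hwS : (w : ℝ) ≤ S := by exact_mod_cast hw
    have hwm : w ≤ m := by
      have : (w : ℝ) ≤ m := by linarith
      exact_mod_cast this
    set u := e.symm ⟨w, zero_le, hwm⟩ with hu
    have heu : e u = ⟨w, zero_le, hwm⟩ := e.apply_symm_apply _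
    have h1 := abs_le.1 (he u)
    rw [heu] at h1
    have hu1 : (u : ℝ≥0) ≤ S + 1 := by
      have : ((u : ℝ≥0) : ℝ) ≤ S + 1 := by
        have := h1.1
        simp only at this
        linarith
      exact_mod_cast this
    have h2 := hclose u hu1
    rw [heu] at h2
    have h3 := hB u hu1
    have h4 : z w = x u - (x u - z w) := by abel
    rw [h4]
    exact (norm_sub_le _ _).trans (by linarith)
  obtain ⟨e', he', hee'⟩ := exists_orderIso_Icc_clip hL hLm e he
  have hdist : ∀ a b : Set.Icc (0 : ℝ≥0) L, |((a : ℝ≥0) : ℝ) - (b : ℝ≥0)| ≤ 2 * η →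
      |((τ.symm a : ℝ≥0) : ℝ) - (τ.symm b : ℝ≥0)| ≤ ε' := by
    intro a b hab
    have : dist a b < ζ := by
      rw [Subtype.dist_eq, NNReal.dist_eq]; linarith
    have := hτζ this
    rw [Subtype.dist_eq, NNReal.dist_eq] at this
    exact this.le
  have hmove : ∀ v : Set.Icc (0 : ℝ≥0) M,
      |((τ.symm (e' (τ v)) : ℝ≥0) : ℝ) - (v : ℝ≥0)| ≤ ε' := by
    intro v
    have := hdist (e' (τ v)) (τ v) ((he' _).trans (by linarith))
    rwa [τ.symm_apply_apply] at this
  have hε'ε : ε' ≤ ε := by nlinarith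
  refine skorokhodDistOn_le_of_orderIso ((τ.trans e').trans τ.symm)
    (fun v => (hmove v).trans hε'ε) fun v => ?_
  set v' := τ.symm (e' (τ v)) with hv'
  change ‖skorokhodCutoff M v • x (σ v) - skorokhodCutoff M v' • z (σ v')‖ ≤ ε
  have hσv' : σ v' = e' (τ v) := by rw [← hτ, hv', τ.apply_symm_apply]
  have hv'B : ‖z (σ v')‖ ≤ B + 1 := hzB _ (hS _)
  -- Away from the end point, `e'` agrees with `e` and the paths match up to `η`. Within `2η` of it
  -- both cutoffs are of order `ε'`, and boundedness suffices.
  by_cases hcase : ((σ v : ℝ≥0) : ℝ) + 2 * η ≤ L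
  · have h1 := hee' (τ v) (by rwa [hτ])
    rw [← hσv'] at h1
    have h2 := hclose ⟨σ v, zero_le, (hS _).trans (by exact_mod_cast (by linarith : (S : ℝ) ≤ m))⟩
      ((hS _).trans le_self_add)
    have h3 : (⟨(τ v : ℝ≥0), (τ v).2.1, (τ v).2.2.trans hLm⟩ : Set.Icc (0 : ℝ≥0) m)
        = ⟨σ v, zero_le, (hS _).trans (by exact_mod_cast (by linarith : (S : ℝ) ≤ m))⟩ :=
      Subtype.ext (hτ v)
    rw [h3] at h1
    rw [← h1] at h2
    simp only at h2
    have h4 : skorokhodCutoff M v • x (σ v) - skorokhodCutoff M v' • z (σ v')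
        = skorokhodCutoff M v • (x (σ v) - z (σ v'))
          + (skorokhodCutoff M v - skorokhodCutoff M v') • z (σ v') := by
      rw [smul_sub, sub_smul]; abel
    rw [h4]
    refine (norm_add_le _ _).trans ?_
    rw [norm_smul, norm_smul, Real.norm_eq_abs, Real.norm_eq_abs,
      abs_of_nonneg (skorokhodCutoff_nonneg _ _)]
    have h5 := (abs_skorokhodCutoff_sub_le M v v').trans (hmove v)
    have h6 : skorokhodCutoff M v * ‖x (σ v) - z (σ v')‖ ≤ 1 * η :=
      mul_le_mul (skorokhodCutoff_le_one _ _) h2 (norm_nonneg _) zero_le_one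
    have h7 : |skorokhodCutoff M v - skorokhodCutoff M v'| * ‖z (σ v')‖ ≤ ε' * (B + 1) :=
      mul_le_mul h5 hv'B (norm_nonneg _) hε'0.le
    nlinarith
  · have hτM : τ.symm ⟨L, zero_le, le_rfl⟩ = ⟨(M : ℝ≥0), zero_le, le_rfl⟩ := by
      rw [OrderIso.symm_apply_eq]; exact Subtype.ext (hLdef.trans (hτ ⟨M, zero_le, le_rfl⟩).symm)
    have h1 := hdist (⟨L, zero_le, le_rfl⟩) (τ v) (by
      rw [hτ, abs_le]
      have : ((σ v : ℝ≥0) : ℝ) ≤ L := by rw [hLdef]; exact_mod_cast hσ.monotone v.2.2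
      constructor <;> simp only <;> linarith)
    rw [τ.symm_apply_apply, hτM] at h1
    have h1' := (abs_le.1 h1).2
    simp only [NNReal.coe_natCast] at h1'
    have h2 := (abs_le.1 (hmove v)).1
    have h3 : skorokhodCutoff M v ≤ ε' := (skorokhodCutoff_le v.2.2).trans h1'
    have h4 : skorokhodCutoff M v' ≤ 2 * ε' := (skorokhodCutoff_le v'.2.2).trans (by linarith)
    refine (norm_sub_le _ _).trans ?_
    rw [norm_smul, norm_smul, Real.norm_eq_abs, Real.norm_eq_abs,
      abs_of_nonneg (skorokhodCutoff_nonneg _ _), abs_of_nonneg (skorokhodCutoff_nonneg _ _)]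
    have h5 : skorokhodCutoff M v * ‖x (σ v)‖ ≤ ε' * B :=
      mul_le_mul h3 (hB _ ((hS _).trans le_self_add)) (norm_nonneg _) hε'0.le
    have h6 : skorokhodCutoff M v' * ‖z (σ v')‖ ≤ 2 * ε' * (B + 1) :=
      mul_le_mul h4 hv'B (norm_nonneg _) (by positivity)
    nlinarith

end Skorokhod

/-! ### Convergence in the Skorokhod distance, time changes and restriction. -/

section SkorokhodContinuity

variable {E : Type*} [NormedAddCommGroup E] [NormedSpace ℝ E]

theorem skorokhodDistOn_lt_of_skorokhodDist_lt (m : ℕ) {x y : ℝ≥0 → E} {δ : ℝ≥0∞} (hδ : δ ≤ 1)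
    (h : skorokhodDist x y < ((2 : ℝ≥0∞) ^ (m + 1))⁻¹ * δ) : skorokhodDistOn (m + 1) x y < δ := by
  have h1 : ((2 : ℝ≥0∞) ^ (m + 1))⁻¹ * min 1 (skorokhodDistOn (m + 1) x y)
      < ((2 : ℝ≥0∞) ^ (m + 1))⁻¹ * δ := (ENNReal.le_tsum m).trans_lt h
  have h2 := lt_of_mul_lt_mul_left' h1
  rcases min_lt_iff.1 h2 with h3 | h3
  · exact absurd h3 (not_lt.2 hδ)
  · exact h3

theorem tendsto_skorokhodDistOn_zero_of_tendsto {ι : Type*} {l : Filter ι} {x : ℝ≥0 → E}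
    {z : ι → ℝ≥0 → E} (h : Tendsto (fun i => skorokhodDist x (z i)) l (𝓝 0)) (m : ℕ) :
    Tendsto (fun i => skorokhodDistOn m x (z i)) l (𝓝 0) := by
  rcases m with _ | m
  · refine tendsto_const_nhds.congr fun i => ?_
    refine (le_antisymm ?_ zero_le).symm
    refine iInf_le_of_le (OrderIso.refl _) (max_le (by simp) (iSup_le fun u => ?_))
    have h0 : ∀ v, skorokhodCutoff 0 v = 0 := fun v => by simp [skorokhodCutoff]
    simp [h0]
  · rw [ENNReal.tendsto_nhds_zero] at h ⊢
    intro ε hε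
    have hδ : 0 < min 1 ε := lt_min one_pos hε
    obtain ⟨η, hη, hη'⟩ := exists_between (show 0 < ((2 : ℝ≥0∞) ^ (m + 1))⁻¹ * min 1 ε from
      ENNReal.mul_pos (by simp) hδ.ne')
    filter_upwards [h η hη] with i hi
    exact (skorokhodDistOn_lt_of_skorokhodDist_lt m (min_le_left _ _) (hi.trans_lt hη')).le.trans
      (min_le_right _ _)

/-- Dominated convergence for the counting measure: the terms are bounded by the summable weights.
-/
theorem tendsto_skorokhodDist_zero {ι : Type*} {l : Filter ι} [l.IsCountablyGenerated]
    {x : ι → ℝ≥0 → E} {z : ι → ℝ≥0 → E}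
    (h : ∀ m, Tendsto (fun i => skorokhodDistOn m (x i) (z i)) l (𝓝 0)) :
    Tendsto (fun i => skorokhodDist (x i) (z i)) l (𝓝 0) := by
  have hsum : ∑' m : ℕ, ((2 : ℝ≥0∞) ^ (m + 1))⁻¹ ≠ ⊤ := by
    have := ENNReal.tsum_geometric_add_one (2⁻¹ : ℝ≥0∞)
    simp only [← ENNReal.inv_pow] at this ⊢
    rw [this]
    exact ENNReal.mul_ne_top (by simp) (ENNReal.inv_ne_top.2 (by simp))
  have key := tendsto_lintegral_filter_of_dominated_convergence (l := l) (μ := Measure.count)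
    (F := fun i (m : ℕ) => ((2 : ℝ≥0∞) ^ (m + 1))⁻¹ * min 1 (skorokhodDistOn (m + 1) (x i) (z i)))
    (f := fun _ => 0) (fun m : ℕ => ((2 : ℝ≥0∞) ^ (m + 1))⁻¹)
    (Eventually.of_forall fun i => measurable_of_countable _)
    (Eventually.of_forall fun i => ae_of_all _ fun m => mul_le_of_le_one_right' (min_le_left _ _))
    (by rwa [lintegral_count]) (ae_of_all _ fun m => ?_)
  · simpa only [lintegral_count, tsum_zero, lintegral_zero, skorokhodDist] using key
  · have h1 : Tendsto (fun i => min 1 (skorokhodDistOn (m + 1) (x i) (z i))) l (𝓝 0) :=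
      tendsto_of_tendsto_of_tendsto_of_le_of_le tendsto_const_nhds (h (m + 1))
        (fun _ => zero_le) (fun _ => min_le_right _ _)
    have := ENNReal.Tendsto.const_mul (a := ((2 : ℝ≥0∞) ^ (m + 1))⁻¹) h1 (Or.inr (by simp))
    simpa using this

theorem tendsto_skorokhodDist_comp {ι : Type*} {l : Filter ι} [l.IsCountablyGenerated]
    {σ : ℝ≥0 → ℝ≥0} (hσ : StrictMono σ) (hc : Continuous σ)
    (h0 : σ 0 = 0) {S : ℝ≥0} (hS : ∀ v, σ v ≤ S) {x : ℝ≥0 → E} {B : ℝ}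
    (hB : ∀ u ≤ S + 1, ‖x u‖ ≤ B) {z : ι → ℝ≥0 → E}
    (h : Tendsto (fun i => skorokhodDist x (z i)) l (𝓝 0)) :
    Tendsto (fun i => skorokhodDist (x ∘ σ) (z i ∘ σ)) l (𝓝 0) := by
  refine tendsto_skorokhodDist_zero fun M => ?_
  rw [ENNReal.tendsto_nhds_zero]
  intro ε hε
  obtain ⟨ε', hε', hε'ε⟩ : ∃ ε' : ℝ, 0 < ε' ∧ ENNReal.ofReal ε' ≤ ε := by
    rcases eq_or_ne ε ⊤ with rfl | hne
    · exact ⟨1, one_pos, le_top⟩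
    · exact ⟨ε.toReal, ENNReal.toReal_pos hε.ne' hne, ENNReal.ofReal_toReal_le⟩
  obtain ⟨m, η, hη, hmη⟩ := exists_skorokhodDistOn_comp_le hσ hc h0 hS hB M hε'
  have := tendsto_skorokhodDistOn_zero_of_tendsto h m
  filter_upwards [this.eventually_lt_const (ENNReal.ofReal_pos.2 hη)] with i hi
  exact (hmη _ hi).trans hε'ε

theorem timeChange_lt {T : ℝ≥0∞} (hT : T ≠ 0) (v : ℝ≥0) : (timeChange T v : ℝ≥0∞) < T := by
  unfold timeChange
  split_ifs with h
  · rw [h]; exact ENNReal.coe_lt_top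
  · lift T to ℝ≥0 using h
    have hT' : 0 < T := pos_iff_ne_zero.2 (by simpa using hT)
    rw [ENNReal.toNNReal_coe, ENNReal.coe_lt_coe]
    have : v / (1 + v) < 1 := by rw [div_lt_one (by positivity)]; exact lt_one_add v
    calc T * (v / (1 + v)) < T * 1 := mul_lt_mul_of_pos_left this hT'
      _ = T := mul_one T

theorem continuous_timeChange (T : ℝ≥0∞) : Continuous (timeChange T) := by
  unfold timeChange
  split_ifs with h
  · exact continuous_id
  · exact continuous_const.mul (continuous_id.div₀ (by fun_prop) fun v => by positivity)

theorem strictMono_div_one_add : StrictMono fun v : ℝ≥0 => v / (1 + v) := by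
  intro a b h
  simp only
  rw [div_lt_div_iff₀ (by positivity) (by positivity)]
  have h' : (a : ℝ) < b := h
  have : (a : ℝ) * (1 + b) < b * (1 + a) := by nlinarith
  exact_mod_cast this

/-- For `T < T'` the time changes of `[0,T[` and `[0,T'[` differ by an increasing homeomorphism of
`[0,∞[` onto a bounded interval. -/
theorem exists_timeChange_comp {T T' : ℝ≥0∞} (hT : T ≠ 0) (hTT' : T < T') :
    ∃ (σ : ℝ≥0 → ℝ≥0) (S : ℝ≥0), StrictMono σ ∧ Continuous σ ∧ σ 0 = 0 ∧ (∀ v, σ v ≤ S) ∧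
      ∀ v, timeChange T' (σ v) = timeChange T v := by
  have hTt : T ≠ ⊤ := hTT'.ne_top
  lift T to ℝ≥0 using hTt
  have hT0 : 0 < T := pos_iff_ne_zero.2 (by simpa using hT)
  rcases eq_or_ne T' ⊤ with rfl | hT't
  · refine ⟨timeChange T, T, fun a b h => ?_, continuous_timeChange _, by simp [timeChange],
      fun v => by exact_mod_cast (timeChange_lt hT v).le, fun v => by simp [timeChange]⟩
    simp only [timeChange, ENNReal.coe_ne_top, if_false, ENNReal.toNNReal_coe]
    exact mul_lt_mul_of_pos_left (strictMono_div_one_add h) hT0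
  · lift T' to ℝ≥0 using hT't
    have hlt : T < T' := by exact_mod_cast hTT'
    obtain ⟨c, hc, rfl⟩ := exists_pos_add_of_lt' hlt
    have hden : ∀ v : ℝ≥0, 0 < T + c + c * v := fun v => by positivity
    -- Writing `T' = T + c`, this is `α_{T'} ∘ α_T⁻¹`, obtained by putting `u = T v / (1 + v)` into
    -- `u / (T' - u)`. The bound `T / c` is its limit at infinity.
    refine ⟨fun v => T * v / (T + c + c * v), T / c, fun a b h => ?_, ?_, by simp, fun v => ?_,
      fun v => ?_⟩
    · simp only
      rw [div_lt_div_iff₀ (hden _) (hden _)]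
      have h' : (a : ℝ) < b := h
      have hT' : (0 : ℝ) < T := hT0
      have hc' : (0 : ℝ) < c := hc
      have : (T : ℝ) * a * (T + c + c * b) < T * b * (T + c + c * a) := by
        have : (0 : ℝ) < T * (T + c) * (b - a) := by
          have := sub_pos.2 h'
          positivity
        nlinarith
      exact_mod_cast this
    · exact Continuous.div₀ (by fun_prop) (by fun_prop) fun v => (hden v).ne'
    · rw [div_le_div_iff₀ (hden _) hc]
      have : (T : ℝ) * v * c ≤ T * (T + c + c * v) := by
        have : (0 : ℝ) ≤ T * (T + c) := by positivity
        nlinarith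
      exact_mod_cast this
    · simp only [timeChange, ENNReal.coe_ne_top, if_false, ENNReal.toNNReal_coe]
      apply NNReal.eq
      push_cast
      have h1 : (0 : ℝ) < T + c + c * v := by exact_mod_cast hden v
      have h2 : (0 : ℝ) < T + c := by positivity
      have h3 : (0 : ℝ) < 1 + v := by positivity
      have h4 : (0 : ℝ) < T + c + c * v + T * v := by positivity
      field_simp
      ring

/-- A right continuous function with left limits is bounded on compact sets. -/
theorem IsCompact.exists_bound_of_cadlag {X E : Type*} [NormedAddCommGroup E] [TopologicalSpace X]
    [LinearOrder X]
    {x : X → E} (hx : ∀ u, Tendsto x (𝓝[>] u) (𝓝 (x u)) ∧ ∃ l, Tendsto x (𝓝[<] u) (𝓝 l))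
    {K : Set X} (hK : IsCompact K) : ∃ B, ∀ u ∈ K, ‖x u‖ ≤ B := by
  refine hK.induction_on (p := fun s => ∃ B, ∀ u ∈ s, ‖x u‖ ≤ B) ⟨0, by simp⟩ ?_ ?_ ?_
  · rintro s t hst ⟨B, hB⟩
    exact ⟨B, fun u hu => hB u (hst hu)⟩
  · rintro s t ⟨B, hB⟩ ⟨B', hB'⟩
    exact ⟨max B B', fun u hu => hu.elim (fun h => (hB u h).trans (le_max_left _ _))
      fun h => (hB' u h).trans (le_max_right _ _)⟩
  · intro u _
    obtain ⟨hr, l, hl⟩ := hx u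
    have h1 : ∀ᶠ v in 𝓝[>] u, ‖x v‖ ≤ ‖x u‖ + 1 :=
      (hr.norm.eventually_lt_const (lt_add_one _)).mono fun _ h => h.le
    have h2 : ∀ᶠ v in 𝓝[<] u, ‖x v‖ ≤ ‖l‖ + 1 :=
      (hl.norm.eventually_lt_const (lt_add_one _)).mono fun _ h => h.le
    have h3 : ∀ᶠ v in 𝓝 u, ‖x v‖ ≤ max (‖l‖ + 1) (‖x u‖ + 1) := by
      rw [← nhdsLT_sup_nhdsGE, eventually_sup]
      refine ⟨h2.mono fun _ h => h.trans (le_max_left _ _), ?_⟩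
      rw [← Set.Ioi_insert, nhdsWithin_insert, eventually_sup]
      refine ⟨?_, h1.mono fun _ h => h.trans (le_max_right _ _)⟩
      have h4 : ‖x u‖ ≤ max (‖l‖ + 1) (‖x u‖ + 1) :=
        le_max_of_le_right (le_add_of_nonneg_right zero_le_one)
      exact h4
    exact ⟨_, mem_nhdsWithin_of_mem_nhds h3, _, fun v hv => hv⟩

theorem CadlagPath.exists_bound_rescale {d : ℕ} {T : ℝ≥0∞} (x : CadlagPath d T) (a : ℝ≥0) :
    ∃ B, ∀ v ≤ a, ‖x.rescale v‖ ≤ B := by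
  rcases eq_or_ne T 0 with rfl | hT
  · exact ⟨0, fun v _ => by simp [CadlagPath.rescale]⟩
  · set j : ℝ≥0 → {u : ℝ≥0 // (u : ℝ≥0∞) < T} := fun v => ⟨timeChange T v, timeChange_lt hT v⟩
    have hj : Continuous j := (continuous_timeChange T).subtype_mk _
    obtain ⟨B, hB⟩ := ((isCompact_Icc (a := 0) (b := a)).image hj).exists_bound_of_cadlag x.2.1
    refine ⟨B, fun v hv => ?_⟩
    rw [CadlagPath.rescale, dif_pos (timeChange_lt hT v)]
    exact hB _ ⟨v, ⟨zero_le, hv⟩, rfl⟩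

/-- The restriction of a càdlàg path on `[0,T'[` to `[0,T[`. -/
def CadlagPath.restrictLE {d : ℕ} {T T' : ℝ≥0∞} (h : T ≤ T') (x : CadlagPath d T') :
    CadlagPath d T :=
  ⟨fun u => x.1 ⟨u.1, u.2.trans_le h⟩, by
    have hc : Continuous fun u : {u : ℝ≥0 // (u : ℝ≥0∞) < T} =>
        (⟨u.1, u.2.trans_le h⟩ : {u : ℝ≥0 // (u : ℝ≥0∞) < T'}) := by fun_prop
    refine ⟨fun u => ⟨?_, ?_⟩, fun u hu => x.2.2 _ hu⟩
    · exact (x.2.1 ⟨u.1, u.2.trans_le h⟩).1.comp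
        (hc.continuousWithinAt.tendsto_nhdsWithin fun v hv => hv)
    · obtain ⟨l, hl⟩ := (x.2.1 ⟨u.1, u.2.trans_le h⟩).2
      exact ⟨l, hl.comp (hc.continuousWithinAt.tendsto_nhdsWithin fun v hv => hv)⟩⟩

/-- After rescaling, restriction is composition with the bounded time change `σ` of
`exists_timeChange_comp`. The cases `T = 0` (a single rescaled path) and `T = T'` (where `σ` would
be the unbounded identity) are separate. -/
theorem CadlagPath.continuous_restrictLE {d : ℕ} {T T' : ℝ≥0∞} (h : T ≤ T') :
    Continuous (CadlagPath.restrictLE (d := d) h) := by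
  refine continuous_iff_continuousAt.2 fun x => ?_
  have hx : Tendsto (fun z : CadlagPath d T' => skorokhodDist x.rescale z.rescale) (𝓝 x) (𝓝 0) := by
    have : Tendsto (fun z : CadlagPath d T' => edist x z) (𝓝 x) (𝓝 (edist x x)) :=
      (continuous_const.edist continuous_id).tendsto x
    rwa [edist_self] at this
  rw [ContinuousAt, tendsto_iff_edist_tendsto_0]
  change Tendsto (fun z : CadlagPath d T' => skorokhodDist (z.restrictLE h).rescale
    (x.restrictLE h).rescale) (𝓝 x) (𝓝 0)
  simp_rw [skorokhodDist_comm _ (x.restrictLE h).rescale]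
  rcases eq_or_ne T 0 with rfl | hT
  · have h0 : ∀ z : CadlagPath d T', (z.restrictLE h).rescale = fun _ => 0 := fun z => by
      ext v; simp [CadlagPath.rescale]
    simp only [h0, skorokhodDist_self]
    exact tendsto_const_nhds
  rcases h.eq_or_lt with rfl | hlt
  · exact hx
  obtain ⟨σ, S, hσ, hc, h0, hS, hcomp⟩ := exists_timeChange_comp hT hlt
  have hres : ∀ z : CadlagPath d T', (z.restrictLE h).rescale = z.rescale ∘ σ := fun z => by
    ext1 v
    have h1 := timeChange_lt hT v
    have h2 := timeChange_lt (hlt.ne_bot) (σ v)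
    simp only [CadlagPath.rescale, Function.comp_apply, dif_pos h1, dif_pos h2,
      CadlagPath.restrictLE]
    simp only [hcomp]
  obtain ⟨B, hB⟩ := x.exists_bound_rescale (S + 1)
  simp only [hres]
  exact tendsto_skorokhodDist_comp hσ hc h0 hS hB hx

end SkorokhodContinuity

/-! ### Restriction maps between the path spaces -/

/-- The restriction of a continuous path on `[0,T']` to `[0,T]`. -/
def ContPath.restrictLE {d : ℕ} {T T' : ℝ≥0∞} (h : T ≤ T') (x : ContPath d T') : ContPath d T :=
  ⟨x.1.comp ⟨fun u => ⟨u.1, u.2.trans h⟩, by fun_prop⟩, x.2⟩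

theorem ContPath.continuous_restrictLE {d : ℕ} {T T' : ℝ≥0∞} (h : T ≤ T') :
    Continuous (ContPath.restrictLE (d := d) h) :=
  Continuous.subtype_mk ((ContinuousMap.continuous_precomp _).comp continuous_subtype_val) _

/-- The factor `r` is what makes cylinder functions and σ-algebras increase with time. Apart from
it, only continuity of the restrictions and pseudometrizability are needed from the path spaces. -/
theorem exists_continuous_restrictPath (k : PathKind) (d : ℕ) {T T' : ℝ≥0∞} (h : T ≤ T') :
    ∃ r : PathSpace k d T' → PathSpace k d T, Continuous r ∧
      ∀ x, r (restrictPath k d T' x) = restrictPath k d T x := by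
  cases k with
  | continuous => exact ⟨ContPath.restrictLE h, ContPath.continuous_restrictLE h, fun x => rfl⟩
  | cadlag => exact ⟨CadlagPath.restrictLE h, CadlagPath.continuous_restrictLE h, fun x => rfl⟩

theorem continuous_restrictPath (k : PathKind) (d : ℕ) (T : ℝ≥0∞) :
    Continuous (restrictPath k d T) := by
  cases k with
  | continuous => exact ContPath.continuous_restrictLE le_top
  | cadlag => exact CadlagPath.continuous_restrictLE le_top

/-- Pseudometrizability supplies continuous functions positive exactly on a given open set, and
approximation of closed sets by functions of `C_b`. For continuous paths it comes from local
compactness of the time interval. -/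
instance (k : PathKind) (d : ℕ) (T : ℝ≥0∞) :
    TopologicalSpace.PseudoMetrizableSpace (PathSpace k d T) := by
  cases k with
  | continuous =>
    have : LocallyCompactSpace {u : ℝ≥0 // (u : ℝ≥0∞) ≤ T} :=
      (isClosed_le ENNReal.continuous_coe
        continuous_const).isClosedEmbedding_subtypeVal.locallyCompactSpace
    exact TopologicalSpace.PseudoMetrizableSpace.subtype
      {x : C({u : ℝ≥0 // (u : ℝ≥0∞) ≤ T}, EuclideanSpace ℝ (Fin d)) | x ⟨0, by simp⟩ = 0}
  | cadlag =>
    exact inferInstanceAs (TopologicalSpace.PseudoMetrizableSpace (CadlagPath d T))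

/-! ### Daniell representation on a space of cylinder functions -/

section Daniell

variable {Ω X : Type*} [TopologicalSpace X]

/-- In a pseudometrizable space, every open set is the set of positivity of a continuous function
with values in `[0,1]`. -/
theorem IsOpen.exists_boundedContinuous_pos_iff [TopologicalSpace.PseudoMetrizableSpace X]
    {U : Set X} (hU : IsOpen U) :
    ∃ g : X →ᵇ ℝ, (∀ x, 0 ≤ g x) ∧ (∀ x, g x ≤ 1) ∧ ∀ x, 0 < g x ↔ x ∈ U := by
  let := TopologicalSpace.pseudoMetrizableSpacePseudoMetric X
  rcases (Uᶜ).eq_empty_or_nonempty with h | h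
  · refine ⟨BoundedContinuousFunction.const X 1, by simp, by simp, fun x => ?_⟩
    simp [Set.compl_empty_iff.1 h]
  · have hc : Continuous fun x => min 1 (Metric.infDist x Uᶜ) := by fun_prop
    have h0 : ∀ x, 0 ≤ min 1 (Metric.infDist x Uᶜ) := fun x =>
      le_min zero_le_one Metric.infDist_nonneg
    refine ⟨BoundedContinuousFunction.ofNormedAddCommGroup _ hc 1 fun x => ?_, fun x => h0 x,
      fun x => min_le_left _ _, fun x => ?_⟩
    · rw [Real.norm_eq_abs, abs_of_nonneg (h0 x)]; exact min_le_left _ _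
    · change 0 < min 1 (Metric.infDist x Uᶜ) ↔ x ∈ U
      rw [lt_min_iff, ← hU.isClosed_compl.notMem_iff_infDist_pos h]
      simp

variable (Λ : (X →ᵇ ℝ) →ₗ[ℝ] ℝ) (π : Ω → X)

/-- The functional `Λ` is positive and continuous along sequences that decrease to `0`, as a
functional of the functions `g ∘ π`. -/
structure IsDaniell : Prop where
  nonneg : ∀ g : X →ᵇ ℝ, (∀ ω, 0 ≤ g (π ω)) → 0 ≤ Λ g
  tendsto_zero : ∀ g : ℕ → X →ᵇ ℝ, (∀ ω, Antitone fun n => g n (π ω)) →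
    (∀ ω, Tendsto (fun n => g n (π ω)) atTop (𝓝 0)) → Tendsto (fun n => Λ (g n)) atTop (𝓝 0)

/-- The supremum of `Λ g` over the functions `g` with `0 ≤ g ∘ π ≤ 1_A`. -/
def daniellContent (A : Set Ω) : ℝ≥0∞ :=
  ⨆ g ∈ {g : X →ᵇ ℝ | (∀ ω, 0 ≤ g (π ω)) ∧ (∀ ω, g (π ω) ≤ 1) ∧ ∀ ω, ω ∉ A → g (π ω) = 0},
    ENNReal.ofReal (Λ g)

variable {Λ π}

/-- In particular `Λ g` depends only on `g ∘ π`, so `π` need not be surjective. -/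
theorem IsDaniell.mono (h : IsDaniell Λ π) {f g : X →ᵇ ℝ} (hfg : ∀ ω, f (π ω) ≤ g (π ω)) :
    Λ f ≤ Λ g := by
  have := h.nonneg (g - f) fun ω => sub_nonneg.2 (hfg ω)
  rw [map_sub] at this
  linarith

theorem le_daniellContent {A : Set Ω} {g : X →ᵇ ℝ} (h0 : ∀ ω, 0 ≤ g (π ω))
    (h1 : ∀ ω, g (π ω) ≤ 1) (h2 : ∀ ω, ω ∉ A → g (π ω) = 0) :
    ENNReal.ofReal (Λ g) ≤ daniellContent Λ π A :=
  le_iSup₂ (f := fun (g : X →ᵇ ℝ) (_ : g ∈ {g : X →ᵇ ℝ | (∀ ω, 0 ≤ g (π ω)) ∧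
    (∀ ω, g (π ω) ≤ 1) ∧ ∀ ω, ω ∉ A → g (π ω) = 0}) => ENNReal.ofReal (Λ g)) g ⟨h0, h1, h2⟩

theorem daniellContent_mono {A B : Set Ω} (hAB : A ⊆ B) :
    daniellContent Λ π A ≤ daniellContent Λ π B :=
  iSup₂_le fun _ hg => le_daniellContent hg.1 hg.2.1 fun ω hω => hg.2.2 ω fun h => hω (hAB h)

theorem daniellContent_empty (h : IsDaniell Λ π) : daniellContent Λ π ∅ = 0 := by
  refine le_antisymm (iSup₂_le fun g hg => ?_) zero_le
  have : Λ g ≤ Λ 0 := h.mono fun ω => (hg.2.2 ω (Set.notMem_empty _)).le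
  rw [map_zero] at this
  rw [ENNReal.ofReal_of_nonpos this]

theorem IsDaniell.content_univ (h : IsDaniell Λ π) :
    daniellContent Λ π Set.univ = ENNReal.ofReal (Λ (BoundedContinuousFunction.const X 1)) :=
  le_antisymm (iSup₂_le fun _ hg => ENNReal.ofReal_le_ofReal (h.mono fun ω => hg.2.1 ω))
    (le_daniellContent (fun _ => zero_le_one) (fun _ => le_rfl)
      fun ω hω => absurd (Set.mem_univ ω) hω)

/-- Let `f` be a test function for the union and `F k = ∑_{n<k} min 1 (k g_n)`, where `g_n` is
positive exactly on `U n`. At each point `F k` eventually dominates `f`, so `(f - F k)⁺` decreases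
to `0` and `Λ` of it vanishes in the limit. The summands of `F k` are test functions for the
individual sets. -/
theorem IsDaniell.content_iUnion_le [TopologicalSpace.PseudoMetrizableSpace X]
    (h : IsDaniell Λ π) {U : ℕ → Set X} (hU : ∀ n, IsOpen (U n)) :
    daniellContent Λ π (⋃ n, π ⁻¹' U n) ≤ ∑' n, daniellContent Λ π (π ⁻¹' U n) := by
  choose g hg0 hg1 hgU using fun n => (hU n).exists_boundedContinuous_pos_iff
  set H : ℕ → ℕ → X →ᵇ ℝ := fun n k => BoundedContinuousFunction.const X 1 ⊓ (k : ℝ) • g n with hH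
  have hHapp : ∀ n k x, H n k x = min 1 (k * g n x) := fun n k x => by simp [hH]
  set F : ℕ → X →ᵇ ℝ := fun k => ∑ n ∈ Finset.range k, H n k with hF
  have hFapp : ∀ k x, F k x = ∑ n ∈ Finset.range k, min 1 (k * g n x) := fun k x => by
    simp [hF, hHapp, BoundedContinuousFunction.sum_apply]
  have hFmono : ∀ x, Monotone fun k => F k x := fun x k l hkl => by
    simp only [hFapp]
    refine (Finset.sum_le_sum (g := fun n => min 1 ((l : ℝ) * g n x)) fun n _ => ?_).trans
      (Finset.sum_le_sum_of_subset_of_nonneg (Finset.range_mono hkl) fun n _ _ => ?_)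
    · have : (k : ℝ) ≤ l := by exact_mod_cast hkl
      exact min_le_min_left _ (mul_le_mul_of_nonneg_right this (hg0 n x))
    · exact le_min zero_le_one (mul_nonneg (Nat.cast_nonneg _) (hg0 n x))
  refine iSup₂_le fun f hf => ?_
  obtain ⟨hf0, hf1, hfU⟩ := hf
  set D : ℕ → X →ᵇ ℝ := fun k => (f - F k) ⊔ 0 with hD
  have hDapp : ∀ k x, D k x = max (f x - F k x) 0 := fun k x => by simp [hD]
  have hDlim : Tendsto (fun k => Λ (D k)) atTop (𝓝 0) := by
    refine h.tendsto_zero D (fun ω k l hkl => ?_) fun ω => ?_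
    · simp only [hDapp]
      exact max_le_max_right _ (sub_le_sub_left (hFmono _ hkl) _)
    · refine tendsto_const_nhds.congr' ?_
      by_cases hω : ω ∈ ⋃ n, π ⁻¹' U n
      · obtain ⟨n, hn⟩ := Set.mem_iUnion.1 hω
        have hpos := (hgU n (π ω)).2 hn
        obtain ⟨k₀, hk₀⟩ := exists_nat_ge (1 / g n (π ω))
        filter_upwards [eventually_ge_atTop k₀, eventually_gt_atTop n] with k hk hkn
        have hk' : (k₀ : ℝ) ≤ k := by exact_mod_cast hk
        have h1 : 1 ≤ k * g n (π ω) := by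
          rw [div_le_iff₀ hpos] at hk₀
          exact hk₀.trans (mul_le_mul_of_nonneg_right hk' hpos.le)
        have h2 : 1 ≤ F k (π ω) := by
          rw [hFapp]
          refine le_trans ?_ (Finset.single_le_sum
            (f := fun n => min 1 ((k : ℝ) * g n (π ω))) (fun i _ => ?_) (Finset.mem_range.2 hkn))
          · simp [h1]
          · exact le_min zero_le_one (mul_nonneg (Nat.cast_nonneg _) (hg0 i _))
        rw [hDapp, max_eq_right]
        linarith [hf1 ω]
      · refine Eventually.of_forall fun k => ?_
        simp only
        rw [hDapp, max_eq_right]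
        have : 0 ≤ F k (π ω) := by
          rw [hFapp]
          exact Finset.sum_nonneg fun i _ =>
            le_min zero_le_one (mul_nonneg (Nat.cast_nonneg _) (hg0 i _))
        linarith [hfU ω hω]
  have hlim : Tendsto (fun k => ENNReal.ofReal (Λ (D k)) +
      ∑' n, daniellContent Λ π (π ⁻¹' U n)) atTop
      (𝓝 (0 + ∑' n, daniellContent Λ π (π ⁻¹' U n))) := by
    refine Tendsto.add ?_ tendsto_const_nhds
    simpa using ENNReal.tendsto_ofReal hDlim
  rw [zero_add] at hlim
  refine ge_of_tendsto' hlim fun k => ?_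
  have h1 : Λ f ≤ Λ (D k) + Λ (F k) := by
    rw [← map_add]
    refine h.mono fun ω => ?_
    have := le_max_left (f (π ω) - F k (π ω)) 0
    rw [BoundedContinuousFunction.add_apply, hDapp]
    linarith
  refine (ENNReal.ofReal_le_ofReal h1).trans (ENNReal.ofReal_add_le.trans ?_)
  gcongr
  have h2 : ∀ n, 0 ≤ Λ (H n k) := fun n => h.nonneg _ fun ω => by
    rw [hHapp]; exact le_min zero_le_one (mul_nonneg (Nat.cast_nonneg _) (hg0 n _))
  rw [hF, map_sum, ENNReal.ofReal_sum_of_nonneg fun n _ => h2 n]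
  refine (Finset.sum_le_sum fun n _ => ?_).trans (ENNReal.sum_le_tsum _)
  refine le_daniellContent (fun ω => ?_) (fun ω => ?_) fun ω hω => ?_
  · rw [hHapp]; exact le_min zero_le_one (mul_nonneg (Nat.cast_nonneg _) (hg0 n _))
  · rw [hHapp]; exact min_le_left _ _
  · have : g n (π ω) = 0 := le_antisymm (not_lt.1 fun hlt => hω ((hgU n _).1 hlt)) (hg0 n _)
    rw [hHapp, this]; simp

/-- This is Carathéodory's condition on open sets. If `f` is a test function for `V ∩ U`, then `V \
U` lies in the open set `W = V ∩ {f < δ}`. Since `(f - δ)⁺` vanishes on `W`, it can be added to any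
test function of `W` to give one of `V`. The loss `δ Λ(1)` tends to `0`. -/
theorem IsDaniell.content_inter_add_le (h : IsDaniell Λ π)
    {U V : Set X} (hV : IsOpen V) {μ : Set Ω → ℝ≥0∞} (hμmono : Monotone μ)
    (hμ : ∀ W, IsOpen W → μ (π ⁻¹' W) = daniellContent Λ π (π ⁻¹' W)) :
    daniellContent Λ π (π ⁻¹' V ∩ π ⁻¹' U) + μ (π ⁻¹' V \ π ⁻¹' U)
      ≤ daniellContent Λ π (π ⁻¹' V) := by
  set c := Λ (BoundedContinuousFunction.const X 1) with hc
  have hc0 : 0 ≤ c := h.nonneg _ fun ω => zero_le_one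
  have key : ∀ f : X →ᵇ ℝ, (∀ ω, 0 ≤ f (π ω)) → (∀ ω, f (π ω) ≤ 1) →
      (∀ ω, ω ∉ π ⁻¹' V ∩ π ⁻¹' U → f (π ω) = 0) → ∀ δ : ℝ, 0 < δ →
      ENNReal.ofReal (Λ f) + μ (π ⁻¹' V \ π ⁻¹' U)
        ≤ daniellContent Λ π (π ⁻¹' V) + ENNReal.ofReal (δ * c) := by
    intro f hf0 hf1 hfU δ hδ
    set W := V ∩ {x | f x < δ} with hW
    have hWo : IsOpen W := hV.inter (isOpen_lt f.continuous continuous_const)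
    have hsub : π ⁻¹' V \ π ⁻¹' U ⊆ π ⁻¹' W := fun ω hω => by
      refine ⟨hω.1, ?_⟩
      change f (π ω) < δ
      rw [hfU ω fun hh => hω.2 hh.2]
      exact hδ
    have h1 : μ (π ⁻¹' V \ π ⁻¹' U) ≤ daniellContent Λ π (π ⁻¹' W) :=
      (hμmono hsub).trans (hμ W hWo).le
    set f' : X →ᵇ ℝ := (f - BoundedContinuousFunction.const X δ) ⊔ 0 with hf'
    have hf'app : ∀ x, f' x = max (f x - δ) 0 := fun x => by simp [hf']
    have h2 : Λ f ≤ Λ f' + δ * c := by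
      rw [hc, ← smul_eq_mul, ← map_smul, ← map_add]
      refine h.mono fun ω => ?_
      rw [BoundedContinuousFunction.add_apply, hf'app]
      have := le_max_left (f (π ω) - δ) 0
      simp only [BoundedContinuousFunction.coe_smul, BoundedContinuousFunction.const_apply,
        smul_eq_mul, mul_one]
      linarith
    have hf'0 : ∀ ω, 0 ≤ f' (π ω) := fun ω => by rw [hf'app]; exact le_max_right _ _
    have h3 : ENNReal.ofReal (Λ f') + daniellContent Λ π (π ⁻¹' W)
        ≤ daniellContent Λ π (π ⁻¹' V) := by
      unfold daniellContent
      rw [ENNReal.add_biSup]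
      · refine iSup₂_le fun w hw => ?_
        obtain ⟨hw0, hw1, hwW⟩ := hw
        rw [← ENNReal.ofReal_add (h.nonneg _ hf'0) (h.nonneg _ hw0), ← map_add]
        refine le_daniellContent (fun ω => add_nonneg (hf'0 ω) (hw0 ω)) (fun ω => ?_)
          fun ω hω => ?_
        · rw [BoundedContinuousFunction.add_apply, hf'app]
          by_cases hω : ω ∈ π ⁻¹' W
          · have : f (π ω) < δ := hω.2
            rw [max_eq_right (by linarith), zero_add]
            exact hw1 ω
          · rw [hwW ω hω, add_zero]
            exact max_le (by linarith [hf1 ω]) zero_le_one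
        · rw [BoundedContinuousFunction.add_apply, hf'app, hfU ω fun hh => hω hh.1,
            hwW ω fun hh => hω hh.1, add_zero]
          exact max_eq_right (by linarith)
      · exact ⟨0, by simp⟩
    calc ENNReal.ofReal (Λ f) + μ (π ⁻¹' V \ π ⁻¹' U)
        ≤ (ENNReal.ofReal (Λ f') + ENNReal.ofReal (δ * c)) + daniellContent Λ π (π ⁻¹' W) := by
          gcongr
          exact (ENNReal.ofReal_le_ofReal h2).trans ENNReal.ofReal_add_le
      _ = ENNReal.ofReal (Λ f') + daniellContent Λ π (π ⁻¹' W) + ENNReal.ofReal (δ * c) := by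
          ring
      _ ≤ _ := by gcongr
  conv_lhs => rw [daniellContent]
  rw [ENNReal.biSup_add]
  · refine iSup₂_le fun f hf => ?_
    obtain ⟨hf0, hf1, hfU⟩ := hf
    have hlim : Tendsto (fun δ : ℝ => daniellContent Λ π (π ⁻¹' V) + ENNReal.ofReal (δ * c))
        (𝓝[>] 0) (𝓝 (daniellContent Λ π (π ⁻¹' V) + ENNReal.ofReal (0 * c))) := by
      refine Tendsto.mono_left ?_ nhdsWithin_le_nhds
      exact tendsto_const_nhds.add (ENNReal.tendsto_ofReal (tendsto_id.mul_const c))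
    rw [zero_mul, ENNReal.ofReal_zero, add_zero] at hlim
    refine ge_of_tendsto hlim ?_
    filter_upwards [self_mem_nhdsWithin] with δ hδ
    exact key f hf0 hf1 hfU δ hδ
  · exact ⟨0, by simp⟩

/-- The inequality `Λ g ≤ ∫ g ∘ π dQ` for `0 ≤ g ∘ π ≤ 1`, when `Q` dominates the content of `Λ`. -/
theorem IsDaniell.le_integral (h : IsDaniell Λ π) {Q : @Measure Ω ((borel X).comap π)}
    [IsFiniteMeasure Q]
    (hQ : ∀ U, IsOpen U → daniellContent Λ π (π ⁻¹' U) ≤ Q (π ⁻¹' U)) {g : X →ᵇ ℝ}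
    (hg0 : ∀ ω, 0 ≤ g (π ω)) (hg1 : ∀ ω, g (π ω) ≤ 1) : Λ g ≤ ∫ ω, g (π ω) ∂Q := by
  let : MeasurableSpace Ω := (borel X).comap π
  let : MeasurableSpace X := borel X
  have : BorelSpace X := ⟨rfl⟩
  have hπ : Measurable π := comap_measurable π
  have hgm : Measurable fun ω => g (π ω) := g.continuous.measurable.comp hπ
  have hgi : Integrable (fun ω => g (π ω)) Q :=
    Integrable.of_bound hgm.aestronglyMeasurable 1 (ae_of_all _ fun ω => by
      rw [Real.norm_eq_abs, abs_of_nonneg (hg0 ω)]; exact hg1 ω)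
  have key : ∀ n : ℕ, 0 < n → Λ g ≤ ∫ ω, g (π ω) ∂Q + (n : ℝ)⁻¹ * Q.real Set.univ := by
    intro n hn
    have hn' : (0 : ℝ) < n := by exact_mod_cast hn
    -- Layers of height `1` of `n g`: they add up to `n g` for `i < n` because `g ∘ π ≤ 1`, and the
    -- `i`-th one is carried by `{n g > i}`.
    set w : ℕ → X →ᵇ ℝ := fun i =>
      BoundedContinuousFunction.const X 1 ⊓
        (((n : ℝ) • g - BoundedContinuousFunction.const X (i : ℝ)) ⊔ 0)
      with hw
    have hwapp : ∀ i x, w i x = min 1 (max (n * g x - i) 0) := fun i x => by simp [hw]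
    have hw0 : ∀ i x, 0 ≤ w i x := fun i x => by
      rw [hwapp]; exact le_min zero_le_one (le_max_right _ _)
    have hsum : ∀ (k : ℕ) (a : ℝ), 0 ≤ a →
        ∑ i ∈ Finset.range k, min 1 (max (a - (i : ℝ)) 0) = min (k : ℝ) a := by
      intro k a ha
      induction k with
      | zero => simp [ha]
      | succ k ih =>
        rw [Finset.sum_range_succ, ih]
        push_cast
        rcases le_total a k with h1 | h1
        · rw [min_eq_right h1, max_eq_right (by linarith), min_eq_right (zero_le_one),
            min_eq_right (by linarith)]
          ring
        · rw [min_eq_left h1, max_eq_left (by linarith)]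
          rcases le_total a (k + 1) with h2 | h2
          · rw [min_eq_right (by linarith), min_eq_right h2]; ring
          · rw [min_eq_left (by linarith), min_eq_left h2]
    set U : ℕ → Set X := fun i => {x | (i : ℝ) < n * g x} with hU
    have hUo : ∀ i, IsOpen (U i) := fun i =>
      isOpen_lt continuous_const (continuous_const.mul g.continuous)
    have hUm : ∀ i, MeasurableSet (π ⁻¹' U i) := fun i => hπ (hUo i).measurableSet
    have h1 : ∀ i, Λ (w i) ≤ Q.real (π ⁻¹' U i) := by
      intro i
      have : ENNReal.ofReal (Λ (w i)) ≤ Q (π ⁻¹' U i) := by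
        refine (le_daniellContent (fun ω => hw0 i _) (fun ω => ?_) fun ω hω => ?_).trans
          (hQ _ (hUo i))
        · rw [hwapp]; exact min_le_left _ _
        · have : n * g (π ω) ≤ i := not_lt.1 hω
          rw [hwapp, max_eq_right (by linarith), min_eq_right zero_le_one]
      exact (ENNReal.ofReal_le_iff_le_toReal (measure_ne_top _ _)).1 this
    have h2 : n * Λ g ≤ ∑ i ∈ Finset.range n, Λ (w i) := by
      rw [← smul_eq_mul, ← map_smul, ← map_sum]
      refine h.mono fun ω => ?_
      rw [BoundedContinuousFunction.sum_apply]
      simp only [hwapp]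
      rw [hsum n _ (mul_nonneg hn'.le (hg0 ω)), min_eq_right]
      · simp
      · nlinarith [hg1 ω]
    have h3 : ∑ i ∈ Finset.range n, Q.real (π ⁻¹' U i)
        ≤ ∫ ω, (n * g (π ω) + 1) ∂Q := by
      have : ∀ i, Q.real (π ⁻¹' U i) = ∫ ω, (π ⁻¹' U i).indicator (fun _ => (1 : ℝ)) ω ∂Q :=
        fun i => by rw [integral_indicator_const _ (hUm i)]; simp
      simp_rw [this]
      rw [← integral_finsetSum _ fun i _ => (integrable_const (1 : ℝ)).indicator (hUm i)]
      refine integral_mono (integrable_finsetSum _ fun i _ =>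
        (integrable_const (1 : ℝ)).indicator (hUm i))
        ((hgi.const_mul _).add (integrable_const _)) fun ω => ?_
      simp only
      -- The indicator of `{n g > i}` is below the `i`-th layer of `n g + 1`, so the summation
      -- identity applies again. The extra mass disappears after division by `n`.
      have hle : ∀ i : ℕ, (π ⁻¹' U i).indicator (fun _ => (1 : ℝ)) ω
          ≤ min 1 (max (n * g (π ω) + 1 - (i : ℝ)) 0) := by
        intro i
        by_cases hi : ω ∈ π ⁻¹' U i
        · have : (i : ℝ) < n * g (π ω) := hi
          rw [Set.indicator_of_mem hi, max_eq_left (by linarith), min_eq_left (by linarith)]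
        · rw [Set.indicator_of_notMem hi]
          exact le_min zero_le_one (le_max_right _ _)
      refine (Finset.sum_le_sum fun i _ => hle i).trans ?_
      rw [hsum n _ (by have := hg0 ω; positivity)]
      exact min_le_right _ _
    rw [integral_add (hgi.const_mul _) (integrable_const _), integral_const_mul] at h3
    simp only [integral_const, smul_eq_mul, mul_one] at h3
    have h4 : n * Λ g ≤ n * ∫ ω, g (π ω) ∂Q + Q.real Set.univ :=
      h2.trans ((Finset.sum_le_sum fun i _ => h1 i).trans h3)
    have h5 := mul_le_mul_of_nonneg_left h4 (inv_nonneg.2 hn'.le)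
    rw [← mul_assoc, inv_mul_cancel₀ hn'.ne', one_mul, mul_add, ← mul_assoc,
      inv_mul_cancel₀ hn'.ne', one_mul] at h5
    exact h5
  have hlim : Tendsto (fun n : ℕ => ∫ ω, g (π ω) ∂Q + (n : ℝ)⁻¹ * Q.real Set.univ) atTop
      (𝓝 (∫ ω, g (π ω) ∂Q + 0 * Q.real Set.univ)) :=
    tendsto_const_nhds.add (tendsto_inv_atTop_nhds_zero_nat.mul_const _)
  rw [zero_mul, add_zero] at hlim
  refine ge_of_tendsto hlim ?_
  filter_upwards [eventually_gt_atTop 0] with n hn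
  exact key n hn

/-- **Daniell representation**: a positive functional that is continuous along sequences decreasing
to `0` is the integral with respect to a finite measure. -/
theorem IsDaniell.exists_measure [TopologicalSpace.PseudoMetrizableSpace X] (h : IsDaniell Λ π) :
    ∃ Q : @Measure Ω ((borel X).comap π), IsFiniteMeasure Q ∧
      ∀ g : X →ᵇ ℝ, ∫ ω, g (π ω) ∂Q = Λ g := by
  let mX : MeasurableSpace X := borel X
  have : BorelSpace X := ⟨rfl⟩
  set Pr : Set Ω → Prop := fun A => ∃ U, IsOpen U ∧ π ⁻¹' U = A with hPr
  set m : ∀ A, Pr A → ℝ≥0∞ := fun A _ => daniellContent Λ π A with hm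
  have P0 : Pr ∅ := ⟨∅, isOpen_empty, rfl⟩
  have m0 : m ∅ P0 = 0 := daniellContent_empty h
  have PU : ∀ ⦃f : ℕ → Set Ω⦄ (_ : ∀ i, Pr (f i)), Pr (⋃ i, f i) := by
    intro f hf
    choose U hU hUf using hf
    exact ⟨⋃ i, U i, isOpen_iUnion hU, by rw [Set.preimage_iUnion]; simp_rw [hUf]⟩
  have msU : ∀ ⦃f : ℕ → Set Ω⦄ (hf : ∀ i, Pr (f i)),
      m (⋃ i, f i) (PU hf) ≤ ∑' i, m (f i) (hf i) := by
    intro f hf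
    choose U hU hUf using id hf
    have := h.content_iUnion_le hU
    simp_rw [hUf] at this
    exact this
  have mm : ∀ ⦃s t : Set Ω⦄ (hs : Pr s) (ht : Pr t), s ⊆ t → m s hs ≤ m t ht :=
    fun s t _ _ hst => daniellContent_mono hst
  set μ := inducedOuterMeasure m P0 m0 with hμ
  have hμeq : ∀ U, IsOpen U → μ (π ⁻¹' U) = daniellContent Λ π (π ⁻¹' U) := fun U hU =>
    inducedOuterMeasure_eq' PU msU mm ⟨U, hU, rfl⟩
  have hcar : (borel X).comap π ≤ μ.caratheodory := by
    rw [borel, MeasurableSpace.comap_generateFrom]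
    refine MeasurableSpace.generateFrom_le ?_
    rintro _ ⟨U, hU, rfl⟩
    rw [inducedOuterMeasure_caratheodory PU msU mm]
    rintro _ ⟨V, hV, rfl⟩
    -- It is enough to test Carathéodory measurability on the generating sets, where the outer
    -- measure is the content.
    rw [← hμ, hμeq V hV, ← Set.preimage_inter, hμeq _ (hV.inter hU), Set.preimage_inter]
    exact h.content_inter_add_le hV (fun s t hst => μ.mono hst) hμeq
  let : MeasurableSpace Ω := (borel X).comap π
  have hπ : Measurable π := comap_measurable π
  set Q := μ.toMeasure hcar with hQ
  have hQU : ∀ U, IsOpen U → Q (π ⁻¹' U) = daniellContent Λ π (π ⁻¹' U) := fun U hU => by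
    rw [hQ, toMeasure_apply _ _ (hπ hU.measurableSet), hμeq U hU]
  have hQuniv : Q Set.univ = ENNReal.ofReal (Λ (BoundedContinuousFunction.const X 1)) := by
    have := hQU Set.univ isOpen_univ
    rwa [Set.preimage_univ, h.content_univ] at this
  have hfin : IsFiniteMeasure Q := ⟨by rw [hQuniv]; exact ENNReal.ofReal_lt_top⟩
  have hQreal : Q.real Set.univ = Λ (BoundedContinuousFunction.const X 1) := by
    rw [Measure.real, hQuniv, ENNReal.toReal_ofReal (h.nonneg _ fun ω => zero_le_one)]
  refine ⟨Q, hfin, fun g => ?_⟩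
  have hint : ∀ f : X →ᵇ ℝ, Integrable (fun ω => f (π ω)) Q := fun f =>
    Integrable.of_bound (f.continuous.measurable.comp hπ).aestronglyMeasurable ‖f‖
      (ae_of_all _ fun ω => f.norm_coe_le_norm _)
  -- The one-sided inequality is applied to `f` and to `1 - f`. As `Q` has total mass `Λ 1`,
  -- equality follows.
  have heq : ∀ f : X →ᵇ ℝ, (∀ ω, 0 ≤ f (π ω)) → (∀ ω, f (π ω) ≤ 1) →
      ∫ ω, f (π ω) ∂Q = Λ f := by
    intro f hf0 hf1
    refine le_antisymm ?_ (h.le_integral (fun U hU => (hQU U hU).ge) hf0 hf1)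
    have := h.le_integral (Q := Q) (fun U hU => (hQU U hU).ge)
      (g := BoundedContinuousFunction.const X 1 - f) (fun ω => sub_nonneg.2 (hf1 ω))
      (fun ω => sub_le_self _ (hf0 ω))
    simp only [BoundedContinuousFunction.sub_apply, BoundedContinuousFunction.const_apply] at this
    rw [integral_sub (integrable_const _) (hint f), map_sub, integral_const, hQreal, smul_eq_mul,
      mul_one] at this
    linarith
  -- `(g + ‖g‖) / c` takes values in `[0,1]`; the summand `1` keeps `c` positive when `g = 0`.
  set c := 2 * ‖g‖ + 1 with hc
  have hc0 : 0 < c := by positivity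
  set f : X →ᵇ ℝ := c⁻¹ • (g + BoundedContinuousFunction.const X ‖g‖) with hf
  have hfapp : ∀ x, f x = c⁻¹ * (g x + ‖g‖) := fun x => by simp [hf, mul_add]
  have hgb : ∀ x, |g x| ≤ ‖g‖ := fun x => g.norm_coe_le_norm x
  have h1 := heq f (fun ω => by
    rw [hfapp]
    have := (abs_le.1 (hgb (π ω))).1
    have : 0 ≤ g (π ω) + ‖g‖ := by linarith
    positivity) (fun ω => by
    rw [hfapp, inv_mul_le_iff₀ hc0]
    have := (abs_le.1 (hgb (π ω))).2
    linarith)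
  simp only [hfapp] at h1
  have hconst : BoundedContinuousFunction.const X ‖g‖ =
      ‖g‖ • BoundedContinuousFunction.const X 1 := by
    ext; simp
  rw [integral_const_mul, integral_add (hint g) (integrable_const _), integral_const, hQreal, hf,
    map_smul, map_add, hconst, map_smul, smul_eq_mul, smul_eq_mul, smul_eq_mul] at h1
  have h2 := mul_left_cancel₀ (inv_ne_zero hc0.ne') h1
  linarith

end Daniell

/-! ### Existence and uniqueness of essential suprema -/

section EssSup

variable {Ω : Type*} {m m0 : MeasurableSpace Ω}

/-- Every family of measurable sets has a countable subfamily whose union contains every member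
of the family up to null sets. -/
theorem exists_countable_iUnion_ae_cover {ι : Type*} (μ : Measure[m0] Ω) [IsFiniteMeasure μ]
    {S : Set ι} {A : ι → Set Ω} (hA : ∀ i ∈ S, MeasurableSet[m0] (A i)) :
    ∃ C ⊆ S, C.Countable ∧ ∀ i ∈ S, μ (A i \ ⋃ j ∈ C, A j) = 0 := by
  -- Exhaustion: the union of a maximizing sequence of countable subfamilies attains the supremum,
  -- so adjoining one more set cannot increase the measure.
  set T : Set ℝ≥0∞ := {v | ∃ C ⊆ S, C.Countable ∧ v = μ (⋃ j ∈ C, A j)} with hT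
  have hTne : T.Nonempty := ⟨_, ∅, Set.empty_subset _, Set.countable_empty, rfl⟩
  obtain ⟨v, -, hvlim, hvT⟩ := exists_seq_tendsto_sSup hTne (OrderTop.bddAbove T)
  choose C hCS hCc hCv using hvT
  have hUS : (⋃ n, C n) ⊆ S := Set.iUnion_subset hCS
  have hUc : (⋃ n, C n).Countable := Set.countable_iUnion hCc
  have hsup : sSup T ≤ μ (⋃ j ∈ ⋃ n, C n, A j) :=
    le_of_tendsto' hvlim fun n => by
      rw [hCv n]
      exact measure_mono (Set.biUnion_subset_biUnion_left (Set.subset_iUnion C n))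
  refine ⟨⋃ n, C n, hUS, hUc, fun i hi => ?_⟩
  have hmeas : MeasurableSet[m0] (⋃ j ∈ ⋃ n, C n, A j) :=
    MeasurableSet.biUnion hUc fun j hj => hA j (hUS hj)
  have h1 : μ (⋃ j ∈ insert i (⋃ n, C n), A j) ≤ μ (⋃ j ∈ ⋃ n, C n, A j) :=
    (le_sSup (a := μ (⋃ j ∈ insert i (⋃ n, C n), A j)) (s := T)
      ⟨_, Set.insert_subset hi hUS, hUc.insert i, rfl⟩).trans hsup
  rw [Set.biUnion_insert, ← Set.sdiff_union_self,
    measure_union Set.disjoint_sdiff_left hmeas] at h1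
  have h2 : μ (A i \ ⋃ j ∈ ⋃ n, C n, A j) + μ (⋃ j ∈ ⋃ n, C n, A j)
      ≤ 0 + μ (⋃ j ∈ ⋃ n, C n, A j) := by rwa [zero_add]
  exact le_antisymm ((ENNReal.add_le_add_iff_right (measure_ne_top _ _)).1 h2) zero_le

/-- For each rational `q`, countably many members of `S` cover all the sets `{f > q}` up to null
sets. The pointwise supremum over the union of these countable subfamilies is an essential supremum,
since a strict inequality between values would be separated by a rational. -/
theorem exists_isEssSupFamily (hm : m ≤ m0) (μ : Measure[m0] Ω) [IsFiniteMeasure μ]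
    {S : Set (Ω → EReal)} (hS : ∀ f ∈ S, Measurable[m] f) : ∃ g, IsEssSupFamily m μ S g := by
  have hA : ∀ q : ℚ, ∀ f ∈ S, MeasurableSet[m0] {ω | (((q : ℝ) : EReal)) < f ω} := fun q f hf =>
    hm _ (hS f hf measurableSet_Ioi)
  choose C hCS hCc hC using fun q => exists_countable_iUnion_ae_cover μ (hA q)
  set D := ⋃ q, C q with hD
  have hDc : D.Countable := Set.countable_iUnion hCc
  have hDS : D ⊆ S := Set.iUnion_subset hCS
  refine ⟨fun ω => ⨆ f ∈ D, f ω, ?_, fun f hf => ?_, fun h _ hh => ?_⟩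
  · exact Measurable.biSup D hDc fun f hf => hS f (hDS hf)
  · have h1 : ∀ᵐ ω ∂μ, ∀ q : ℚ,
        ω ∉ {ω | (((q : ℝ) : EReal)) < f ω} \ ⋃ g ∈ C q, {ω | (((q : ℝ) : EReal)) < g ω} :=
      ae_all_iff.2 fun q => measure_eq_zero_iff_ae_notMem.1 (hC q f hf)
    filter_upwards [h1] with ω hω
    by_contra hlt
    obtain ⟨q, hq1, hq2⟩ := EReal.lt_iff_exists_rat_btwn.1 (not_le.1 hlt)
    refine hω q ⟨hq2, fun hmem => ?_⟩
    obtain ⟨g, hg, hgω⟩ := Set.mem_iUnion₂.1 hmem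
    exact absurd (hq1.trans hgω)
      (not_lt.2 (le_iSup₂ (f := fun f (_ : f ∈ D) => f ω) g (Set.mem_iUnion.2 ⟨q, hg⟩)))
  · have h1 : ∀ᵐ ω ∂μ, ∀ f ∈ D, f ω ≤ h ω := (ae_ball_iff hDc).2 fun f hf => hh f (hDS hf)
    filter_upwards [h1] with ω hω
    exact iSup₂_le hω

theorem IsEssSupFamily.ae_eq {μ : Measure[m0] Ω} {S : Set (Ω → EReal)} {g g' : Ω → EReal}
    (h : IsEssSupFamily m μ S g) (h' : IsEssSupFamily m μ S g') : g =ᵐ[μ] g' := by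
  filter_upwards [h.2.2 g' h'.1 h'.2.1, h'.2.2 g h.1 h.2.1] with ω h1 h2
  exact le_antisymm h1 h2

theorem isEssSupFamily_essSupFamily {μ : Measure[m0] Ω} {S : Set (Ω → EReal)}
    (h : ∃ g, IsEssSupFamily m μ S g) : IsEssSupFamily m μ S (essSupFamily m μ S) :=
  Classical.epsilon_spec h

end EssSup

/-! ### Convex functions -/

section ConvexFunctions

/-- A finite convex function on a real vector space has a subgradient at every point. -/
theorem exists_subgradient {E : Type*} [AddCommGroup E] [Module ℝ E] {h : E → ℝ}
    (hconv : ConvexOn ℝ Set.univ h) (x : E) :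
    ∃ ℓ : E →ₗ[ℝ] ℝ, ∀ y, h x + ℓ (y - x) ≤ h y := by
  -- The cone generated by the epigraph of `h` translated so that `(x, h x)` becomes the origin. The
  -- form `(0, r) ↦ r` is nonnegative on its intersection with the vertical line, and the Riesz
  -- theorem extends it to a form nonnegative on the cone. Minus its horizontal part is the
  -- subgradient.
  let s : PointedCone ℝ (E × ℝ) :=
    { carrier := {w | ∃ a : ℝ, 0 < a ∧ h (x + a • w.1) - h x ≤ a * w.2}
      zero_mem' := ⟨1, one_pos, by simp⟩
      add_mem' := by
        rintro ⟨z, r⟩ ⟨z', r'⟩ ⟨a, ha, hz⟩ ⟨b, hb, hz'⟩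
        simp only at hz hz'
        have hab : 0 < a + b := add_pos ha hb
        -- With this scale, `x + a b / (a + b) • (z + z')` is the convex combination of `x + a • z`
        -- and `x + b • z'` with weights `b / (a + b)` and `a / (a + b)`.
        refine ⟨a * b / (a + b), by positivity, ?_⟩
        have h1 := hconv.2 (Set.mem_univ (x + a • z)) (Set.mem_univ (x + b • z'))
          (show 0 ≤ b / (a + b) by positivity) (show 0 ≤ a / (a + b) by positivity)
          (by rw [← add_div, add_comm b, div_self hab.ne'])
        have h2 : (b / (a + b)) • (x + a • z) + (a / (a + b)) • (x + b • z')
            = x + (a * b / (a + b)) • (z + z') := by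
          have h3 : x = (b / (a + b)) • x + (a / (a + b)) • x := by
            rw [← add_smul, ← add_div, add_comm b, div_self hab.ne', one_smul]
          conv_rhs => rw [h3]
          rw [smul_add, smul_add, smul_add, smul_smul, smul_smul,
            show b / (a + b) * a = a * b / (a + b) by ring,
            show a / (a + b) * b = a * b / (a + b) by ring]
          abel
        rw [h2, smul_eq_mul, smul_eq_mul] at h1
        have h4 : b / (a + b) * h (x + a • z) ≤ b / (a + b) * (h x + a * r) :=
          mul_le_mul_of_nonneg_left (by linarith) (by positivity)
        have h5 : a / (a + b) * h (x + b • z') ≤ a / (a + b) * (h x + b * r') :=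
          mul_le_mul_of_nonneg_left (by linarith) (by positivity)
        have h6 : b / (a + b) * (h x + a * r) + a / (a + b) * (h x + b * r')
            = h x + a * b / (a + b) * (r + r') := by field_simp; ring
        change h (x + (a * b / (a + b)) • (z + z')) - h x ≤ a * b / (a + b) * (r + r')
        linarith
      smul_mem' := by
        rintro ⟨c, hc⟩ ⟨z, r⟩ ⟨a, ha, hz⟩
        simp only at hz
        rcases hc.eq_or_lt with rfl | hc
        · exact ⟨1, one_pos, by
            change h (x + (1 : ℝ) • ((0 : ℝ) • z)) - h x ≤ 1 * ((0 : ℝ) * r)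
            simp⟩
        · refine ⟨a / c, by positivity, ?_⟩
          change h (x + (a / c) • (c • z)) - h x ≤ a / c * (c * r)
          rwa [smul_smul, div_mul_cancel₀ _ hc.ne', ← mul_assoc, div_mul_cancel₀ _ hc.ne'] }
  let f : E × ℝ →ₗ.[ℝ] ℝ :=
    ⟨LinearMap.ker (LinearMap.fst ℝ E ℝ), (LinearMap.snd ℝ E ℝ).domRestrict _⟩
  obtain ⟨g, hgf, hgs⟩ := riesz_extension s f
    (by
      rintro ⟨⟨z, r⟩, hz⟩ ⟨a, ha, hw⟩
      have hz' : z = 0 := hz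
      subst hz'
      simp only [smul_zero, add_zero, sub_self] at hw
      change 0 ≤ r
      exact nonneg_of_mul_nonneg_right hw ha)
    (by
      rintro ⟨z, r⟩
      refine ⟨⟨(0, h (x + z) - h x - r), rfl⟩, 1, one_pos, ?_⟩
      simp)
  have hg0 : ∀ r : ℝ, g (0, r) = r := fun r => hgf ⟨(0, r), rfl⟩
  refine ⟨-(g.comp (LinearMap.inl ℝ E ℝ)), fun y => ?_⟩
  have h1 := hgs (y - x, h y - h x) ⟨1, one_pos, by simp⟩
  have h2 : ((y - x, h y - h x) : E × ℝ) = (y - x, 0) + (0, h y - h x) := by simp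
  rw [h2, map_add, hg0] at h1
  simp only [LinearMap.neg_apply, LinearMap.comp_apply, LinearMap.inl_apply]
  linarith

/-- On a Banach space ordered by a closed cone, a monotone convex function is upper semicontinuous
along positive increments that tend to `0`. -/
theorem exists_le_add_of_monotone_convex {E : Type*} [NormedAddCommGroup E] [NormedSpace ℝ E]
    [CompleteSpace E] {C : PointedCone ℝ E} (hC : IsClosed (C : Set E)) {h : E → ℝ}
    (hconv : ConvexOn ℝ Set.univ h) (hmono : ∀ x y, y - x ∈ C → h x ≤ h y) (x : E) {z : ℕ → E}
    (hz : ∀ n, z n ∈ C) (hz0 : Tendsto (fun n => ‖z n‖) atTop (𝓝 0)) {ε : ℝ} (hε : 0 < ε) :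
    ∃ n, h (x + z n) ≤ h x + ε := by
  have hex : ∀ j : ℕ, ∃ n, ‖z n‖ ≤ (4⁻¹ : ℝ) ^ j := fun j =>
    ((hz0.eventually_lt_const (show (0 : ℝ) < 4⁻¹ ^ j by positivity)).mono
      fun _ h => h.le).exists
  choose φ hφ using hex
  -- The selected increments have norm at most `4^{-j}`, so they remain summable when multiplied by
  -- `2^j`. The sum `S` then dominates every `y j`, because the cone is closed.
  set y : ℕ → E := fun j => (2 : ℝ) ^ j • z (φ j) with hy
  have hsmul : ∀ a : ℝ, 0 ≤ a → ∀ w ∈ C, a • w ∈ C := fun a ha w hw => C.smul_mem ha hw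
  have hyC : ∀ j, y j ∈ C := fun j => hsmul _ (by positivity) _ (hz _)
  have hynorm : ∀ j, ‖y j‖ ≤ (2⁻¹ : ℝ) ^ j := fun j => by
    rw [hy, norm_smul, Real.norm_of_nonneg (by positivity)]
    calc (2 : ℝ) ^ j * ‖z (φ j)‖ ≤ 2 ^ j * 4⁻¹ ^ j := by gcongr; exact hφ j
      _ = 2⁻¹ ^ j := by rw [← mul_pow]; norm_num
  have hsum : Summable y := Summable.of_norm_bounded
    (summable_geometric_of_lt_one (by norm_num) (by norm_num)) hynorm
  set S := ∑' j, y j with hS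
  have hSC : ∀ j, S - y j ∈ C := by
    intro j
    have hlim := (hsum.hasSum.tendsto_sum_nat).sub_const (y j)
    refine hC.mem_of_tendsto hlim ?_
    filter_upwards [eventually_gt_atTop j] with n hn
    rw [← Finset.sum_erase_eq_sub (Finset.mem_range.2 hn)]
    exact Submodule.sum_mem _ fun i _ => hyC i
  -- `x + z (φ j)` is the convex combination of `x` and `x + y j` with weight `2^{-j}` on the
  -- latter, and `h (x + y j) ≤ h (x + S)`.
  have hbound : ∀ j, h (x + z (φ j)) ≤ h x + (2⁻¹ : ℝ) ^ j * (h (x + S) - h x) := by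
    intro j
    have ht0 : (0 : ℝ) ≤ 2⁻¹ ^ j := by positivity
    have ht1 : (2⁻¹ : ℝ) ^ j ≤ 1 := pow_le_one₀ (by norm_num) (by norm_num)
    have h1 := hconv.2 (Set.mem_univ x) (Set.mem_univ (x + y j)) (sub_nonneg.2 ht1) ht0
      (by ring)
    have h2 : (1 - (2⁻¹ : ℝ) ^ j) • x + (2⁻¹ : ℝ) ^ j • (x + y j) = x + z (φ j) := by
      rw [hy, smul_add, smul_smul, ← mul_pow, inv_mul_cancel₀ two_ne_zero, one_pow, one_smul,
        ← add_assoc, ← add_smul, sub_add_cancel, one_smul]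
    have h3 : h (x + y j) ≤ h (x + S) := hmono _ _ (by rw [add_sub_add_left_eq_sub]; exact hSC j)
    rw [h2, smul_eq_mul, smul_eq_mul] at h1
    have h4 := mul_le_mul_of_nonneg_left h3 ht0
    linarith
  have hlim : Tendsto (fun j : ℕ => (2⁻¹ : ℝ) ^ j * (h (x + S) - h x)) atTop
      (𝓝 (0 * (h (x + S) - h x))) :=
    (tendsto_pow_atTop_nhds_zero_of_lt_one (by norm_num) (by norm_num)).mul_const _
  rw [zero_mul] at hlim
  obtain ⟨j, hj⟩ := (hlim.eventually_lt_const hε).exists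
  exact ⟨φ j, (hbound j).trans (by linarith)⟩

end ConvexFunctions

/-! ### The capacity and operators on `L¹(c)` -/

section PointwiseMaps

variable {Ω : Type*} [TopologicalSpace Ω]

/-- A map of `C_b(Ω)` that acts pointwise by `K`-Lipschitz functions. -/
def IsPointwiseLipschitz (K : ℝ≥0) (φ : Ω → ℝ → ℝ) (Φ : (Ω →ᵇ ℝ) → Ω →ᵇ ℝ) : Prop :=
  (∀ f ω, Φ f ω = φ ω (f ω)) ∧ ∀ ω, LipschitzWith K (φ ω)

theorem isPointwiseLipschitz_comp {θ : ℝ → ℝ} (hθ : LipschitzWith 1 θ) :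
    IsPointwiseLipschitz (Ω := Ω) 1 (fun _ => θ) (BoundedContinuousFunction.comp θ hθ) :=
  ⟨fun _ _ => rfl, fun _ => hθ⟩

theorem isPointwiseLipschitz_mul (g : Ω →ᵇ ℝ) :
    IsPointwiseLipschitz ‖g‖₊ (fun ω a => g ω * a) (fun f => g * f) :=
  ⟨fun _ _ => rfl, fun ω => LipschitzWith.of_dist_le_mul fun a b => by
    rw [Real.dist_eq, Real.dist_eq, ← mul_sub, abs_mul]
    exact mul_le_mul_of_nonneg_right (g.norm_coe_le_norm ω) (abs_nonneg _)⟩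

theorem comp_mem_cylinderFun {X : Type*} [TopologicalSpace X] {π : Ω → X} {θ : ℝ → ℝ}
    (hθ : LipschitzWith 1 θ) {f : Ω →ᵇ ℝ} (hf : f ∈ cylinderFun π) :
    BoundedContinuousFunction.comp θ hθ f ∈ cylinderFun π := by
  obtain ⟨g, hg⟩ := hf
  exact ⟨g.comp θ hθ, fun ω => by simp [hg]⟩

theorem mul_mem_cylinderFun {X : Type*} [TopologicalSpace X] {π : Ω → X} {f g : Ω →ᵇ ℝ}
    (hf : f ∈ cylinderFun π) (hg : g ∈ cylinderFun π) : f * g ∈ cylinderFun π := by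
  obtain ⟨f', hf'⟩ := hf
  obtain ⟨g', hg'⟩ := hg
  exact ⟨f' * g', fun ω => by simp [hf', hg']⟩

theorem compContinuous_mem_cylinderFun {X : Type*} [TopologicalSpace X] {π : Ω → X}
    (hπ : Continuous π) (g : X →ᵇ ℝ) : g.compContinuous ⟨π, hπ⟩ ∈ cylinderFun π :=
  ⟨g, fun _ => rfl⟩

theorem abs_mem_cylinderFun {X : Type*} [TopologicalSpace X] {π : Ω → X} {f : Ω →ᵇ ℝ}
    (hf : f ∈ cylinderFun π) : |f| ∈ cylinderFun π := by
  obtain ⟨g, hg⟩ := hf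
  exact ⟨|g|, fun ω => by simp [hg]⟩

end PointwiseMaps

/-! ### Dini continuity of the capacity, and extension of pointwise Lipschitz maps to `L¹(c)`. -/

section CapacityOperators

variable {Ω : Type*} [TopologicalSpace Ω] [MeasurableSpace Ω] [OpensMeasurableSpace Ω]
  {𝒦 : Set (ProbabilityMeasure Ω)} {p : ℝ≥0∞} [Fact (1 ≤ p)]

theorem capacity_mono {f g : Ω →ᵇ ℝ} (h : ∀ ω, |f ω| ≤ |g ω|) :
    capacity 𝒦 p f ≤ capacity 𝒦 p g :=
  ENNReal.toReal_mono (iSup_eLpNorm_ne_top 𝒦 p g)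
    (iSup₂_mono fun R _ => eLpNorm_mono (μ := (R : Measure Ω)) fun ω => h ω)

/-- By Dini's theorem, the capacity is continuous along sequences decreasing to `0`. -/
theorem tendsto_capacity_zero (h𝒦 : IsCompact (closure 𝒦)) (hp : p ≠ ⊤) {f : ℕ → Ω →ᵇ ℝ}
    (hanti : ∀ ω, Antitone fun n => f n ω) (hlim : ∀ ω, Tendsto (fun n => f n ω) atTop (𝓝 0)) :
    Tendsto (fun n => capacity 𝒦 p (f n)) atTop (𝓝 0) := by
  have hp1 : (1 : ℝ≥0∞) ≤ p := Fact.out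
  have hp0 : p ≠ 0 := (zero_lt_one.trans_le hp1).ne'
  set q := p.toReal with hq
  have hq0 : 0 < q := ENNReal.toReal_pos hp0 hp
  have hf0 : ∀ n ω, 0 ≤ f n ω := fun n ω => (hanti ω).le_of_tendsto (hlim ω) n
  have hle : ∀ n ω, f n ω ≤ ‖f 0‖ := fun n ω =>
    (hanti ω (Nat.zero_le n)).trans ((le_abs_self _).trans ((f 0).norm_coe_le_norm ω))
  -- The `q`-th powers turn the norms into expectations of functions of `C_b(Ω)`, which are weakly
  -- continuous in `R`. Dini's theorem then applies on the compact closure of `𝒦`.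
  let F : ℕ → Ω →ᵇ ℝ := fun n => BoundedContinuousFunction.ofNormedAddCommGroup
    (fun ω => f n ω ^ q) ((f n).continuous.rpow_const fun _ => Or.inr hq0.le) (‖f 0‖ ^ q)
    fun ω => by
      rw [Real.norm_of_nonneg (Real.rpow_nonneg (hf0 n ω) q)]
      exact Real.rpow_le_rpow (hf0 n ω) (hle n ω) hq0.le
  have hFapp : ∀ n ω, F n ω = f n ω ^ q := fun n ω => rfl
  have hF0 : ∀ n ω, 0 ≤ F n ω := fun n ω => Real.rpow_nonneg (hf0 n ω) q
  have hFint : ∀ n (R : ProbabilityMeasure Ω), Integrable (F n) (R : Measure Ω) := fun n R =>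
    (F n).integrable _
  have hunif : TendstoUniformlyOn
      (fun n (R : ProbabilityMeasure Ω) => ∫ ω, F n ω ∂(R : Measure Ω)) (fun _ => 0) atTop
      (closure 𝒦) := by
    refine Antitone.tendstoUniformlyOn_of_forall_tendsto h𝒦
      (fun n => (ProbabilityMeasure.continuous_integral_boundedContinuousFunction
        (F n)).continuousOn) (fun R _ n k hnk => ?_) continuousOn_const fun R _ => ?_
    · exact integral_mono (hFint k R) (hFint n R) fun ω =>
        Real.rpow_le_rpow (hf0 k ω) (hanti ω hnk) hq0.le
    · have := tendsto_integral_of_dominated_convergence (μ := (R : Measure Ω))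
        (F := fun n => F n) (f := fun _ => (0 : ℝ)) (fun _ => ‖f 0‖ ^ q)
        (fun n => (F n).continuous.measurable.aestronglyMeasurable) (integrable_const _)
        (fun n => ae_of_all _ fun ω => by
          rw [Real.norm_of_nonneg (hF0 n ω)]
          exact Real.rpow_le_rpow (hf0 n ω) (hle n ω) hq0.le)
        (ae_of_all _ fun ω => by
          have h1 : Tendsto (fun n => f n ω ^ q) atTop (𝓝 (0 ^ q)) :=
            (hlim ω).rpow_const (Or.inr hq0.le)
          rwa [Real.zero_rpow hq0.ne'] at h1)
      simpa using this
  rw [Metric.tendsto_atTop]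
  intro ε hε
  have hδ : 0 < (ε / 2) ^ q := Real.rpow_pos_of_pos (half_pos hε) q
  obtain ⟨N, hN⟩ := eventually_atTop.1 (Metric.tendstoUniformlyOn_iff.1 hunif _ hδ)
  refine ⟨N, fun n hn => ?_⟩
  have hcap : capacity 𝒦 p (f n) ≤ ε / 2 := by
    refine ENNReal.toReal_le_of_le_ofReal (half_pos hε).le (iSup₂_le fun R hR => ?_)
    have h1 := hN n hn R (subset_closure hR)
    rw [dist_zero_left, Real.norm_of_nonneg (integral_nonneg fun ω => hF0 n ω)] at h1
    rw [eLpNorm_eq_lintegral_rpow_enorm_toReal hp0 hp, ← hq]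
    have h2 : ∫⁻ ω, ‖f n ω‖ₑ ^ q ∂(R : Measure Ω)
        = ENNReal.ofReal (∫ ω, F n ω ∂(R : Measure Ω)) := by
      rw [ofReal_integral_eq_lintegral_ofReal (hFint n R) (ae_of_all _ (hF0 n))]
      refine lintegral_congr fun ω => ?_
      rw [hFapp, Real.enorm_of_nonneg (hf0 n ω), ENNReal.ofReal_rpow_of_nonneg (hf0 n ω) hq0.le]
    rw [h2, one_div, ENNReal.rpow_inv_le_iff hq0,
      ENNReal.ofReal_rpow_of_nonneg (half_pos hε).le hq0.le]
    exact ENNReal.ofReal_le_ofReal h1.le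
  rw [dist_zero_right, Real.norm_of_nonneg (apply_nonneg _ _)]
  linarith

theorem norm_toL1c (f : Ω →ᵇ ℝ) : ‖toL1c 𝒦 p f‖ = capacity 𝒦 p f :=
  Completion.norm_coe (E := CbCap 𝒦 p) f

theorem denseRange_toL1c : DenseRange (toL1c 𝒦 p) :=
  Completion.denseRange_coe (α := CbCap 𝒦 p)

theorem L1cSub_coe {X : Type*} [TopologicalSpace X] (π : Ω → X) :
    (L1cSub 𝒦 p π : Set (L1c 𝒦 p)) = closure (toL1c 𝒦 p '' (cylinderFun π : Set (Ω →ᵇ ℝ))) := by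
  rw [L1cSub, Submodule.topologicalClosure_coe, Submodule.map_coe]

theorem toL1c_mem_L1cSub {X : Type*} [TopologicalSpace X] {π : Ω → X} {f : Ω →ᵇ ℝ}
    (hf : f ∈ cylinderFun π) : toL1c 𝒦 p f ∈ L1cSub 𝒦 p π :=
  Submodule.le_topologicalClosure _ (Submodule.mem_map_of_mem hf)

variable (𝒦 p) in
/-- The extension to `L¹(c)` of a map of `C_b(Ω)`. -/
def L1c.map (Φ : (Ω →ᵇ ℝ) → Ω →ᵇ ℝ) : L1c 𝒦 p → L1c 𝒦 p :=
  Completion.map (α := CbCap 𝒦 p) (β := CbCap 𝒦 p) Φ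

namespace IsPointwiseLipschitz

variable {K : ℝ≥0} {φ : Ω → ℝ → ℝ} {Φ : (Ω →ᵇ ℝ) → Ω →ᵇ ℝ}

/-- The pointwise bound passes to `c` since `c(f)` is monotone in `|f|`. -/
theorem lipschitzWith (h : IsPointwiseLipschitz K φ Φ) :
    LipschitzWith K (show CbCap 𝒦 p → CbCap 𝒦 p from Φ) := by
  have h1 : ∀ a b : Ω →ᵇ ℝ, @dist (CbCap 𝒦 p) _ a b = capacity 𝒦 p (a - b) := fun a b =>
    dist_eq_norm (E := CbCap 𝒦 p) a b
  have h2 : ∀ f g : Ω →ᵇ ℝ, capacity 𝒦 p (Φ f - Φ g) ≤ K * capacity 𝒦 p (f - g) := by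
    intro f g
    have hK : ‖(K : ℝ)‖ = K := Real.norm_of_nonneg K.coe_nonneg
    rw [← hK, ← map_smul_eq_mul (capacity 𝒦 p)]
    refine capacity_mono fun ω => ?_
    have h3 := (h.2 ω).dist_le_mul (f ω) (g ω)
    rw [Real.dist_eq, Real.dist_eq, ← h.1, ← h.1] at h3
    change |Φ f ω - Φ g ω| ≤ |(K : ℝ) * (f ω - g ω)|
    rwa [abs_mul, abs_of_nonneg K.coe_nonneg]
  exact LipschitzWith.of_dist_le_mul fun f g =>
    (h1 _ _).trans_le ((h2 f g).trans_eq (congrArg ((K : ℝ) * ·) (h1 f g).symm))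

theorem map_toL1c (h : IsPointwiseLipschitz K φ Φ) (f : Ω →ᵇ ℝ) :
    L1c.map 𝒦 p Φ (toL1c 𝒦 p f) = toL1c 𝒦 p (Φ f) :=
  Completion.map_coe (α := CbCap 𝒦 p) (β := CbCap 𝒦 p)
    (h.lipschitzWith (𝒦 := 𝒦) (p := p)).uniformContinuous f

theorem lipschitzWith_map (h : IsPointwiseLipschitz K φ Φ) : LipschitzWith K (L1c.map 𝒦 p Φ) :=
  (h.lipschitzWith (𝒦 := 𝒦) (p := p)).completion_map

theorem map_mem (h : IsPointwiseLipschitz K φ Φ) {C C' : Set (Ω →ᵇ ℝ)} (hC : Set.MapsTo Φ C C')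
    {X : L1c 𝒦 p} (hX : X ∈ closure (toL1c 𝒦 p '' C)) :
    L1c.map 𝒦 p Φ X ∈ closure (toL1c 𝒦 p '' C') := by
  refine map_mem_closure (h.lipschitzWith_map (𝒦 := 𝒦) (p := p)).continuous hX ?_
  rintro _ ⟨f, hf, rfl⟩
  exact ⟨Φ f, hC hf, (h.map_toL1c f).symm⟩

theorem map_mem_L1cSub (h : IsPointwiseLipschitz K φ Φ) {X : Type*} [TopologicalSpace X] {π : Ω → X}
    (hC : ∀ f ∈ cylinderFun π, Φ f ∈ cylinderFun π) {Z : L1c 𝒦 p} (hZ : Z ∈ L1cSub 𝒦 p π) :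
    L1c.map 𝒦 p Φ Z ∈ L1cSub 𝒦 p π := by
  rw [← SetLike.mem_coe, L1cSub_coe] at hZ ⊢
  exact h.map_mem hC hZ

end IsPointwiseLipschitz

/-- Truncations at level `n` of an element of `L¹(c)` converge to it. -/
theorem tendsto_map_comp {θ : ℕ → ℝ → ℝ} (hθ : ∀ n, LipschitzWith 1 (θ n))
    (hid : ∀ (n : ℕ) (a : ℝ), |a| ≤ n → θ n a = a) (X : L1c 𝒦 p) :
    Tendsto (fun n => L1c.map 𝒦 p (BoundedContinuousFunction.comp (θ n) (hθ n)) X) atTop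
      (𝓝 X) := by
  rw [Metric.tendsto_atTop]
  intro ε hε
  -- All truncations are `1`-Lipschitz for `c` and fix `f` once `n ≥ ‖f‖`, so convergence on a dense
  -- set is enough.
  obtain ⟨f, hf⟩ := Metric.denseRange_iff.1 (denseRange_toL1c (𝒦 := 𝒦) (p := p)) X (ε / 2)
    (half_pos hε)
  obtain ⟨N, hN⟩ := exists_nat_ge ‖f‖
  refine ⟨N, fun n hn => ?_⟩
  have h1 : BoundedContinuousFunction.comp (θ n) (hθ n) f = f := by
    ext ω
    rw [BoundedContinuousFunction.comp_apply]
    refine hid n _ ((f.norm_coe_le_norm ω).trans (hN.trans ?_))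
    exact_mod_cast hn
  have h2 := isPointwiseLipschitz_comp (Ω := Ω) (hθ n)
  have h3 := (h2.lipschitzWith_map (𝒦 := 𝒦) (p := p)).dist_le_mul X (toL1c 𝒦 p f)
  rw [h2.map_toL1c, h1, NNReal.coe_one, one_mul] at h3
  refine (dist_triangle _ (toL1c 𝒦 p f) _).trans_lt ?_
  rw [dist_comm (toL1c 𝒦 p f) X]
  linarith

end CapacityOperators

/-! ### Versions of elements of `L¹(c)` -/

theorem measurable_edist_real {β : Type*} {m : MeasurableSpace β} {f g : β → ℝ}
    (hf : Measurable f) (hg : Measurable g) : Measurable fun b => edist (f b) (g b) :=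
  hf.edist hg

theorem lintegral_edist_trim {Ω : Type*} {m m' : MeasurableSpace Ω} (hm : m' ≤ m) {Q : Measure[m] Ω}
    {f g : Ω → ℝ} (hf : Measurable[m'] f) (hg : Measurable[m'] g) :
    ∫⁻ ω, edist (f ω) (g ω) ∂Q.trim hm = ∫⁻ ω, edist (f ω) (g ω) ∂Q :=
  lintegral_trim hm (measurable_edist_real hf hg)

theorem lipschitzWith_abs : LipschitzWith 1 fun a : ℝ => |a| :=
  LipschitzWith.of_dist_le_mul fun a b => by simpa [Real.dist_eq] using abs_abs_sub_abs_le a b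

theorem integrable_of_measurable_bcf {Ω : Type*} [TopologicalSpace Ω] {m : MeasurableSpace Ω}
    {Q : Measure[m] Ω} [IsFiniteMeasure Q] {f : Ω →ᵇ ℝ} (hf : Measurable[m] f) :
    Integrable f Q :=
  Integrable.of_bound (C := ‖f‖) hf.aestronglyMeasurable (ae_of_all _ fun ω => f.norm_coe_le_norm ω)

section VersionCalculus

variable {Ω : Type*} [TopologicalSpace Ω] {m : MeasurableSpace Ω} [MeasurableSpace Ω]
  [OpensMeasurableSpace Ω] {𝒦 : Set (ProbabilityMeasure Ω)} {p : ℝ≥0∞} [Fact (1 ≤ p)]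

/-- `C` is stable under absolute values, its elements are measurable for the σ-algebra of `Q`, and
the integral under `Q` is a continuous form on the closure of `C` in `L¹(c)`. -/
structure IsDominated (𝒦 : Set (ProbabilityMeasure Ω)) (p : ℝ≥0∞) [Fact (1 ≤ p)]
    (C : Submodule ℝ (Ω →ᵇ ℝ)) (Q : Measure[m] Ω) : Prop where
  measurable : ∀ f ∈ C, Measurable[m] f
  abs_mem : ∀ f ∈ C, |f| ∈ C
  inDual : InDual 𝒦 p C Q

variable {C : Submodule ℝ (Ω →ᵇ ℝ)} {Q : Measure[m] Ω}

namespace IsDominated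

theorem integrable [IsFiniteMeasure Q] (h : IsDominated 𝒦 p C Q) {f : Ω →ᵇ ℝ} (hf : f ∈ C) :
    Integrable f Q := integrable_of_measurable_bcf (h.measurable f hf)

/-- The bound on `|∫ f|` becomes an `L¹(Q)` bound when applied to `|f|`, which belongs to `C` and
has the same capacity as `f`. -/
theorem exists_lintegral_le [IsFiniteMeasure Q] (h : IsDominated 𝒦 p C Q) :
    ∃ K : ℝ≥0, ∀ f ∈ C, ∫⁻ ω, ‖f ω‖ₑ ∂Q ≤ K * ‖toL1c 𝒦 p f‖ₑ := by
  obtain ⟨K, hK⟩ := h.inDual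
  refine ⟨K.toNNReal, fun f hf => ?_⟩
  have h1 := hK _ (h.abs_mem f hf)
  have h2 : capacity 𝒦 p |f| = capacity 𝒦 p f :=
    le_antisymm (capacity_mono fun ω => by simp) (capacity_mono fun ω => by simp)
  rw [h2] at h1
  have h3 : ∫⁻ ω, ‖f ω‖ₑ ∂Q = ENNReal.ofReal (∫ ω, |f| ω ∂Q) := by
    rw [ofReal_integral_eq_lintegral_ofReal (h.integrable (h.abs_mem f hf))
      (ae_of_all _ fun ω => by simp)]
    refine lintegral_congr fun ω => ?_
    simp [Real.enorm_eq_ofReal_abs]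
  have h4 : (K.toNNReal : ℝ≥0∞) * ‖toL1c 𝒦 p f‖ₑ
      = ENNReal.ofReal (max K 0 * capacity 𝒦 p f) := by
    rw [ENNReal.ofReal_mul (le_max_right _ _), ← norm_toL1c, ofReal_norm]
    congr 1
    rw [← Real.coe_toNNReal', ENNReal.ofReal_coe_nnreal]
  rw [h3, h4]
  refine ENNReal.ofReal_le_ofReal ((le_abs_self _).trans (h1.trans ?_))
  exact mul_le_mul_of_nonneg_right (le_max_left _ _) (apply_nonneg _ _)

end IsDominated

namespace IsVersion

variable {X X' : L1c 𝒦 p} {Y Y' : Ω → ℝ}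

theorem exists_seq (h : IsVersion C Q X Y) : ∃ f : ℕ → Ω →ᵇ ℝ, (∀ n, f n ∈ C) ∧
    Tendsto (fun n => toL1c 𝒦 p (f n)) atTop (𝓝 X) ∧
    Tendsto (fun n => ∫⁻ ω, edist (f n ω) (Y ω) ∂Q) atTop (𝓝 0) := by
  have hpos : ∀ n : ℕ, (0 : ℝ≥0∞) < ((n : ℝ≥0∞) + 1)⁻¹ := fun n => by simp
  have hlim : Tendsto (fun n : ℕ => ((n : ℝ≥0∞) + 1)⁻¹) atTop (𝓝 0) := by
    have := ENNReal.tendsto_inv_nat_nhds_zero.comp (tendsto_add_atTop_nat 1)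
    refine this.congr fun n => ?_
    simp
  choose f hfC hfX hfY using fun n => h.2 _ (hpos n)
  refine ⟨f, hfC, ?_, ?_⟩
  · rw [tendsto_iff_edist_tendsto_0]
    refine tendsto_of_tendsto_of_tendsto_of_le_of_le tendsto_const_nhds hlim (fun _ => zero_le)
      fun n => ?_
    rw [edist_comm]
    exact (hfX n).le
  · exact tendsto_of_tendsto_of_tendsto_of_le_of_le tendsto_const_nhds hlim (fun _ => zero_le)
      fun n => (hfY n).le

theorem of_seq (hY : Integrable Y Q) {f : ℕ → Ω →ᵇ ℝ} (hf : ∀ n, f n ∈ C)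
    (hX : Tendsto (fun n => toL1c 𝒦 p (f n)) atTop (𝓝 X))
    (hfY : Tendsto (fun n => ∫⁻ ω, edist (f n ω) (Y ω) ∂Q) atTop (𝓝 0)) :
    IsVersion C Q X Y := by
  refine ⟨hY, fun ε hε => ?_⟩
  rw [tendsto_iff_edist_tendsto_0] at hX
  obtain ⟨n, h1, h2⟩ := ((hX.eventually_lt_const hε).and (hfY.eventually_lt_const hε)).exists
  exact ⟨f n, hf n, by rwa [edist_comm], h2⟩

theorem toL1c_of_mem [IsFiniteMeasure Q] (hd : IsDominated 𝒦 p C Q) {f : Ω →ᵇ ℝ} (hf : f ∈ C) :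
    IsVersion C Q (toL1c 𝒦 p f) f :=
  ⟨hd.integrable hf, fun ε hε => ⟨f, hf, by simpa using hε, by simpa using hε⟩⟩

theorem sub [IsFiniteMeasure Q] (hd : IsDominated 𝒦 p C Q) (h : IsVersion C Q X Y)
    (h' : IsVersion C Q X' Y') : IsVersion C Q (X - X') (fun ω => Y ω - Y' ω) := by
  obtain ⟨f, hf, hX, hY⟩ := h.exists_seq
  obtain ⟨f', hf', hX', hY'⟩ := h'.exists_seq
  refine of_seq (h.1.sub h'.1) (fun n => C.sub_mem (hf n) (hf' n)) (f := fun n => f n - f' n)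
    (by simpa only [map_sub] using hX.sub hX') ?_
  refine tendsto_of_tendsto_of_tendsto_of_le_of_le tendsto_const_nhds
    (by simpa using hY.add hY') (fun _ => zero_le) fun n => ?_
  have hm : AEMeasurable (fun ω => edist (f n ω) (Y ω)) Q := by
    simp only [edist_eq_enorm_sub]
    exact ((hd.integrable (hf n)).sub h.1).aestronglyMeasurable.enorm
  rw [← lintegral_add_left' hm]
  refine lintegral_mono fun ω => ?_
  simp only [BoundedContinuousFunction.sub_apply, sub_eq_add_neg (f n ω), sub_eq_add_neg (Y ω)]
  refine (edist_add_add_le _ _ _ _).trans ?_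
  rw [edist_neg_neg]

theorem map [IsFiniteMeasure Q] (h : IsVersion C Q X Y) {K : ℝ≥0} {φ : Ω → ℝ → ℝ}
    {Φ : (Ω →ᵇ ℝ) → Ω →ᵇ ℝ} (hΦ : IsPointwiseLipschitz K φ Φ) (hC : ∀ f ∈ C, Φ f ∈ C)
    (hint : Integrable (fun ω => φ ω (Y ω)) Q) :
    IsVersion C Q (L1c.map 𝒦 p Φ X) (fun ω => φ ω (Y ω)) := by
  obtain ⟨f, hf, hX, hY⟩ := h.exists_seq
  refine of_seq hint (f := fun n => Φ (f n)) (fun n => hC _ (hf n)) ?_ ?_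
  · have := ((hΦ.lipschitzWith_map (𝒦 := 𝒦) (p := p)).continuous.tendsto X).comp hX
    refine this.congr fun n => ?_
    exact hΦ.map_toL1c (f n)
  · have h1 : Tendsto (fun n => (K : ℝ≥0∞) * ∫⁻ ω, edist (f n ω) (Y ω) ∂Q) atTop (𝓝 0) := by
      have := ENNReal.Tendsto.const_mul (a := (K : ℝ≥0∞)) hY (Or.inr ENNReal.coe_ne_top)
      simpa using this
    refine tendsto_of_tendsto_of_tendsto_of_le_of_le tendsto_const_nhds h1 (fun _ => zero_le)
      fun n => ?_
    simp only
    rw [← lintegral_const_mul' _ _ ENNReal.coe_ne_top]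
    refine lintegral_mono fun ω => ?_
    simp only [hΦ.1]
    exact hΦ.2 ω _ _

theorem map_comp [IsFiniteMeasure Q] (h : IsVersion C Q X Y) {θ : ℝ → ℝ} (hθ : LipschitzWith 1 θ)
    (hC : ∀ f ∈ C, BoundedContinuousFunction.comp θ hθ f ∈ C) :
    IsVersion C Q (L1c.map 𝒦 p (BoundedContinuousFunction.comp θ hθ) X) (fun ω => θ (Y ω)) := by
  refine h.map (isPointwiseLipschitz_comp hθ) hC ?_
  refine Integrable.mono' (g := fun ω => ‖Y ω‖ + ‖θ 0‖) (h.1.norm.add (integrable_const _))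
    (hθ.continuous.comp_aestronglyMeasurable h.1.aestronglyMeasurable) (ae_of_all _ fun ω => ?_)
  have := hθ.dist_le_mul (Y ω) 0
  rw [NNReal.coe_one, one_mul, dist_eq_norm, dist_zero_right] at this
  calc ‖θ (Y ω)‖ = ‖(θ (Y ω) - θ 0) + θ 0‖ := by rw [sub_add_cancel]
    _ ≤ _ := (norm_add_le _ _).trans (by linarith)

theorem map_mul [IsFiniteMeasure Q] (h : IsVersion C Q X Y) {g : Ω →ᵇ ℝ} (hg : Measurable[m] g)
    (hC : ∀ f ∈ C, g * f ∈ C) :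
    IsVersion C Q (L1c.map 𝒦 p (fun f => g * f) X) (fun ω => g ω * Y ω) :=
  h.map (isPointwiseLipschitz_mul g) hC
    (h.1.bdd_mul (c := ‖g‖) hg.aestronglyMeasurable (ae_of_all _ fun ω => g.norm_coe_le_norm ω))

/-- The approximating functions tend to `0` for `c`, hence in `L¹(Q)` by domination, while they also
tend to `Y` there. -/
theorem ae_eq_zero [IsFiniteMeasure Q] (hd : IsDominated 𝒦 p C Q)
    (h : IsVersion C Q (0 : L1c 𝒦 p) Y) :
    Y =ᵐ[Q] 0 := by
  obtain ⟨K, hK⟩ := hd.exists_lintegral_le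
  obtain ⟨f, hf, hX, hY⟩ := h.exists_seq
  have h1 : Tendsto (fun n => (K : ℝ≥0∞) * ‖toL1c 𝒦 p (f n)‖ₑ
      + ∫⁻ ω, edist (f n ω) (Y ω) ∂Q) atTop (𝓝 (K * ‖(0 : L1c 𝒦 p)‖ₑ + 0)) :=
    (ENNReal.Tendsto.const_mul hX.enorm (Or.inr ENNReal.coe_ne_top)).add hY
  rw [enorm_zero, mul_zero, add_zero] at h1
  have h2 : ∫⁻ ω, ‖Y ω‖ₑ ∂Q ≤ 0 := by
    refine ge_of_tendsto' h1 fun n => ?_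
    calc ∫⁻ ω, ‖Y ω‖ₑ ∂Q ≤ ∫⁻ ω, (‖f n ω‖ₑ + edist (f n ω) (Y ω)) ∂Q := by
          refine lintegral_mono fun ω => ?_
          simp only [← edist_zero_right]
          rw [add_comm, edist_comm (f n ω) (Y ω)]
          exact edist_triangle _ _ _
      _ = ∫⁻ ω, ‖f n ω‖ₑ ∂Q + ∫⁻ ω, edist (f n ω) (Y ω) ∂Q :=
          lintegral_add_left' (hd.integrable (hf n)).aestronglyMeasurable.enorm _
      _ ≤ _ := by gcongr; exact hK _ (hf n)
  have h3 := (lintegral_eq_zero_iff' h.1.aestronglyMeasurable.enorm).1 (le_antisymm h2 zero_le)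
  filter_upwards [h3] with ω hω
  simpa using hω

theorem ae_eq [IsFiniteMeasure Q] (hd : IsDominated 𝒦 p C Q) (h : IsVersion C Q X Y)
    (h' : IsVersion C Q X Y') : Y =ᵐ[Q] Y' := by
  have h1 := h.sub hd h'
  rw [sub_self] at h1
  filter_upwards [h1.ae_eq_zero hd] with ω hω
  exact sub_eq_zero.1 hω

theorem add [IsFiniteMeasure Q] (hd : IsDominated 𝒦 p C Q) (h : IsVersion C Q X Y)
    (h' : IsVersion C Q X' Y') : IsVersion C Q (X + X') (fun ω => Y ω + Y' ω) := by
  have h0 : IsVersion C Q (0 : L1c 𝒦 p) (fun _ => 0) := by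
    have := toL1c_of_mem hd C.zero_mem
    rwa [map_zero] at this
  simpa using h.sub hd (h0.sub hd h')

theorem map_eq_integral [IsFiniteMeasure Q] (hd : IsDominated 𝒦 p C Q) (h : IsVersion C Q X Y)
    {Λ : L1c 𝒦 p → ℝ} (hΛ : Continuous Λ) (hΛQ : ∀ f ∈ C, Λ (toL1c 𝒦 p f) = ∫ ω, f ω ∂Q) :
    Λ X = ∫ ω, Y ω ∂Q := by
  obtain ⟨f, hf, hX, hY⟩ := h.exists_seq
  have h1 : Tendsto (fun n => ∫ ω, f n ω ∂Q) atTop (𝓝 (∫ ω, Y ω ∂Q)) := by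
    refine tendsto_integral_of_L1 _ h.1.aestronglyMeasurable
      (Eventually.of_forall fun n => hd.integrable (hf n)) ?_
    simpa only [edist_eq_enorm_sub] using hY
  refine tendsto_nhds_unique ((hΛ.tendsto X).comp hX) (h1.congr fun n => ?_)
  exact (hΛQ _ (hf n)).symm

/-- The equation `|X| = X` is closed in `L¹(c)` and holds for nonnegative functions of `C_b`, hence
on the whole positive cone. By uniqueness of versions, `Y` equals `|Y|` a.e. -/
theorem ae_nonneg [IsFiniteMeasure Q] (hd : IsDominated 𝒦 p ⊤ Q) (h : IsVersion ⊤ Q X Y)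
    (hX : L1c.LEq 0 X) : ∀ᵐ ω ∂Q, 0 ≤ Y ω := by
  rw [L1c.LEq, sub_zero] at hX
  have habs : L1c.map 𝒦 p (BoundedContinuousFunction.comp _ lipschitzWith_abs) X = X := by
    have hc := ((isPointwiseLipschitz_comp (Ω := Ω) lipschitzWith_abs).lipschitzWith_map
      (𝒦 := 𝒦) (p := p)).continuous
    refine (isClosed_eq hc continuous_id).closure_subset_iff.2 ?_ hX
    rintro _ ⟨f, hf, rfl⟩
    change L1c.map 𝒦 p _ (toL1c 𝒦 p f) = toL1c 𝒦 p f
    rw [(isPointwiseLipschitz_comp (Ω := Ω) lipschitzWith_abs).map_toL1c]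
    congr 1
    ext ω
    exact abs_of_nonneg (hf ω)
  have h1 := h.map_comp lipschitzWith_abs fun f _ => Submodule.mem_top
  rw [habs] at h1
  filter_upwards [h.ae_eq hd h1] with ω hω
  rw [hω]
  exact abs_nonneg _

end IsVersion

/-- A sequence of `C` that is Cauchy for `c` is Cauchy in `L¹(Q)`, which is complete. -/
theorem exists_isVersion [IsFiniteMeasure Q] (hd : IsDominated 𝒦 p C Q) {X : L1c 𝒦 p}
    (hX : X ∈ closure (toL1c 𝒦 p '' (C : Set (Ω →ᵇ ℝ)))) :
    ∃ Y, Measurable[m] Y ∧ IsVersion C Q X Y := by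
  obtain ⟨u, hu, hlim⟩ := mem_closure_iff_seq_limit.1 hX
  choose f hfC hfu using hu
  obtain rfl : (fun n => toL1c 𝒦 p (f n)) = u := funext hfu
  obtain ⟨K, hK⟩ := hd.exists_lintegral_le
  set F : ℕ → Lp ℝ 1 Q := fun n => (hd.integrable (hfC n)).toL1 (f n) with hF
  have hdist : ∀ n k, edist (F n) (F k) ≤ K * edist (toL1c 𝒦 p (f n)) (toL1c 𝒦 p (f k)) := by
    intro n k
    rw [hF, Integrable.edist_toL1_toL1, edist_eq_enorm_sub (toL1c 𝒦 p (f n)), ← map_sub]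
    refine le_trans (le_of_eq (lintegral_congr fun ω => ?_)) (hK _ (C.sub_mem (hfC n) (hfC k)))
    rw [edist_eq_enorm_sub]; rfl
  have hcau : CauchySeq F := by
    have hc := hlim.cauchySeq
    rw [EMetric.cauchySeq_iff] at hc ⊢
    intro ε hε
    have hδ : 0 < ε / (K + 1) := ENNReal.div_pos hε.ne' (by finiteness)
    obtain ⟨N, hN⟩ := hc _ hδ
    refine ⟨N, fun n hn k hk => (hdist n k).trans_lt ?_⟩
    have h1 := hN n hn k hk
    calc (K : ℝ≥0∞) * edist (toL1c 𝒦 p (f n)) (toL1c 𝒦 p (f k))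
        ≤ (K + 1) * edist (toL1c 𝒦 p (f n)) (toL1c 𝒦 p (f k)) := by gcongr; exact le_self_add
      _ < ε := by
        rw [mul_comm]
        exact (ENNReal.lt_div_iff_mul_lt (Or.inl (by simp)) (Or.inl (by finiteness))).1 h1
  obtain ⟨Y, hY⟩ := cauchySeq_tendsto_of_complete hcau
  refine ⟨Y, (Lp.stronglyMeasurable Y).measurable, IsVersion.of_seq (L1.integrable_coeFn Y) hfC
    hlim ?_⟩
  rw [tendsto_iff_edist_tendsto_0] at hY
  refine hY.congr fun n => ?_
  rw [L1.edist_def]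
  refine lintegral_congr_ae ?_
  filter_upwards [(hd.integrable (hfC n)).coeFn_toL1] with ω hω
  rw [hω]

theorem isVersion_versionUnder [IsFiniteMeasure Q] (hd : IsDominated 𝒦 p C Q) {X : L1c 𝒦 p}
    (hX : X ∈ closure (toL1c 𝒦 p '' (C : Set (Ω →ᵇ ℝ)))) :
    IsVersion C Q X (versionUnder C Q X) := by
  obtain ⟨Y, -, hY⟩ := exists_isVersion hd hX
  exact Classical.epsilon_spec (p := fun Y => IsVersion C Q X Y) ⟨Y, hY⟩

end VersionCalculus

theorem IsVersion.of_trim {Ω : Type*} [TopologicalSpace Ω] {m m' : MeasurableSpace Ω}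
    [MeasurableSpace Ω] [OpensMeasurableSpace Ω] {𝒦 : Set (ProbabilityMeasure Ω)} {p : ℝ≥0∞}
    [Fact (1 ≤ p)] {C C' : Submodule ℝ (Ω →ᵇ ℝ)} {Q : Measure[m] Ω} {X : L1c 𝒦 p} {Y : Ω → ℝ}
    (hm : m' ≤ m)
    (hC : C ≤ C') (hCm : ∀ f ∈ C, Measurable[m'] f) (hY : Measurable[m'] Y)
    (h : IsVersion C (Q.trim hm) X Y) : IsVersion C' Q X Y := by
  refine ⟨integrable_of_integrable_trim hm h.1, fun ε hε => ?_⟩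
  obtain ⟨f, hf, h1, h2⟩ := h.2 ε hε
  refine ⟨f, hC hf, h1, ?_⟩
  rwa [lintegral_edist_trim hm (hCm f hf) hY] at h2

/-! ### The order of `L¹(c)` under a measure of the canonical class -/

section CanonicalOrder

theorem IsVersion.smul {Ω : Type*} [TopologicalSpace Ω] {m : MeasurableSpace Ω} [MeasurableSpace Ω]
    [OpensMeasurableSpace Ω] {𝒦 : Set (ProbabilityMeasure Ω)} {p : ℝ≥0∞} [Fact (1 ≤ p)]
    {C : Submodule ℝ (Ω →ᵇ ℝ)} {Q : Measure[m] Ω} {X : L1c 𝒦 p} {Y : Ω → ℝ} (a : ℝ)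
    (h : IsVersion C Q X Y) : IsVersion C Q (a • X) (fun ω => a * Y ω) := by
  obtain ⟨f, hf, hX, hY⟩ := h.exists_seq
  refine IsVersion.of_seq (h.1.const_mul a) (fun n => C.smul_mem a (hf n)) (f := fun n => a • f n)
    (by simpa only [map_smul] using hX.const_smul a) ?_
  have h1 : Tendsto (fun n => ‖a‖ₑ * ∫⁻ ω, edist (f n ω) (Y ω) ∂Q) atTop (𝓝 0) := by
    have := ENNReal.Tendsto.const_mul (a := ‖a‖ₑ) hY (Or.inr enorm_ne_top)
    simpa using this
  refine h1.congr fun n => ?_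
  rw [← lintegral_const_mul' _ _ enorm_ne_top]
  refine lintegral_congr fun ω => ?_
  rw [edist_eq_enorm_sub, edist_eq_enorm_sub, ← enorm_mul, mul_sub]
  rfl

variable {Ω : Type*} [TopologicalSpace Ω] [MeasurableSpace Ω] [OpensMeasurableSpace Ω]
  {𝒦 : Set (ProbabilityMeasure Ω)} {p : ℝ≥0∞} [Fact (1 ≤ p)] {P : Measure Ω}

namespace InCanonicalClass

theorem isDominated (hP : InCanonicalClass 𝒦 p P) : IsDominated 𝒦 p ⊤ P where
  measurable f _ := f.continuous.measurable
  abs_mem _ _ := Submodule.mem_top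
  inDual := ⟨1, fun f _ => by simpa using hP.1 f⟩

variable [IsProbabilityMeasure P]

theorem isVersion (hP : InCanonicalClass 𝒦 p P) (X : L1c 𝒦 p) :
    IsVersion ⊤ P X (versionUnder ⊤ P X) := by
  refine isVersion_versionUnder hP.isDominated ?_
  have : toL1c 𝒦 p '' ((⊤ : Submodule ℝ (Ω →ᵇ ℝ)) : Set (Ω →ᵇ ℝ)) = Set.range (toL1c 𝒦 p) := by
    simp
  rw [this]
  exact denseRange_toL1c X

theorem isVersion_toL1c (hP : InCanonicalClass 𝒦 p P) (f : Ω →ᵇ ℝ) :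
    IsVersion ⊤ P (toL1c 𝒦 p f) f :=
  IsVersion.toL1c_of_mem hP.isDominated Submodule.mem_top

variable {X X' : L1c 𝒦 p} {Y Y' : Ω → ℝ}

theorem eq_of_ae_eq (hP : InCanonicalClass 𝒦 p P) (h : IsVersion ⊤ P X Y)
    (h' : IsVersion ⊤ P X' Y') (hY : Y =ᵐ[P] Y') : X = X' := by
  refine (hP.2 X X').1 ?_
  filter_upwards [(hP.isVersion X).ae_eq hP.isDominated h,
    (hP.isVersion X').ae_eq hP.isDominated h', hY] with ω h1 h2 h3
  rw [h1, h2, h3]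

/-- If `Y ≤ Y'` a.s., then `X' - X` and its positive part have a.s. equal versions, so they coincide
in the canonical class. The positive part lies in the closed cone because `C_b` is dense. -/
theorem lEq_iff (hP : InCanonicalClass 𝒦 p P) (h : IsVersion ⊤ P X Y)
    (h' : IsVersion ⊤ P X' Y') : L1c.LEq X X' ↔ ∀ᵐ ω ∂P, Y ω ≤ Y' ω := by
  have hsub := h'.sub hP.isDominated h
  constructor
  · intro hle
    have h0 : L1c.LEq 0 (X' - X) := by rwa [L1c.LEq, sub_zero]
    filter_upwards [hsub.ae_nonneg hP.isDominated h0] with ω hω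
    exact sub_nonneg.1 hω
  · intro hle
    have hθ : LipschitzWith 1 fun a : ℝ => max a 0 := LipschitzWith.id.max_const 0
    have h1 := hsub.map_comp hθ fun f _ => Submodule.mem_top
    have h2 : X' - X = L1c.map 𝒦 p (BoundedContinuousFunction.comp _ hθ) (X' - X) := by
      refine hP.eq_of_ae_eq hsub h1 ?_
      filter_upwards [hle] with ω hω
      rw [max_eq_left (sub_nonneg.2 hω)]
    rw [L1c.LEq, h2]
    refine (isPointwiseLipschitz_comp hθ).map_mem (C := Set.univ)
      (C' := {f : Ω →ᵇ ℝ | ∀ ω, 0 ≤ f ω}) (fun f _ ω => le_max_right _ _) ?_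
    rw [Set.image_univ]
    exact denseRange_toL1c _

theorem ae_le_of_lEq (hP : InCanonicalClass 𝒦 p P) (hle : L1c.LEq X X') (h : IsVersion ⊤ P X Y)
    (h' : IsVersion ⊤ P X' Y') : ∀ᵐ ω ∂P, Y ω ≤ Y' ω := (hP.lEq_iff h h').1 hle

end InCanonicalClass

end CanonicalOrder

/-! ### The σ-algebras generated by the restrictions -/

section Restriction

theorem ae_trim_iff_of_measurableSet {Ω : Type*} {m m0 : MeasurableSpace Ω} (hm : m ≤ m0)
    {μ : Measure[m0] Ω} {q : Ω → Prop} (hq : MeasurableSet[m] {ω | q ω}) :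
    (∀ᵐ ω ∂μ.trim hm, q ω) ↔ ∀ᵐ ω ∂μ, q ω := by
  rw [ae_iff, ae_iff, trim_measurableSet_eq hm]
  exact hq.compl

variable {Ω X : Type*} [TopologicalSpace Ω] [TopologicalSpace X] {π : Ω → X}

theorem measurable_sigmaOf_of_mem_cylinderFun {f : Ω →ᵇ ℝ} (hf : f ∈ cylinderFun π) :
    Measurable[sigmaOf π] f := by
  obtain ⟨g, hg⟩ := hf
  borelize X
  have h1 : Measurable[sigmaOf π] π := comap_measurable π
  have h2 : (f : Ω → ℝ) = g ∘ π := funext hg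
  rw [h2]
  exact g.continuous.measurable.comp h1

theorem sigmaOf_le [mΩ : MeasurableSpace Ω] [OpensMeasurableSpace Ω] (hπ : Continuous π) :
    sigmaOf π ≤ mΩ := by
  borelize X
  exact hπ.measurable.comap_le

theorem sigmaOf_mono {Ω X X' : Type*} [TopologicalSpace X] [TopologicalSpace X'] {π : Ω → X}
    {π' : Ω → X'} {r : X' → X}
    (hr : Continuous r) (hπ : ∀ ω, r (π' ω) = π ω) : sigmaOf π ≤ sigmaOf π' := by
  obtain rfl : r ∘ π' = π := funext hπ
  borelize X X'
  rw [sigmaOf, sigmaOf, ← MeasurableSpace.comap_comp]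
  exact MeasurableSpace.comap_mono hr.measurable.comap_le

theorem cylinderFun_mono {X' : Type*} [TopologicalSpace X'] {π' : Ω → X'} {r : X' → X}
    (hr : Continuous r) (hπ : ∀ ω, r (π' ω) = π ω) : cylinderFun π ≤ cylinderFun π' := by
  rintro f ⟨g, hg⟩
  exact ⟨g.compContinuous ⟨r, hr⟩, fun ω => by simp [hg, hπ]⟩

/-- The image measures on `X` are finite and agree on `C_b(X)`, hence are equal, and every set of
the σ-algebra is a preimage. -/
theorem ext_of_integral_cylinderFun [TopologicalSpace.PseudoMetrizableSpace X] (hπ : Continuous π)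
    {μ ν : Measure[sigmaOf π] Ω} [IsFiniteMeasure μ] [IsFiniteMeasure ν]
    (h : ∀ f ∈ cylinderFun π, ∫ ω, f ω ∂μ = ∫ ω, f ω ∂ν) : μ = ν := by
  borelize X
  let := TopologicalSpace.pseudoMetrizableSpacePseudoMetric X
  let : MeasurableSpace Ω := sigmaOf π
  have hm : Measurable π := comap_measurable π
  have hmap : μ.map π = ν.map π := by
    have : IsFiniteMeasure (μ.map π) := Measure.isFiniteMeasure_map μ π
    have : IsFiniteMeasure (ν.map π) := Measure.isFiniteMeasure_map ν π
    refine ext_of_forall_integral_eq_of_IsFiniteMeasure fun g => ?_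
    rw [integral_map hm.aemeasurable g.continuous.measurable.aestronglyMeasurable,
      integral_map hm.aemeasurable g.continuous.measurable.aestronglyMeasurable]
    exact h _ (compContinuous_mem_cylinderFun hπ g)
  refine @Measure.ext _ (sigmaOf π) _ _ fun A hA => ?_
  obtain ⟨B, hB, rfl⟩ := hA
  rw [← Measure.map_apply hm hB, ← Measure.map_apply hm hB, hmap]

/-- A function that is nonnegative when tested against the cylinder functions with values in
`[0,1]` is nonnegative almost everywhere. -/
theorem ae_nonneg_of_integral_cylinderFun [TopologicalSpace.PseudoMetrizableSpace X]
    (hπ : Continuous π) {μ : Measure[sigmaOf π] Ω} [IsFiniteMeasure μ] {G : Ω → ℝ}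
    (hGm : Measurable[sigmaOf π] G) (hG : Integrable G μ)
    (h : ∀ f ∈ cylinderFun π, (∀ ω, 0 ≤ f ω) → (∀ ω, f ω ≤ 1) → 0 ≤ ∫ ω, f ω * G ω ∂μ) :
    ∀ᵐ ω ∂μ, 0 ≤ G ω := by
  borelize X
  let := TopologicalSpace.pseudoMetrizableSpacePseudoMetric X
  let : MeasurableSpace Ω := sigmaOf π
  have hm : Measurable π := comap_measurable π
  have : IsFiniteMeasure (μ.map π) := Measure.isFiniteMeasure_map μ π
  obtain ⟨B, hB, hBG⟩ : MeasurableSet[sigmaOf π] {ω | G ω < 0} := hGm measurableSet_Iio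
  -- The indicator of `π⁻¹ F` is a limit of cylinder functions with values in `[0,1]`, so `∫ G ≥ 0`
  -- on this set, where `G < 0`. Inner regularity by closed sets then gives the same for `B`.
  have hcl : ∀ F ⊆ B, IsClosed F → μ.map π F = 0 := by
    intro F hFB hF
    rw [Measure.map_apply hm hF.measurableSet]
    have hFG : ∀ ω ∈ π ⁻¹' F, G ω < 0 := fun ω hω => by
      have : ω ∈ π ⁻¹' B := hFB hω
      rwa [hBG] at this
    have hFm : MeasurableSet[sigmaOf π] (π ⁻¹' F) := hm hF.measurableSet
    have hnn : 0 ≤ ∫ ω in π ⁻¹' F, G ω ∂μ := by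
      have hlim : Tendsto (fun n : ℕ => ∫ ω, (hF.apprSeq n (π ω) : ℝ) * G ω ∂μ) atTop
          (𝓝 (∫ ω, (π ⁻¹' F).indicator G ω ∂μ)) := by
        refine tendsto_integral_of_dominated_convergence (fun ω => ‖G ω‖) (fun n => ?_) hG.norm
          (fun n => ae_of_all _ fun ω => ?_) (ae_of_all _ fun ω => ?_)
        · have h1 : Measurable[sigmaOf π] fun ω => (hF.apprSeq n (π ω) : ℝ) :=
            (NNReal.continuous_coe.comp (hF.apprSeq n).continuous).measurable.comp hm
          exact h1.aestronglyMeasurable.mul hG.aestronglyMeasurable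
        · rw [norm_mul, Real.norm_of_nonneg (NNReal.coe_nonneg _)]
          refine mul_le_of_le_one_left (norm_nonneg _) ?_
          exact_mod_cast HasOuterApproxClosed.apprSeq_apply_le_one hF n (π ω)
        · have h1 := tendsto_pi_nhds.1 (HasOuterApproxClosed.tendsto_apprSeq hF) (π ω)
          have h2 : Tendsto (fun n => (hF.apprSeq n (π ω) : ℝ) * G ω) atTop
              (𝓝 (((F.indicator (fun _ => (1 : ℝ≥0)) (π ω) : ℝ≥0) : ℝ) * G ω)) :=
            ((NNReal.continuous_coe.tendsto _).comp h1).mul_const _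
          convert h2 using 2
          by_cases hω : π ω ∈ F
          · simp [hω]
          · simp [hω]
      rw [integral_indicator hFm] at hlim
      refine ge_of_tendsto' hlim fun n => ?_
      let g : X →ᵇ ℝ := BoundedContinuousFunction.ofNormedAddCommGroup
        (fun x => (hF.apprSeq n x : ℝ)) (NNReal.continuous_coe.comp (hF.apprSeq n).continuous) 1
        fun x => by
          rw [Real.norm_of_nonneg (NNReal.coe_nonneg _)]
          exact_mod_cast HasOuterApproxClosed.apprSeq_apply_le_one hF n x
      exact h _ (compContinuous_mem_cylinderFun hπ g) (fun ω => NNReal.coe_nonneg _)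
        fun ω => by exact_mod_cast HasOuterApproxClosed.apprSeq_apply_le_one hF n (π ω)
    have hneg : 0 ≤ᵐ[μ.restrict (π ⁻¹' F)] fun ω => -G ω :=
      (ae_restrict_iff' hFm).2 (ae_of_all _ fun ω hω => neg_nonneg.2 (hFG ω hω).le)
    have h0 : ∫ ω in π ⁻¹' F, -G ω ∂μ = 0 := by
      refine le_antisymm ?_ (integral_nonneg_of_ae hneg)
      rw [integral_neg]
      linarith
    have h1 := (integral_eq_zero_iff_of_nonneg_ae hneg hG.neg.integrableOn).1 h0
    have h2 := (ae_restrict_iff' hFm).1 h1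
    rw [ae_iff] at h2
    refine measure_mono_null ?_ h2
    intro ω hω hc
    exact (hFG ω hω).ne (neg_eq_zero.1 (hc hω))
  have hB0 : μ.map π B = 0 := by
    rw [hB.measure_eq_iSup_isClosed_of_ne_top (measure_ne_top _ _)]
    simp only [ENNReal.iSup_eq_zero]
    exact fun F hFB hF => hcl F hFB hF
  rw [Measure.map_apply hm hB, hBG] at hB0
  rw [ae_iff]
  simpa using hB0

end Restriction

/-! ### Positive linear forms and expected risk -/

section ExpectedRisk

variable {Ω Ωs Ωt : Type*} [TopologicalSpace Ω] [MeasurableSpace Ω] [OpensMeasurableSpace Ω]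
  [TopologicalSpace Ωs] [TopologicalSpace Ωt]
  {𝒦 : Set (ProbabilityMeasure Ω)} {p : ℝ≥0∞} [Fact (1 ≤ p)] {P : Measure Ω}
  [IsProbabilityMeasure P] {πs : Ω → Ωs} {πt : Ω → Ωt}

instance : CompleteSpace (L1cSub 𝒦 p πt) :=
  (Submodule.isClosed_topologicalClosure _).completeSpace_coe

/-- The cone of nonnegative elements of `L¹_t(c)`. -/
def L1cSub.positiveCone (hP : InCanonicalClass 𝒦 p P) (πt : Ω → Ωt) :
    PointedCone ℝ (L1cSub 𝒦 p πt) where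
  carrier := {Z | L1c.LEq 0 (Z : L1c 𝒦 p)}
  add_mem' := by
    intro Z Z' hZ hZ'
    have h0 := hP.isVersion_toL1c 0
    rw [map_zero] at h0
    refine (hP.lEq_iff h0 ((hP.isVersion Z).add hP.isDominated (hP.isVersion Z'))).2 ?_
    filter_upwards [hP.ae_le_of_lEq hZ h0 (hP.isVersion Z),
      hP.ae_le_of_lEq hZ' h0 (hP.isVersion Z')] with ω h1 h2
    exact add_nonneg h1 h2
  zero_mem' := (hP.lEq_iff (hP.isVersion 0) (hP.isVersion 0)).2 (ae_of_all _ fun _ => le_rfl)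
  smul_mem' := by
    rintro ⟨a, ha⟩ Z hZ
    have h0 := hP.isVersion_toL1c 0
    rw [map_zero] at h0
    refine (hP.lEq_iff h0 ((hP.isVersion Z).smul a)).2 ?_
    filter_upwards [hP.ae_le_of_lEq hZ h0 (hP.isVersion Z)] with ω h1
    exact mul_nonneg ha h1

theorem L1cSub.mem_positiveCone {hP : InCanonicalClass 𝒦 p P} {Z : L1cSub 𝒦 p πt} :
    Z ∈ L1cSub.positiveCone hP πt ↔ L1c.LEq 0 (Z : L1c 𝒦 p) := Iff.rfl

theorem L1cSub.isClosed_positiveCone (hP : InCanonicalClass 𝒦 p P) :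
    IsClosed (L1cSub.positiveCone hP πt : Set (L1cSub 𝒦 p πt)) := by
  have h : (L1cSub.positiveCone hP πt : Set (L1cSub 𝒦 p πt))
      = (fun Z : L1cSub 𝒦 p πt => (Z : L1c 𝒦 p) - 0) ⁻¹'
        closure (toL1c 𝒦 p '' {f | ∀ ω, 0 ≤ f ω}) := rfl
  rw [h]
  exact isClosed_closure.preimage (by fun_prop)

/-- A positive linear form on `L¹_t(c)` is continuous; it extends to a continuous linear form on
`L¹(c)`. -/
theorem L1cSub.exists_continuous_extension (hP : InCanonicalClass 𝒦 p P)
    (ℓ : L1cSub 𝒦 p πt →ₗ[ℝ] ℝ) 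
    (hℓ : ∀ Z : L1cSub 𝒦 p πt, L1c.LEq 0 (Z : L1c 𝒦 p) → 0 ≤ ℓ Z) :
    ∃ Λ : L1c 𝒦 p →L[ℝ] ℝ, ∀ Z : L1cSub 𝒦 p πt, Λ Z = ℓ Z := by
  have h0 : IsVersion ⊤ P (0 : L1c 𝒦 p) (fun _ => 0) := by
    have := hP.isVersion_toL1c 0
    rwa [map_zero] at this
  -- Otherwise there would be positive `z n → 0` with `ℓ (z n) > 1`, against semicontinuity of `ℓ`
  -- at `0` along positive increments.
  obtain ⟨n, hn⟩ : ∃ n : ℕ, ∀ Z : L1cSub 𝒦 p πt, L1c.LEq 0 (Z : L1c 𝒦 p) →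
      ‖Z‖ ≤ 1 / ((n : ℝ) + 1) → ℓ Z ≤ 1 := by
    by_contra! hcon
    choose z hz hznorm hzℓ using hcon
    obtain ⟨n, hn⟩ := exists_le_add_of_monotone_convex (L1cSub.isClosed_positiveCone hP)
      (h := ℓ) (ℓ.convexOn convex_univ) (fun x y hxy => by
        have := hℓ _ (L1cSub.mem_positiveCone.1 hxy)
        rw [map_sub] at this
        linarith) 0 hz
      (squeeze_zero (fun _ => norm_nonneg _) hznorm tendsto_one_div_add_atTop_nhds_zero_nat)
      one_pos
    rw [zero_add, map_zero, zero_add] at hn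
    exact absurd hn (not_le.2 (hzℓ n))
  have hn1 : (0 : ℝ) < n + 1 := by positivity
  have hbound : ∀ Z : L1cSub 𝒦 p πt, L1c.LEq 0 (Z : L1c 𝒦 p) → ℓ Z ≤ (n + 1) * ‖Z‖ := by
    intro Z hZ
    refine le_of_forall_pos_le_add fun ε hε => ?_
    -- Division by `b` brings `Z` into the ball of radius `1 / (n + 1)`; `ε` covers the case `Z =
    -- 0`.
    set b := (n + 1) * ‖Z‖ + ε with hb
    have hb0 : 0 < b := by positivity
    have h1 := hn (b⁻¹ • Z) ((L1cSub.positiveCone hP πt).smul_mem (inv_nonneg.2 hb0.le) hZ) (by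
      rw [norm_smul, Real.norm_of_nonneg (inv_nonneg.2 hb0.le), inv_mul_le_iff₀ hb0,
        mul_one_div, le_div_iff₀ hn1]
      linarith)
    rw [map_smul, smul_eq_mul, inv_mul_le_iff₀ hb0, mul_one] at h1
    exact h1
  have habs : ∀ Z : L1cSub 𝒦 p πt, ℓ Z ≤ (n + 1) * ‖Z‖ ∧ -ℓ Z ≤ (n + 1) * ‖Z‖ := by
    intro Z
    have hθ := isPointwiseLipschitz_comp (Ω := Ω) lipschitzWith_abs
    -- `W = |Z|` satisfies `W ± Z ≥ 0` and `‖W‖ ≤ ‖Z‖`, which extends the bound from the cone to all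
    -- `Z`.
    set W : L1cSub 𝒦 p πt := ⟨L1c.map 𝒦 p (BoundedContinuousFunction.comp _ lipschitzWith_abs) Z,
      hθ.map_mem_L1cSub (fun f hf => comp_mem_cylinderFun lipschitzWith_abs hf) Z.2⟩ with hW
    have hWv : IsVersion ⊤ P (W : L1c 𝒦 p) (fun ω => |versionUnder ⊤ P (Z : L1c 𝒦 p) ω|) :=
      (hP.isVersion Z).map_comp lipschitzWith_abs fun f _ => Submodule.mem_top
    have hWnorm : ‖W‖ ≤ ‖Z‖ := by
      have h1 := (hθ.lipschitzWith_map (𝒦 := 𝒦) (p := p)).dist_le_mul (Z : L1c 𝒦 p)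
        (toL1c 𝒦 p 0)
      rw [hθ.map_toL1c] at h1
      have h2 : BoundedContinuousFunction.comp _ lipschitzWith_abs (0 : Ω →ᵇ ℝ) = 0 := by
        ext ω; simp
      rw [h2, map_zero, dist_zero_right, dist_zero_right, NNReal.coe_one, one_mul] at h1
      exact h1
    have hW0 : L1c.LEq 0 (W : L1c 𝒦 p) := (hP.lEq_iff h0 hWv).2 (ae_of_all _ fun ω => abs_nonneg _)
    have h1 : L1c.LEq 0 ((W - Z : L1cSub 𝒦 p πt) : L1c 𝒦 p) :=
      (hP.lEq_iff h0 (hWv.sub hP.isDominated (hP.isVersion Z))).2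
        (ae_of_all _ fun ω => sub_nonneg.2 (le_abs_self _))
    have h2 : L1c.LEq 0 ((W + Z : L1cSub 𝒦 p πt) : L1c 𝒦 p) :=
      (hP.lEq_iff h0 (hWv.add hP.isDominated (hP.isVersion Z))).2
        (ae_of_all _ fun ω => by
          have := neg_abs_le (versionUnder ⊤ P (Z : L1c 𝒦 p) ω)
          linarith)
    have h3 := hℓ _ h1
    have h4 := hℓ _ h2
    rw [map_sub] at h3
    rw [map_add] at h4
    have h5 := (hbound W hW0).trans (mul_le_mul_of_nonneg_left hWnorm hn1.le)
    constructor <;> linarith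
  obtain ⟨Λ, hΛ, -⟩ := exists_extension_norm_eq (L1cSub 𝒦 p πt)
    (ℓ.mkContinuous (n + 1) fun Z => abs_le'.2 (habs Z))
  exact ⟨Λ, fun Z => hΛ Z⟩

/-- A monotone, translation invariant and convex map `L¹_t(c) → L¹_s(c)`. -/
structure IsConditionalRiskMeasure (ρ : L1cSub 𝒦 p πt → L1cSub 𝒦 p πs) : Prop where
  monotone : ∀ X Y : L1cSub 𝒦 p πt,
    L1c.LEq (X : L1c 𝒦 p) Y → L1c.LEq (ρ Y : L1c 𝒦 p) (ρ X)
  translation : ∀ (X Z : L1cSub 𝒦 p πt) (Y : L1cSub 𝒦 p πs),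
    (Z : L1c 𝒦 p) = X + Y → ρ Z = ρ X - Y
  convex : ∀ (X Y : L1cSub 𝒦 p πt) (a : ℝ), 0 ≤ a → a ≤ 1 →
    L1c.LEq (ρ (a • X + (1 - a) • Y) : L1c 𝒦 p) (a • ρ X + (1 - a) • ρ Y)

variable {ρ : L1cSub 𝒦 p πt → L1cSub 𝒦 p πs}

namespace IsConditionalRiskMeasure

theorem ae_antitone (hρ : IsConditionalRiskMeasure ρ) (hP : InCanonicalClass 𝒦 p P)
    {X Y : L1cSub 𝒦 p πt} (h : L1c.LEq (X : L1c 𝒦 p) Y) :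
    ∀ᵐ ω ∂P, versionUnder ⊤ P (ρ Y : L1c 𝒦 p) ω ≤ versionUnder ⊤ P (ρ X : L1c 𝒦 p) ω :=
  hP.ae_le_of_lEq (hρ.monotone X Y h) (hP.isVersion _) (hP.isVersion _)

theorem ae_convex (hρ : IsConditionalRiskMeasure ρ) (hP : InCanonicalClass 𝒦 p P)
    (X Y : L1cSub 𝒦 p πt) {a : ℝ} (ha : 0 ≤ a) (ha1 : a ≤ 1) :
    ∀ᵐ ω ∂P, versionUnder ⊤ P (ρ (a • X + (1 - a) • Y) : L1c 𝒦 p) ω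
      ≤ a * versionUnder ⊤ P (ρ X : L1c 𝒦 p) ω + (1 - a) * versionUnder ⊤ P (ρ Y : L1c 𝒦 p) ω :=
  hP.ae_le_of_lEq (hρ.convex X Y a ha ha1) (hP.isVersion _)
    (((hP.isVersion _).smul a).add hP.isDominated ((hP.isVersion _).smul (1 - a)))

theorem expectedRisk_antitone (hρ : IsConditionalRiskMeasure ρ) (hP : InCanonicalClass 𝒦 p P)
    {X Y : L1cSub 𝒦 p πt} (h : L1c.LEq (X : L1c 𝒦 p) Y) :
    expectedRisk P ρ Y ≤ expectedRisk P ρ X :=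
  integral_mono_ae (hP.isVersion _).1 (hP.isVersion _).1 (hρ.ae_antitone hP h)

theorem expectedRisk_convexOn (hρ : IsConditionalRiskMeasure ρ) (hP : InCanonicalClass 𝒦 p P) :
    ConvexOn ℝ Set.univ (expectedRisk P ρ) := by
  refine ⟨convex_univ, fun X _ Y _ a b ha hb hab => ?_⟩
  obtain rfl : b = 1 - a := by linarith
  have h1 := (hP.isVersion (ρ X)).1
  have h2 := (hP.isVersion (ρ Y)).1
  have := integral_mono_ae (hP.isVersion _).1 ((h1.const_mul a).add (h2.const_mul (1 - a)))
    (hρ.ae_convex hP X Y ha (by linarith))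
  simp only [Pi.add_apply] at this
  rw [integral_add (h1.const_mul a) (h2.const_mul _), integral_const_mul,
    integral_const_mul] at this
  exact this

theorem ae_translation (hρ : IsConditionalRiskMeasure ρ) (hP : InCanonicalClass 𝒦 p P)
    {X Z : L1cSub 𝒦 p πt} {Y : L1c 𝒦 p} (hY : Y ∈ L1cSub 𝒦 p πs) {y : Ω → ℝ}
    (hy : IsVersion ⊤ P Y y) (hZ : (Z : L1c 𝒦 p) = X + Y) :
    ∀ᵐ ω ∂P, versionUnder ⊤ P (ρ Z : L1c 𝒦 p) ω = versionUnder ⊤ P (ρ X : L1c 𝒦 p) ω - y ω := by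
  rw [hρ.translation X Z ⟨Y, hY⟩ hZ]
  exact (hP.isVersion _).ae_eq hP.isDominated ((hP.isVersion (ρ X)).sub hP.isDominated hy)

theorem expectedRisk_add (hρ : IsConditionalRiskMeasure ρ) (hP : InCanonicalClass 𝒦 p P)
    {X Z : L1cSub 𝒦 p πt} {Y : L1c 𝒦 p} (hY : Y ∈ L1cSub 𝒦 p πs) {y : Ω → ℝ}
    (hy : IsVersion ⊤ P Y y) (hZ : (Z : L1c 𝒦 p) = X + Y) :
    expectedRisk P ρ Z = expectedRisk P ρ X - ∫ ω, y ω ∂P := by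
  rw [expectedRisk, expectedRisk, integral_congr_ae (hρ.ae_translation hP hY hy hZ),
    integral_sub (hP.isVersion _).1 hy.1]

/-- The expected risk has a continuous positive subgradient (up to sign) at every point. -/
theorem exists_subgradient (hρ : IsConditionalRiskMeasure ρ) (hP : InCanonicalClass 𝒦 p P)
    (X : L1cSub 𝒦 p πt) :
    ∃ Λ : L1c 𝒦 p →L[ℝ] ℝ, (∀ Z ∈ L1cSub 𝒦 p πt, L1c.LEq 0 Z → 0 ≤ Λ Z) ∧
      ∀ D : L1cSub 𝒦 p πt, expectedRisk P ρ X - Λ D ≤ expectedRisk P ρ (X + D) := by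
  obtain ⟨ℓ, hℓ⟩ := _root_.exists_subgradient (hρ.expectedRisk_convexOn hP) X
  have hℓ' : ∀ D, expectedRisk P ρ X + ℓ D ≤ expectedRisk P ρ (X + D) := fun D => by
    simpa using hℓ (X + D)
  have hpos : ∀ Z : L1cSub 𝒦 p πt, L1c.LEq 0 (Z : L1c 𝒦 p) → 0 ≤ (-ℓ) Z := by
    intro Z hZ
    have h1 : L1c.LEq (X : L1c 𝒦 p) ((X + Z : L1cSub 𝒦 p πt) : L1c 𝒦 p) := by
      rw [L1c.LEq] at hZ ⊢
      simpa using hZ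
    have h2 := hρ.expectedRisk_antitone hP h1
    have h3 := hℓ' Z
    rw [LinearMap.neg_apply]
    linarith
  obtain ⟨Λ, hΛ⟩ := L1cSub.exists_continuous_extension hP (-ℓ) hpos
  refine ⟨Λ, fun Z hZ hZ0 => ?_, fun D => ?_⟩
  · rw [show Λ Z = (-ℓ) ⟨Z, hZ⟩ from hΛ ⟨Z, hZ⟩]
    exact hpos ⟨Z, hZ⟩ hZ0
  · rw [hΛ, LinearMap.neg_apply, sub_neg_eq_add]
    exact hℓ' D

end IsConditionalRiskMeasure

end ExpectedRisk

/-! ### Measures in the dual that extend the restriction of `P` -/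

section DualMeasures

variable {Ω Ωs Ωt : Type*} [TopologicalSpace Ω] [mΩ : MeasurableSpace Ω] [OpensMeasurableSpace Ω]
  [TopologicalSpace Ωs] [TopologicalSpace Ωt]
  {𝒦 : Set (ProbabilityMeasure Ω)} {p : ℝ≥0∞} [Fact (1 ≤ p)] {P : Measure Ω}
  {πs : Ω → Ωs} {πt : Ω → Ωt}

theorem L1cSub_mono (h : cylinderFun πs ≤ cylinderFun πt) : L1cSub 𝒦 p πs ≤ L1cSub 𝒦 p πt :=
  Submodule.topologicalClosure_mono (Submodule.map_mono h)

theorem mem_closure_of_mem_L1cSub {W : L1c 𝒦 p} (hW : W ∈ L1cSub 𝒦 p πt) :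
    W ∈ closure (toL1c 𝒦 p '' (cylinderFun πt : Set (Ω →ᵇ ℝ))) := by
  rwa [← L1cSub_coe, SetLike.mem_coe]

theorem isDominated_of_mem_dualMeasures {Q : Measure[sigmaOf πt] Ω}
    (hQ : Q ∈ dualMeasures 𝒦 p P πs πt) : IsDominated 𝒦 p (cylinderFun πt) Q where
  measurable _ hf := measurable_sigmaOf_of_mem_cylinderFun hf
  abs_mem _ hf := abs_mem_cylinderFun hf
  inDual := hQ.2.1

theorem trim_eq_of_mem_dualMeasures (hs : sigmaOf πs ≤ sigmaOf πt) (hb : sigmaOf πs ≤ mΩ)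
    {Q : Measure[sigmaOf πt] Ω} (hQ : Q ∈ dualMeasures 𝒦 p P πs πt) : Q.trim hs = P.trim hb := by
  refine @Measure.ext _ (sigmaOf πs) _ _ fun A hA => ?_
  rw [trim_measurableSet_eq hs hA, trim_measurableSet_eq hb hA, hQ.2.2 A hA]

/-- `Q` and `P` coincide on `𝓑_s`. This is how statements pass between `Q`-a.s. and `P`-a.s.,
although `Q` need not be absolutely continuous with respect to `P` on `𝓑_t`. -/
theorem ae_iff_of_mem_dualMeasures (hs : sigmaOf πs ≤ sigmaOf πt) (hb : sigmaOf πs ≤ mΩ)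
    {Q : Measure[sigmaOf πt] Ω} (hQ : Q ∈ dualMeasures 𝒦 p P πs πt) {q : Ω → Prop}
    (hq : MeasurableSet[sigmaOf πs] {ω | q ω}) : (∀ᵐ ω ∂Q, q ω) ↔ ∀ᵐ ω ∂P, q ω := by
  rw [← ae_trim_iff_of_measurableSet hs hq, ← ae_trim_iff_of_measurableSet hb hq,
    trim_eq_of_mem_dualMeasures hs hb hQ]

variable [IsProbabilityMeasure P]

/-- An element of `L¹_s(c)` has a `𝓑_s`-measurable version that does not depend on the measure. -/
theorem exists_isVersion_of_mem_L1cSub (hP : InCanonicalClass 𝒦 p P) (hs : sigmaOf πs ≤ sigmaOf πt)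
    (hC : cylinderFun πs ≤ cylinderFun πt) (hb : sigmaOf πs ≤ mΩ)
    {W : L1c 𝒦 p} (hW : W ∈ L1cSub 𝒦 p πs) :
    ∃ R, Measurable[sigmaOf πs] R ∧ IsVersion ⊤ P W R ∧
      ∀ Q ∈ dualMeasures 𝒦 p P πs πt, IsVersion (cylinderFun πt) Q W R := by
  have hm : ∀ f ∈ cylinderFun πs, Measurable[sigmaOf πs] f := fun f hf =>
    measurable_sigmaOf_of_mem_cylinderFun hf
  have hd : IsDominated 𝒦 p (cylinderFun πs) (P.trim hb) :=
    { measurable := hm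
      abs_mem := fun _ hf => abs_mem_cylinderFun hf
      inDual := ⟨1, fun f hf => by
        rw [← integral_trim hb (hm f hf).stronglyMeasurable, one_mul]
        exact hP.1 f⟩ }
  -- The version is built from `C_b(Ω_s)` under the restriction of `P` to `𝓑_s`, which is also the
  -- restriction of every `Q`.
  obtain ⟨R, hRm, hR⟩ := exists_isVersion hd (mem_closure_of_mem_L1cSub hW)
  refine ⟨R, hRm, hR.of_trim hb le_top hm hRm, fun Q hQ => ?_⟩
  rw [← trim_eq_of_mem_dualMeasures hs hb hQ] at hR
  exact hR.of_trim hs hC hm hRm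

/-- A continuous positive linear form that agrees with `E_P` on `C_b(Ω_s)` is the expectation under
a measure of `𝒬_{s,t}(P)`. -/
theorem exists_mem_dualMeasures [TopologicalSpace.PseudoMetrizableSpace Ωs]
    [TopologicalSpace.PseudoMetrizableSpace Ωt] (h𝒦 : IsCompact (closure 𝒦)) (hp : p ≠ ⊤)
    (hs : sigmaOf πs ≤ sigmaOf πt) (hC : cylinderFun πs ≤ cylinderFun πt)
    (hπs : Continuous πs) (hπt : Continuous πt) (Λ : L1c 𝒦 p →L[ℝ] ℝ)
    (hpos : ∀ Z ∈ L1cSub 𝒦 p πt, L1c.LEq 0 Z → 0 ≤ Λ Z)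
    (hΛ : ∀ f ∈ cylinderFun πs, Λ (toL1c 𝒦 p f) = ∫ ω, f ω ∂P) :
    ∃ Q ∈ dualMeasures 𝒦 p P πs πt,
      ∀ f ∈ cylinderFun πt, Λ (toL1c 𝒦 p f) = ∫ ω, f ω ∂Q := by
  have hb := sigmaOf_le hπs
  let J : (Ωt →ᵇ ℝ) →ₗ[ℝ] ℝ :=
    { toFun := fun g => Λ (toL1c 𝒦 p (g.compContinuous ⟨πt, hπt⟩))
      map_add' := fun g g' => by
        rw [← map_add, ← map_add]; rfl
      map_smul' := fun a g => by
        rw [RingHom.id_apply, ← map_smul, ← map_smul]; rfl }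
  have hJ : IsDaniell J πt :=
    { nonneg := fun g hg => hpos _ (toL1c_mem_L1cSub (compContinuous_mem_cylinderFun hπt g)) <| by
        rw [L1c.LEq, sub_zero]
        exact subset_closure ⟨g.compContinuous ⟨πt, hπt⟩, hg, rfl⟩
      tendsto_zero := fun g hanti hlim => by
        have h1 := (tendsto_capacity_zero h𝒦 hp
          (f := fun n => (g n).compContinuous ⟨πt, hπt⟩) hanti hlim).const_mul ‖Λ‖
        rw [mul_zero] at h1
        refine squeeze_zero_norm (fun n => ?_) h1
        rw [← norm_toL1c]
        exact Λ.le_opNorm _ }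
  obtain ⟨Q, hQf, hQ⟩ := hJ.exists_measure
  have hQΛ : ∀ f ∈ cylinderFun πt, Λ (toL1c 𝒦 p f) = ∫ ω, f ω ∂Q := by
    rintro f ⟨g, hg⟩
    have h1 : f = g.compContinuous ⟨πt, hπt⟩ := BoundedContinuousFunction.ext hg
    rw [h1]
    exact (hQ g).symm
  have htrim : Q.trim hs = P.trim hb := by
    have : IsFiniteMeasure (Q.trim hs) := isFiniteMeasure_trim hs
    have : IsFiniteMeasure (P.trim hb) := isFiniteMeasure_trim hb
    refine ext_of_integral_cylinderFun hπs fun f hf => ?_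
    have hm := (measurable_sigmaOf_of_mem_cylinderFun hf).stronglyMeasurable
    rw [← integral_trim hs hm, ← integral_trim hb hm, ← hQΛ f (hC hf), hΛ f hf]
  have hA : ∀ A, MeasurableSet[sigmaOf πs] A → Q A = P A := fun A hA => by
    rw [← trim_measurableSet_eq hs hA, ← trim_measurableSet_eq hb hA, htrim]
  refine ⟨Q, ⟨⟨?_⟩, ⟨‖Λ‖, fun f hf => ?_⟩, hA⟩, hQΛ⟩
  · rw [hA _ (@MeasurableSet.univ _ (sigmaOf πs)), measure_univ]
  · rw [← hQΛ f hf, ← norm_toL1c]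
    exact Λ.le_opNorm _

end DualMeasures

/-! ### Localization of the subgradient inequality -/

section Localization

variable {Ω Ωs Ωt : Type*} [TopologicalSpace Ω] [MeasurableSpace Ω] [OpensMeasurableSpace Ω]
  [TopologicalSpace Ωs] [TopologicalSpace Ωt]
  {𝒦 : Set (ProbabilityMeasure Ω)} {p : ℝ≥0∞} [Fact (1 ≤ p)] {P : Measure Ω}
  [IsProbabilityMeasure P] {πs : Ω → Ωs} {πt : Ω → Ωt}

/-- The action of a `1`-Lipschitz function on `L¹_t(c)`. -/
def L1cSub.comp {θ : ℝ → ℝ} (hθ : LipschitzWith 1 θ) (D : L1cSub 𝒦 p πt) : L1cSub 𝒦 p πt :=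
  ⟨L1c.map 𝒦 p (BoundedContinuousFunction.comp θ hθ) D,
    (isPointwiseLipschitz_comp hθ).map_mem_L1cSub (fun _ hf => comp_mem_cylinderFun hθ hf) D.2⟩

theorem L1cSub.isVersion_comp (hP : InCanonicalClass 𝒦 p P) {θ : ℝ → ℝ} (hθ : LipschitzWith 1 θ)
    (D : L1cSub 𝒦 p πt) : IsVersion ⊤ P (L1cSub.comp hθ D : L1c 𝒦 p)
      (fun ω => θ (versionUnder ⊤ P (D : L1c 𝒦 p) ω)) :=
  (hP.isVersion D).map_comp hθ fun _ _ => Submodule.mem_top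

theorem L1cSub.tendsto_comp {θ : ℕ → ℝ → ℝ} (hθ : ∀ n, LipschitzWith 1 (θ n))
    (hid : ∀ (n : ℕ) (a : ℝ), |a| ≤ n → θ n a = a) (D : L1cSub 𝒦 p πt) :
    Tendsto (fun n => L1cSub.comp (hθ n) D) atTop (𝓝 D) :=
  tendsto_subtype_rng.2 (tendsto_map_comp hθ hid (D : L1c 𝒦 p))

theorem const_mem_cylinderFun {Ω X : Type*} [TopologicalSpace Ω] [TopologicalSpace X] (π : Ω → X)
    (a : ℝ) :
    BoundedContinuousFunction.const Ω a ∈ cylinderFun π :=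
  ⟨BoundedContinuousFunction.const X a, fun _ => rfl⟩

namespace IsConditionalRiskMeasure

variable {ρ : L1cSub 𝒦 p πt → L1cSub 𝒦 p πs} {X D : L1cSub 𝒦 p πt} {f : Ω →ᵇ ℝ}

/-- A convex combination with coefficients that are close to a constant, for a bounded direction. -/
theorem ae_le_of_bounded_of_const (hρ : IsConditionalRiskMeasure ρ) (hP : InCanonicalClass 𝒦 p P)
    (hf : f ∈ cylinderFun πs) {M : ℝ} (hD : ∀ᵐ ω ∂P, |versionUnder ⊤ P (D : L1c 𝒦 p) ω| ≤ M)
    {Z : L1cSub 𝒦 p πt} (hC : cylinderFun πs ≤ cylinderFun πt)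
    (hZ : (Z : L1c 𝒦 p) = L1c.map 𝒦 p (fun g => f * g) D) {a : ℝ} (ha : 0 ≤ a) (ha1 : a ≤ 1) :
    ∀ᵐ ω ∂P, versionUnder ⊤ P (ρ (X + Z) : L1c 𝒦 p) ω
      ≤ a * versionUnder ⊤ P (ρ (X + D) : L1c 𝒦 p) ω
        + (1 - a) * versionUnder ⊤ P (ρ X : L1c 𝒦 p) ω + M * |f ω - a| := by
  -- Since `|D| ≤ M`, the error satisfies `(a - f) D ≤ M |f - a| = w`, so `a (X + D) + (1 - a) X ≤ X
  -- + f D + w`. As `w` belongs to `C_b(Ω_s)`, translation invariance takes it out of `ρ`.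
  set w : Ω →ᵇ ℝ := M • |f - BoundedContinuousFunction.const Ω a| with hw
  have hwC : w ∈ cylinderFun πs := (cylinderFun πs).smul_mem M
    (abs_mem_cylinderFun ((cylinderFun πs).sub_mem hf (const_mem_cylinderFun πs a)))
  have hwv := hP.isVersion_toL1c (𝒦 := 𝒦) (p := p) w
  have hZv : IsVersion ⊤ P (Z : L1c 𝒦 p) (fun ω => f ω * versionUnder ⊤ P (D : L1c 𝒦 p) ω) := by
    rw [hZ]
    exact (hP.isVersion D).map_mul f.continuous.measurable fun _ _ => Submodule.mem_top
  have hd := hP.isDominated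
  set V : L1cSub 𝒦 p πt := X + Z + ⟨toL1c 𝒦 p w, toL1c_mem_L1cSub (hC hwC)⟩ with hV
  have hle : L1c.LEq ((a • (X + D) + (1 - a) • X : L1cSub 𝒦 p πt) : L1c 𝒦 p) V := by
    refine (hP.lEq_iff ((((hP.isVersion X).add hd (hP.isVersion D)).smul a).add hd
      ((hP.isVersion X).smul (1 - a))) (((hP.isVersion X).add hd hZv).add hd hwv)).2 ?_
    filter_upwards [hD] with ω hω
    have h1 : w ω = M * |f ω - a| := rfl
    rw [h1]
    have h2 : (a - f ω) * versionUnder ⊤ P (D : L1c 𝒦 p) ω ≤ M * |f ω - a| := by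
      refine (le_abs_self _).trans ?_
      rw [abs_mul, abs_sub_comm, mul_comm]
      exact mul_le_mul_of_nonneg_right hω (abs_nonneg _)
    linarith
  filter_upwards [hρ.ae_antitone hP hle, hρ.ae_convex hP (X + D) X ha ha1,
    hρ.ae_translation hP (X := X + Z) (Z := V) (toL1c_mem_L1cSub hwC) hwv rfl] with ω h1 h2 h3
  have h4 : w ω = M * |f ω - a| := rfl
  rw [h4] at h3
  linarith

/-- The inequality with constant coefficient holds a.s. for all rationals, clipped to `[0,1]`, at
once. By continuity in the coefficient it holds for `a = f ω`, where the error `M |f ω - a|`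
vanishes. -/
theorem ae_le_of_bounded (hρ : IsConditionalRiskMeasure ρ) (hP : InCanonicalClass 𝒦 p P)
    (hf : f ∈ cylinderFun πs) (hf0 : ∀ ω, 0 ≤ f ω) (hf1 : ∀ ω, f ω ≤ 1) {M : ℝ}
    (hD : ∀ᵐ ω ∂P, |versionUnder ⊤ P (D : L1c 𝒦 p) ω| ≤ M)
    {Z : L1cSub 𝒦 p πt} (hC : cylinderFun πs ≤ cylinderFun πt)
    (hZ : (Z : L1c 𝒦 p) = L1c.map 𝒦 p (fun g => f * g) D) :
    ∀ᵐ ω ∂P, versionUnder ⊤ P (ρ (X + Z) : L1c 𝒦 p) ω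
      ≤ f ω * versionUnder ⊤ P (ρ (X + D) : L1c 𝒦 p) ω
        + (1 - f ω) * versionUnder ⊤ P (ρ X : L1c 𝒦 p) ω := by
  have h := ae_all_iff.2 fun q : ℚ => hρ.ae_le_of_bounded_of_const hP (X := X) hf hD hC hZ
    (a := max 0 (min (q : ℝ) 1)) (le_max_left _ _) (max_le zero_le_one (min_le_right _ _))
  filter_upwards [h] with ω hω
  have h1 : ∀ b : ℝ, versionUnder ⊤ P (ρ (X + Z) : L1c 𝒦 p) ω
      ≤ max 0 (min b 1) * versionUnder ⊤ P (ρ (X + D) : L1c 𝒦 p) ω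
        + (1 - max 0 (min b 1)) * versionUnder ⊤ P (ρ X : L1c 𝒦 p) ω
        + M * |f ω - max 0 (min b 1)| := fun b => by
    refine Rat.denseRange_cast.induction_on b (isClosed_le ?_ ?_) hω <;> fun_prop
  have h2 := h1 (f ω)
  rwa [min_eq_left (hf1 ω), max_eq_right (hf0 ω), sub_self, abs_zero, mul_zero, add_zero] at h2

theorem integrable_mul (hP : InCanonicalClass 𝒦 p P) (f : Ω →ᵇ ℝ) (W : L1c 𝒦 p) :
    Integrable (fun ω => f ω * versionUnder ⊤ P W ω) P :=
  (hP.isVersion W).1.bdd_mul (c := ‖f‖) f.continuous.measurable.aestronglyMeasurable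
    (ae_of_all _ fun ω => f.norm_coe_le_norm ω)

variable {Λ : L1c 𝒦 p →L[ℝ] ℝ}

/-- The subgradient inequality in the direction `f D`, combined with the conditional convexity of
`ae_le_of_bounded`. -/
theorem integral_mul_sub_le_of_bounded (hρ : IsConditionalRiskMeasure ρ)
    (hP : InCanonicalClass 𝒦 p P) (hC : cylinderFun πs ≤ cylinderFun πt)
    (hΛ : ∀ D : L1cSub 𝒦 p πt, expectedRisk P ρ X - Λ D ≤ expectedRisk P ρ (X + D))
    (hf : f ∈ cylinderFun πs) (hf0 : ∀ ω, 0 ≤ f ω) (hf1 : ∀ ω, f ω ≤ 1) {M : ℝ}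
    (hD : ∀ᵐ ω ∂P, |versionUnder ⊤ P (D : L1c 𝒦 p) ω| ≤ M) :
    ∫ ω, f ω * (versionUnder ⊤ P (ρ X : L1c 𝒦 p) ω
      - versionUnder ⊤ P (ρ (X + D) : L1c 𝒦 p) ω) ∂P ≤ Λ (L1c.map 𝒦 p (fun g => f * g) D) := by
  set Z : L1cSub 𝒦 p πt := ⟨L1c.map 𝒦 p (fun g => f * g) D,
    (isPointwiseLipschitz_mul f).map_mem_L1cSub
      (fun _ hg => mul_mem_cylinderFun (hC hf) hg) D.2⟩ with hZ
  have h1 := hρ.ae_le_of_bounded hP (X := X) hf hf0 hf1 hD (Z := Z) hC rfl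
  have hi1 := integrable_mul hP f (ρ X : L1c 𝒦 p)
  have hi2 := integrable_mul hP f (ρ (X + D) : L1c 𝒦 p)
  have hi3 := (hP.isVersion (ρ X : L1c 𝒦 p)).1
  have h2 : expectedRisk P ρ (X + Z) ≤ ∫ ω, versionUnder ⊤ P (ρ X : L1c 𝒦 p) ω
      - (f ω * versionUnder ⊤ P (ρ X : L1c 𝒦 p) ω
        - f ω * versionUnder ⊤ P (ρ (X + D) : L1c 𝒦 p) ω) ∂P := by
    refine integral_mono_ae (hP.isVersion _).1 (hi3.sub (hi1.sub hi2)) ?_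
    filter_upwards [h1] with ω hω
    linarith
  have hi4 : Integrable (fun ω => f ω * versionUnder ⊤ P (ρ X : L1c 𝒦 p) ω
      - f ω * versionUnder ⊤ P (ρ (X + D) : L1c 𝒦 p) ω) P := hi1.sub hi2
  rw [integral_sub hi3 hi4] at h2
  have h3 := hΛ Z
  simp only [mul_sub]
  rw [expectedRisk] at h3
  linarith

theorem ae_antitone_add (hρ : IsConditionalRiskMeasure ρ) (hP : InCanonicalClass 𝒦 p P)
    {D' : L1cSub 𝒦 p πt}
    (h : ∀ᵐ ω ∂P, versionUnder ⊤ P (D : L1c 𝒦 p) ω ≤ versionUnder ⊤ P (D' : L1c 𝒦 p) ω) :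
    ∀ᵐ ω ∂P, versionUnder ⊤ P (ρ (X + D') : L1c 𝒦 p) ω
      ≤ versionUnder ⊤ P (ρ (X + D) : L1c 𝒦 p) ω := by
  refine hρ.ae_antitone hP ((hP.lEq_iff ((hP.isVersion X).add hP.isDominated (hP.isVersion D))
    ((hP.isVersion X).add hP.isDominated (hP.isVersion D'))).2 ?_)
  filter_upwards [h] with ω hω
  linarith

/-- The truncations `min D n` increase to `D`, so `ρ` at them lies above `ρ (X + D)`, which is the
unfavourable side. The excess is controlled in expectation by `exists_le_add_of_monotone_convex`,
and multiplication by `f ≤ 1` only reduces it. -/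
theorem integral_mul_sub_le_of_bddBelow (hρ : IsConditionalRiskMeasure ρ)
    (hP : InCanonicalClass 𝒦 p P) (hC : cylinderFun πs ≤ cylinderFun πt)
    (hΛ : ∀ D : L1cSub 𝒦 p πt, expectedRisk P ρ X - Λ D ≤ expectedRisk P ρ (X + D))
    (hf : f ∈ cylinderFun πs) (hf0 : ∀ ω, 0 ≤ f ω) (hf1 : ∀ ω, f ω ≤ 1) {M : ℝ}
    (hD : ∀ᵐ ω ∂P, -M ≤ versionUnder ⊤ P (D : L1c 𝒦 p) ω) :
    ∫ ω, f ω * (versionUnder ⊤ P (ρ X : L1c 𝒦 p) ω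
      - versionUnder ⊤ P (ρ (X + D) : L1c 𝒦 p) ω) ∂P ≤ Λ (L1c.map 𝒦 p (fun g => f * g) D) := by
  have hθ : ∀ n : ℕ, LipschitzWith 1 fun a : ℝ => min a n := fun n =>
    LipschitzWith.id.min_const (n : ℝ)
  set T : ℕ → L1cSub 𝒦 p πt := fun n => L1cSub.comp (hθ n) D with hT
  have hTv : ∀ n, ∀ᵐ ω ∂P, versionUnder ⊤ P (T n : L1c 𝒦 p) ω
      = min (versionUnder ⊤ P (D : L1c 𝒦 p) ω) n := fun n =>
    (hP.isVersion _).ae_eq hP.isDominated (L1cSub.isVersion_comp hP (hθ n) D)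
  have hTD : ∀ n, ∀ᵐ ω ∂P, versionUnder ⊤ P (T n : L1c 𝒦 p) ω
      ≤ versionUnder ⊤ P (D : L1c 𝒦 p) ω := fun n => by
    filter_upwards [hTv n] with ω hω
    rw [hω]
    exact min_le_left _ _
  have hTlim : Tendsto T atTop (𝓝 D) := L1cSub.tendsto_comp hθ (fun n a ha => min_eq_left
    ((le_abs_self a).trans ha)) D
  have hT_le : ∀ n, ∫ ω, f ω * (versionUnder ⊤ P (ρ X : L1c 𝒦 p) ω
      - versionUnder ⊤ P (ρ (X + T n) : L1c 𝒦 p) ω) ∂P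
        ≤ Λ (L1c.map 𝒦 p (fun g => f * g) (T n)) := fun n =>
    hρ.integral_mul_sub_le_of_bounded hP hC hΛ hf hf0 hf1 (M := max M n) <| by
      filter_upwards [hTv n, hD] with ω h1 h2
      rw [h1, abs_le]
      refine ⟨?_, (min_le_right _ _).trans (le_max_right _ _)⟩
      have h3 : (0 : ℝ) ≤ n := Nat.cast_nonneg n
      exact le_min (by linarith [le_max_left M (n : ℝ)]) (by linarith [le_max_right M (n : ℝ)])
  have hΛlim : Tendsto (fun n => Λ (L1c.map 𝒦 p (fun g => f * g) (T n))) atTop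
      (𝓝 (Λ (L1c.map 𝒦 p (fun g => f * g) D))) := by
    have hc := ((isPointwiseLipschitz_mul f).lipschitzWith_map (𝒦 := 𝒦) (p := p)).continuous
    exact ((Λ.continuous.comp (hc.comp continuous_subtype_val)).tendsto D).comp hTlim
  refine le_of_forall_pos_le_add fun ε hε => ?_
  obtain ⟨N, hN⟩ := eventually_atTop.1 (hΛlim.eventually_lt_const
    (lt_add_of_pos_right _ (half_pos hε)))
  -- `Y ↦ E_P ρ(-Y)` is increasing and convex, and the increments `D - T (k + N)` are positive and
  -- tend to `0`. The shift by `N` keeps the chosen index where `Λ` is already close to its limit.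
  obtain ⟨k, hk⟩ := exists_le_add_of_monotone_convex (L1cSub.isClosed_positiveCone hP)
    (h := fun Y : L1cSub 𝒦 p πt => expectedRisk P ρ (-Y))
    ((hρ.expectedRisk_convexOn hP).comp_linearMap (-LinearMap.id))
    (fun Y Y' hY => hρ.expectedRisk_antitone hP (by
      have := L1cSub.mem_positiveCone.1 hY
      rw [L1c.LEq] at this ⊢
      simpa [sub_eq_add_neg, add_comm] using this)) (-(X + D)) (z := fun k => D - T (k + N))
    (fun k => (hP.lEq_iff ((map_zero (toL1c 𝒦 p)) ▸ hP.isVersion_toL1c 0)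
      ((hP.isVersion D).sub hP.isDominated (hP.isVersion (T (k + N))))).2 (by
        filter_upwards [hTD (k + N)] with ω hω
        exact sub_nonneg.2 hω))
    (by
      have := (tendsto_const_nhds (x := D)).sub (hTlim.comp (tendsto_add_atTop_nat N))
      rw [sub_self] at this
      simpa using this.norm) (half_pos hε)
  have h1 : -(-(X + D) + (D - T (k + N))) = X + T (k + N) := by abel
  rw [h1, neg_neg] at hk
  set n := k + N with hn
  have hi := fun W => integrable_mul (𝒦 := 𝒦) (p := p) hP f W
  have hi' := fun W => (hP.isVersion (𝒦 := 𝒦) (p := p) W).1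
  have h2 : ∫ ω, (f ω * versionUnder ⊤ P (ρ (X + T n) : L1c 𝒦 p) ω
      - f ω * versionUnder ⊤ P (ρ (X + D) : L1c 𝒦 p) ω) ∂P
        ≤ ∫ ω, (versionUnder ⊤ P (ρ (X + T n) : L1c 𝒦 p) ω
          - versionUnder ⊤ P (ρ (X + D) : L1c 𝒦 p) ω) ∂P := by
    refine integral_mono_ae ((hi _).sub (hi _)) ((hi' _).sub (hi' _)) ?_
    filter_upwards [hρ.ae_antitone_add hP (X := X) (hTD n)] with ω hω
    rw [← mul_sub]
    exact mul_le_of_le_one_left (sub_nonneg.2 hω) (hf1 ω)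
  rw [integral_sub (hi _) (hi _), integral_sub (hi' _) (hi' _)] at h2
  have h3 := hT_le n
  have h4 := hN n (Nat.le_add_left N k)
  simp only [mul_sub] at h3 ⊢
  rw [integral_sub (hi _) (hi _)] at h3 ⊢
  rw [expectedRisk, expectedRisk] at hk
  linarith

/-- The subgradient inequality at `X`, localized by a function of `C_b(Ω_s)`. -/
theorem integral_mul_sub_le (hρ : IsConditionalRiskMeasure ρ)
    (hP : InCanonicalClass 𝒦 p P) (hC : cylinderFun πs ≤ cylinderFun πt)
    (hΛ : ∀ D : L1cSub 𝒦 p πt, expectedRisk P ρ X - Λ D ≤ expectedRisk P ρ (X + D))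
    (hf : f ∈ cylinderFun πs) (hf0 : ∀ ω, 0 ≤ f ω) (hf1 : ∀ ω, f ω ≤ 1) (D : L1cSub 𝒦 p πt) :
    ∫ ω, f ω * (versionUnder ⊤ P (ρ X : L1c 𝒦 p) ω
      - versionUnder ⊤ P (ρ (X + D) : L1c 𝒦 p) ω) ∂P ≤ Λ (L1c.map 𝒦 p (fun g => f * g) D) := by
  have hθ : ∀ n : ℕ, LipschitzWith 1 fun a : ℝ => max a (-n) := fun n =>
    LipschitzWith.id.max_const (-(n : ℝ))
  set T : ℕ → L1cSub 𝒦 p πt := fun n => L1cSub.comp (hθ n) D with hT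
  have hTv : ∀ n, ∀ᵐ ω ∂P, versionUnder ⊤ P (T n : L1c 𝒦 p) ω
      = max (versionUnder ⊤ P (D : L1c 𝒦 p) ω) (-n) := fun n =>
    (hP.isVersion _).ae_eq hP.isDominated (L1cSub.isVersion_comp hP (hθ n) D)
  have hTlim : Tendsto T atTop (𝓝 D) := L1cSub.tendsto_comp hθ (fun n a ha => max_eq_left
    (abs_le.1 ha).1) D
  have hΛlim : Tendsto (fun n => Λ (L1c.map 𝒦 p (fun g => f * g) (T n))) atTop
      (𝓝 (Λ (L1c.map 𝒦 p (fun g => f * g) D))) := by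
    have hc := ((isPointwiseLipschitz_mul f).lipschitzWith_map (𝒦 := 𝒦) (p := p)).continuous
    exact ((Λ.continuous.comp (hc.comp continuous_subtype_val)).tendsto D).comp hTlim
  -- Now `T n ≥ D`, hence `ρ (X + T n) ≤ ρ (X + D)`: the left side for `D` is below that for `T n`,
  -- and only the right side needs a limit.
  refine ge_of_tendsto' hΛlim fun n => ?_
  refine le_trans ?_ (hρ.integral_mul_sub_le_of_bddBelow hP hC hΛ hf hf0 hf1 (M := n) (D := T n) ?_)
  · have hi := fun W => integrable_mul (𝒦 := 𝒦) (p := p) hP f W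
    simp only [mul_sub]
    refine integral_mono_ae ((hi _).sub (hi _)) ((hi _).sub (hi _)) ?_
    filter_upwards [hρ.ae_antitone_add hP (X := X) (D := D) (D' := T n) (by
      filter_upwards [hTv n] with ω hω
      rw [hω]
      exact le_max_left _ _)] with ω hω
    exact sub_le_sub_left (mul_le_mul_of_nonneg_left hω (hf0 ω)) _
  · filter_upwards [hTv n] with ω hω
    rw [hω]
    exact le_max_right _ _

end IsConditionalRiskMeasure

end Localization

/-! ### Conditional expectations -/

section CondExp

variable {Ω : Type*} {m m0 : MeasurableSpace Ω} {μ : Measure[m0] Ω} [IsFiniteMeasure μ]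

theorem integral_mul_condExp (hm : m ≤ m0) {f g : Ω → ℝ} (hf : StronglyMeasurable[m] f)
    (hfg : Integrable (fun ω => f ω * g ω) μ) (hg : Integrable g μ) :
    ∫ ω, f ω * (μ[g | m]) ω ∂μ = ∫ ω, f ω * g ω ∂μ := by
  rw [← integral_condExp hm (f := fun ω => f ω * g ω)]
  exact integral_congr_ae (condExp_mul_of_stronglyMeasurable_left hf hfg hg).symm

theorem condExp_neg_of_ae_eq_add (hm : m ≤ m0) {x y R : Ω → ℝ} (hx : Integrable x μ)
    (hRm : Measurable[m] R) (hR : Integrable R μ) (hy : ∀ᵐ ω ∂μ, y ω = x ω + R ω) :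
    ∀ᵐ ω ∂μ, (μ[fun ω => -y ω | m]) ω = (μ[fun ω => -x ω | m]) ω - R ω := by
  have h1 : (fun ω => -y ω) =ᵐ[μ] (fun ω => -x ω) - R := by
    filter_upwards [hy] with ω hω
    rw [hω, Pi.sub_apply]
    ring
  filter_upwards [condExp_congr_ae (m := m) h1, condExp_sub hx.neg hR m] with ω h2 h3
  rw [h2]
  refine h3.trans ?_
  rw [Pi.sub_apply, condExp_of_stronglyMeasurable hm hRm.stronglyMeasurable hR]
  rfl

end CondExp

/-! ### The robust representation -/

section Representation

variable {Ω Ωs Ωt : Type*} [TopologicalSpace Ω] [mΩ : MeasurableSpace Ω] [OpensMeasurableSpace Ω]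
  [TopologicalSpace Ωs] [TopologicalSpace Ωt]
  {𝒦 : Set (ProbabilityMeasure Ω)} {p : ℝ≥0∞} [Fact (1 ≤ p)] {P : Measure Ω}
  {πs : Ω → Ωs} {πt : Ω → Ωt} {Q : Measure[sigmaOf πt] Ω}

theorem measurable_condNegExp (X : L1cSub 𝒦 p πt) :
    Measurable[sigmaOf πs] (condNegExp πs Q X) :=
  stronglyMeasurable_condExp.measurable

theorem isVersion_of_mem_dualMeasures (hQ : Q ∈ dualMeasures 𝒦 p P πs πt) (X : L1cSub 𝒦 p πt) :
    IsVersion (cylinderFun πt) Q (X : L1c 𝒦 p) (versionUnder (cylinderFun πt) Q (X : L1c 𝒦 p)) := by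
  have := hQ.1
  exact isVersion_versionUnder (isDominated_of_mem_dualMeasures hQ) (mem_closure_of_mem_L1cSub X.2)

theorem condNegExp_add (hs : sigmaOf πs ≤ sigmaOf πt) (hQ : Q ∈ dualMeasures 𝒦 p P πs πt)
    {X Y : L1cSub 𝒦 p πt} {W : L1c 𝒦 p} {R : Ω → ℝ} (hRm : Measurable[sigmaOf πs] R)
    (hR : IsVersion (cylinderFun πt) Q W R) (hY : (Y : L1c 𝒦 p) = X + W) :
    ∀ᵐ ω ∂Q, condNegExp πs Q Y ω = condNegExp πs Q X ω - R ω := by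
  have := hQ.1
  have hd := isDominated_of_mem_dualMeasures hQ
  have hX := isVersion_of_mem_dualMeasures hQ X
  refine condExp_neg_of_ae_eq_add hs hX.1 hRm hR.1 ?_
  refine (isVersion_of_mem_dualMeasures hQ Y).ae_eq hd ?_
  rw [hY]
  exact hX.add hd hR

theorem isEssSupFamily_minimalPenalty (hs : sigmaOf πs ≤ sigmaOf πt) [IsFiniteMeasure Q]
    (ρ : L1cSub 𝒦 p πt → L1cSub 𝒦 p πs) :
    IsEssSupFamily (sigmaOf πs) Q
      {g | ∃ X ∈ acceptanceSet ρ, g = fun ω => (condNegExp πs Q X ω : EReal)}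
      (minimalPenalty ρ Q) := by
  refine isEssSupFamily_essSupFamily (exists_isEssSupFamily hs Q ?_)
  rintro _ ⟨X, -, rfl⟩
  exact measurable_coe_real_ereal.comp (measurable_condNegExp X)

/-- Rearrangement with a penalty that may be `+∞`, in which case the difference is `-∞`. -/
theorem sub_le_of_sub_le_coe {a b : ℝ} {x : EReal} (h : ((a - b : ℝ) : EReal) ≤ x) :
    (a : EReal) - x ≤ b := by
  induction x with
  | bot => exact absurd (le_bot_iff.1 h) (EReal.coe_ne_bot _)
  | top => simp
  | coe x =>
    norm_cast at h ⊢
    linarith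

namespace IsConditionalRiskMeasure

variable {ρ : L1cSub 𝒦 p πt → L1cSub 𝒦 p πs}

/-- The penalty dominates `E_Q(-X | 𝓑_s) - ρ(X)`. -/
theorem ae_sub_le_minimalPenalty (hρ : IsConditionalRiskMeasure ρ)
    (hs : sigmaOf πs ≤ sigmaOf πt) (hb : sigmaOf πs ≤ mΩ) (hC : cylinderFun πs ≤ cylinderFun πt)
    (hQ : Q ∈ dualMeasures 𝒦 p P πs πt) (X : L1cSub 𝒦 p πt) {R : Ω → ℝ}
    (hRm : Measurable[sigmaOf πs] R) (hR : IsVersion (cylinderFun πt) Q (ρ X : L1c 𝒦 p) R) :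
    ∀ᵐ ω ∂P, ((condNegExp πs Q X ω - R ω : ℝ) : EReal) ≤ minimalPenalty ρ Q ω := by
  have := hQ.1
  have hα := isEssSupFamily_minimalPenalty hs (Q := Q) ρ
  refine (ae_iff_of_mem_dualMeasures hs hb hQ (measurableSet_le
    (measurable_coe_real_ereal.comp ((measurable_condNegExp X).sub hRm)) hα.1)).1 ?_
  -- `X + ρ(X)` has risk `0`, so it is one of the positions in the supremum defining the penalty.
  set A : L1cSub 𝒦 p πt := X + ⟨ρ X, L1cSub_mono hC (ρ X).2⟩ with hA
  have hacc : A ∈ acceptanceSet ρ := by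
    have h0 : ρ A = 0 := by rw [hρ.translation X A (ρ X) rfl, sub_self]
    rw [acceptanceSet, Set.mem_ofPred_eq, h0, L1c.LEq]
    refine subset_closure ⟨0, fun _ => le_rfl, ?_⟩
    simp
  filter_upwards [hα.2.1 _ ⟨A, hacc, rfl⟩,
    condNegExp_add hs hQ hRm hR (X := X) (Y := A) rfl] with ω h1 h2
  rwa [h2] at h1

variable [IsProbabilityMeasure P] [TopologicalSpace.PseudoMetrizableSpace Ωs]
  [TopologicalSpace.PseudoMetrizableSpace Ωt]

/-- A measure that is a subgradient of the expected risk at `X`, localized by functions of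
`C_b(Ω_s)`. -/
theorem exists_localized_subgradient (hρ : IsConditionalRiskMeasure ρ) (hP : InCanonicalClass 𝒦 p P)
    (h𝒦 : IsCompact (closure 𝒦)) (hp : p ≠ ⊤) (hs : sigmaOf πs ≤ sigmaOf πt)
    (hC : cylinderFun πs ≤ cylinderFun πt) (hπs : Continuous πs) (hπt : Continuous πt)
    (X : L1cSub 𝒦 p πt) :
    ∃ Q ∈ dualMeasures 𝒦 p P πs πt, ∀ f ∈ cylinderFun πs, (∀ ω, 0 ≤ f ω) → (∀ ω, f ω ≤ 1) →
      ∀ (D : L1cSub 𝒦 p πt) (q : Ω → ℝ), IsVersion (cylinderFun πt) Q (D : L1c 𝒦 p) q →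
        ∫ ω, f ω * (versionUnder ⊤ P (ρ X : L1c 𝒦 p) ω
          - versionUnder ⊤ P (ρ (X + D) : L1c 𝒦 p) ω) ∂P ≤ ∫ ω, f ω * q ω ∂Q := by
  obtain ⟨Λ, hpos, hΛ⟩ := hρ.exists_subgradient hP X
  -- In the direction `f` translation invariance computes the expected risk exactly. Using `-f` as
  -- well gives `Λ f = E_P f`.
  have hle : ∀ f ∈ cylinderFun πs, ∫ ω, f ω ∂P ≤ Λ (toL1c 𝒦 p f) := fun f hf => by
    have h1 := hΛ ⟨toL1c 𝒦 p f, toL1c_mem_L1cSub (hC hf)⟩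
    rw [hρ.expectedRisk_add hP (Z := X + _) (toL1c_mem_L1cSub hf) (hP.isVersion_toL1c f) rfl] at h1
    exact (sub_le_sub_iff_left _).1 h1
  obtain ⟨Q, hQ, hQΛ⟩ := exists_mem_dualMeasures (P := P) h𝒦 hp hs hC hπs hπt Λ hpos
    fun f hf => by
      refine le_antisymm ?_ (hle f hf)
      have h1 := hle (-f) ((cylinderFun πs).neg_mem hf)
      rw [map_neg, map_neg] at h1
      simp only [BoundedContinuousFunction.coe_neg, Pi.neg_apply, integral_neg] at h1
      linarith
  have := hQ.1
  refine ⟨Q, hQ, fun f hf hf0 hf1 D q hq => ?_⟩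
  refine (hρ.integral_mul_sub_le hP hC hΛ hf hf0 hf1 D).trans (le_of_eq ?_)
  exact (hq.map_mul (measurable_sigmaOf_of_mem_cylinderFun (hC hf))
    fun _ hg => mul_mem_cylinderFun (hC hf) hg).map_eq_integral
      (isDominated_of_mem_dualMeasures hQ) Λ.continuous hQΛ

/-- A measure under which `E_Q(-X | 𝓑_s) - ρ(X)` dominates `E_Q(-Y | 𝓑_s) - ρ(Y)` for all `Y`. -/
theorem exists_ae_condNegExp_sub_le (hρ : IsConditionalRiskMeasure ρ) (hP : InCanonicalClass 𝒦 p P)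
    (h𝒦 : IsCompact (closure 𝒦)) (hp : p ≠ ⊤) (hs : sigmaOf πs ≤ sigmaOf πt)
    (hC : cylinderFun πs ≤ cylinderFun πt) (hπs : Continuous πs) (hπt : Continuous πt)
    (X : L1cSub 𝒦 p πt) {R : Ω → ℝ} (hRm : Measurable[sigmaOf πs] R)
    (hR : IsVersion ⊤ P (ρ X : L1c 𝒦 p) R) :
    ∃ Q ∈ dualMeasures 𝒦 p P πs πt, ∀ (Y : L1cSub 𝒦 p πt) (R' : Ω → ℝ), Measurable[sigmaOf πs] R' →
      IsVersion ⊤ P (ρ Y : L1c 𝒦 p) R' →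
        ∀ᵐ ω ∂Q, condNegExp πs Q Y ω - R' ω ≤ condNegExp πs Q X ω - R ω := by
  obtain ⟨Q, hQ, hloc⟩ := hρ.exists_localized_subgradient hP h𝒦 hp hs hC hπs hπt X
  refine ⟨Q, hQ, fun Y R' hRm' hR' => ?_⟩
  have := hQ.1
  have hb := sigmaOf_le hπs
  have hd := isDominated_of_mem_dualMeasures hQ
  have htrim := trim_eq_of_mem_dualMeasures hs hb hQ
  have : IsFiniteMeasure (Q.trim hs) := isFiniteMeasure_trim hs
  have hvX := isVersion_of_mem_dualMeasures hQ X
  have hvY := isVersion_of_mem_dualMeasures hQ Y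
  have hRd : Measurable[sigmaOf πs] fun ω => R ω - R' ω := hRm.sub hRm'
  have hRP : Integrable (fun ω => R ω - R' ω) P := hR.1.sub hR'.1
  have hRt : Integrable (fun ω => R ω - R' ω) (Q.trim hs) := by
    rw [htrim]
    exact hRP.trim hb hRd.stronglyMeasurable
  have hRQ := integrable_of_integrable_trim hs hRt
  have hc : Measurable[sigmaOf πs] fun ω => condNegExp πs Q X ω - condNegExp πs Q Y ω :=
    (measurable_condNegExp X).sub (measurable_condNegExp Y)
  have hcX : Integrable (condNegExp πs Q X) Q := integrable_condExp
  have hcY : Integrable (condNegExp πs Q Y) Q := integrable_condExp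
  have hcQ : Integrable (fun ω => condNegExp πs Q X ω - condNegExp πs Q Y ω) Q :=
    hcX.sub hcY
  -- Testing `G` against `f` gives `E_Q(f (Y - X)) - E_P(f (ρ(X) - ρ(Y)))`, which the localized
  -- inequality with `D = Y - X` makes nonnegative.
  set G : Ω → ℝ := fun ω => (condNegExp πs Q X ω - condNegExp πs Q Y ω) - (R ω - R' ω) with hG
  have hGm : Measurable[sigmaOf πs] G := hc.sub hRd
  have key : ∀ᵐ ω ∂Q.trim hs, 0 ≤ G ω := by
    refine ae_nonneg_of_integral_cylinderFun hπs hGm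
      ((hcQ.sub hRQ).trim hs hGm.stronglyMeasurable) fun f hf hf0 hf1 => ?_
    have hfm := measurable_sigmaOf_of_mem_cylinderFun hf
    have hbdd : ∀ {g : Ω → ℝ}, Integrable g Q → Integrable (fun ω => f ω * g ω) Q := fun hg =>
      hg.bdd_mul (c := ‖f‖) (hfm.stronglyMeasurable.mono hs).aestronglyMeasurable
        (ae_of_all _ fun ω => f.norm_coe_le_norm ω)
    have h1 := hloc f hf hf0 hf1 (Y - X) _ (hvY.sub hd hvX)
    rw [add_sub_cancel] at h1
    have h2 : ∫ ω, f ω * (versionUnder ⊤ P (ρ X : L1c 𝒦 p) ω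
        - versionUnder ⊤ P (ρ Y : L1c 𝒦 p) ω) ∂P = ∫ ω, f ω * (R ω - R' ω) ∂Q := by
      have hfR : StronglyMeasurable[sigmaOf πs] fun ω => f ω * (R ω - R' ω) :=
        (hfm.mul hRd).stronglyMeasurable
      rw [integral_trim hs hfR, htrim, ← integral_trim hb hfR]
      refine integral_congr_ae ?_
      filter_upwards [(hP.isVersion _).ae_eq hP.isDominated hR,
        (hP.isVersion _).ae_eq hP.isDominated hR'] with ω h3 h4
      rw [h3, h4]
    have h3 : ∫ ω, f ω * (condNegExp πs Q X ω - condNegExp πs Q Y ω) ∂Q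
        = ∫ ω, f ω * (versionUnder (cylinderFun πt) Q (Y : L1c 𝒦 p) ω
          - versionUnder (cylinderFun πt) Q (X : L1c 𝒦 p) ω) ∂Q := by
      have h4 := integral_mul_condExp hs hfm.stronglyMeasurable (hbdd hvX.1.neg) hvX.1.neg
      have h5 := integral_mul_condExp hs hfm.stronglyMeasurable (hbdd hvY.1.neg) hvY.1.neg
      simp only [mul_sub]
      rw [integral_sub (hbdd hcX) (hbdd hcY),
        integral_sub (hbdd hvY.1) (hbdd hvX.1)]
      refine (congrArg₂ (· - ·) h4 h5).trans ?_
      simp only [Pi.neg_apply, mul_neg, integral_neg]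
      ring
    have hfG : StronglyMeasurable[sigmaOf πs] fun ω => f ω * G ω :=
      (hfm.mul hGm).stronglyMeasurable
    rw [← integral_trim hs hfG]
    simp only [hG, mul_sub (f _) (condNegExp πs Q X _ - condNegExp πs Q Y _)]
    rw [integral_sub (hbdd hcQ) (hbdd hRQ), h3, ← h2]
    exact sub_nonneg.2 h1
  filter_upwards [ae_of_ae_trim hs key] with ω hω
  simp only [hG] at hω
  linarith

/-- The robust representation of a conditional risk measure, with attained supremum. -/
theorem exists_eq_penalizedExp (hρ : IsConditionalRiskMeasure ρ) (hP : InCanonicalClass 𝒦 p P)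
    (h𝒦 : IsCompact (closure 𝒦)) (hp : p ≠ ⊤) (hs : sigmaOf πs ≤ sigmaOf πt)
    (hC : cylinderFun πs ≤ cylinderFun πt) (hπs : Continuous πs) (hπt : Continuous πt)
    (X : L1cSub 𝒦 p πt) :
    ∃ QX ∈ dualMeasures 𝒦 p P πs πt,
      (∀ᵐ ω ∂P, ((versionUnder ⊤ P (ρ X : L1c 𝒦 p) ω : ℝ) : EReal) = penalizedExp ρ X QX ω) ∧
      (∀ᵐ ω ∂P, ((versionUnder ⊤ P (ρ X : L1c 𝒦 p) ω : ℝ) : EReal) =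
        essSupFamily (sigmaOf πs) P
          {g | ∃ Q ∈ dualMeasures 𝒦 p P πs πt, g = penalizedExp ρ X Q} ω) := by
  have hb := sigmaOf_le hπs
  obtain ⟨R, hRm, hRP, hRQ⟩ := exists_isVersion_of_mem_L1cSub hP hs hC hb (ρ X).2
  have hRv := (hP.isVersion (ρ X)).ae_eq hP.isDominated hRP
  obtain ⟨QX, hQX, hmax⟩ := hρ.exists_ae_condNegExp_sub_le hP h𝒦 hp hs hC hπs hπt X hRm hRP
  have := hQX.1
  have hα := isEssSupFamily_minimalPenalty hs (Q := QX) ρ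
  have hcm : Measurable[sigmaOf πs] fun ω => ((condNegExp πs QX X ω - R ω : ℝ) : EReal) :=
    measurable_coe_real_ereal.comp ((measurable_condNegExp X).sub hRm)
  have hαle : ∀ᵐ ω ∂P, minimalPenalty ρ QX ω ≤ ((condNegExp πs QX X ω - R ω : ℝ) : EReal) := by
    refine (ae_iff_of_mem_dualMeasures hs hb hQX (measurableSet_le hα.1 hcm)).1
      (hα.2.2 _ hcm ?_)
    rintro _ ⟨Y, hY, rfl⟩
    obtain ⟨R', hRm', hRP', -⟩ := exists_isVersion_of_mem_L1cSub hP hs hC hb (ρ Y).2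
    have h0 : IsVersion ⊤ P (0 : L1c 𝒦 p) (0 : Ω →ᵇ ℝ) :=
      map_zero (toL1c 𝒦 p) ▸ hP.isVersion_toL1c 0
    -- Acceptability of `Y` means `ρ(Y) ≤ 0`, hence `E(-Y | 𝓑_s) ≤ E(-Y | 𝓑_s) - ρ(Y)`, and the
    -- maximality of `X` under `QX` applies.
    have hneg : ∀ᵐ ω ∂QX, R' ω ≤ 0 :=
      (ae_iff_of_mem_dualMeasures hs hb hQX (hRm' measurableSet_Iic)).2 (hP.ae_le_of_lEq hY hRP' h0)
    filter_upwards [hmax Y R' hRm' hRP', hneg] with ω h1 h2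
    exact EReal.coe_le_coe_iff.2 (by linarith)
  have hattained : ∀ᵐ ω ∂P, (R ω : EReal) = penalizedExp ρ X QX ω := by
    filter_upwards [hαle, hρ.ae_sub_le_minimalPenalty hs hb hC hQX X hRm (hRQ QX hQX)] with ω h1 h2
    rw [penalizedExp, le_antisymm h1 h2, ← EReal.coe_sub, sub_sub_cancel]
  -- The lower bound on penalties makes `R` an upper bound of the family, and attainment at `QX`
  -- makes it the least one.
  have hsup : IsEssSupFamily (sigmaOf πs) P
      {g | ∃ Q ∈ dualMeasures 𝒦 p P πs πt, g = penalizedExp ρ X Q} fun ω => (R ω : EReal) := by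
    refine ⟨measurable_coe_real_ereal.comp hRm, ?_, fun h _ hh => ?_⟩
    · rintro _ ⟨Q, hQ, rfl⟩
      filter_upwards [hρ.ae_sub_le_minimalPenalty hs hb hC hQ X hRm (hRQ Q hQ)] with ω hω
      exact sub_le_of_sub_le_coe hω
    · filter_upwards [hattained, hh _ ⟨QX, hQX, rfl⟩] with ω h1 h2
      rwa [h1]
  refine ⟨QX, hQX, ?_, ?_⟩
  · filter_upwards [hRv, hattained] with ω h1 h2
    rw [h1, h2]
  · filter_upwards [hRv, hsup.ae_eq (isEssSupFamily_essSupFamily ⟨_, hsup⟩)] with ω h1 h2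
    rw [h1, ← h2]

end IsConditionalRiskMeasure

end Representation

end

theorem mainTheorem11 (k : PathKind) (d : ℕ)
    (𝒦 : Set (ProbabilityMeasure (PathSpace k d ⊤))) (h𝒦 : IsCompact (closure 𝒦))
    (p : ℝ≥0∞) [Fact (1 ≤ p)] (hp : p ≠ ⊤)
    (P : Measure (PathSpace k d ⊤)) [IsProbabilityMeasure P] (hP : InCanonicalClass 𝒦 p P)
    (ρ : ∀ s t : ℝ≥0∞, L1cSub 𝒦 p (restrictPath k d t) → L1cSub 𝒦 p (restrictPath k d s))
    (hρ : IsDynamicRiskMeasure (restrictPath k d) ρ)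
    (s t : ℝ≥0∞) (hst : s ≤ t)
    (hnorm : expectedRisk P (ρ s t) 0 = 0)
    (hmaj : ∃ φ : L1cSub 𝒦 p (restrictPath k d t) → ℝ,
      IsSublinearRiskMeasure (L1cSub 𝒦 p (restrictPath k d t)) φ ∧
        ∀ X, expectedRisk P (ρ s t) X ≤ φ X)
    (X : L1cSub 𝒦 p (restrictPath k d t)) :
    ∃ QX ∈ dualMeasures 𝒦 p P (restrictPath k d s) (restrictPath k d t),
      (∀ᵐ ω ∂P, ((versionUnder ⊤ P (ρ s t X : L1c 𝒦 p) ω : ℝ) : EReal) =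
        penalizedExp (ρ s t) X QX ω) ∧
      (∀ᵐ ω ∂P, ((versionUnder ⊤ P (ρ s t X : L1c 𝒦 p) ω : ℝ) : EReal) =
        essSupFamily (sigmaOf (restrictPath k d s)) P
          {g | ∃ Q ∈ dualMeasures 𝒦 p P (restrictPath k d s) (restrictPath k d t),
            g = penalizedExp (ρ s t) X Q} ω) := by
  obtain ⟨r, hr, hπ⟩ := exists_continuous_restrictPath k d hst
  have hρst : IsConditionalRiskMeasure (ρ s t) :=
    ⟨hρ.monotone s t hst, hρ.translation s t hst, hρ.convex s t hst⟩
  exact hρst.exists_eq_penalizedExp hP h𝒦 hp (sigmaOf_mono hr hπ) (cylinderFun_mono hr hπ)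
    (continuous_restrictPath k d s) (continuous_restrictPath k d t) X
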